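/- Let $n\ge 1$, let $c_1<\dots<c_n$ be real numbers and $p_j=(0,0,c_j)\in\mathbb R^3$. Put $r_j=\sqrt{x^2+y^2+(z-c_j)^2}$ and $V=\frac12\sum_{j}\frac1{r_j}$. For $k=0,\dots,n$ let $U_k\subset\mathbb R^3$ be the complement of the $z$-axis together with the points $(0,0,z)$ with $c_k<z<c_{k+1}$ (where $c_0=-\infty$, $c_{n+1}=+\infty$). The toric Gibbons–Hawking space $M$ is the circle bundle over $\mathbb R^3\setminus\{p_1,\dots,p_n\}$ obtained from the trivial bundles over the $U_k$, with fibre coordinates $e^{i\varphi_k}$, by gluing $\varphi_k=\varphi_0-k\theta$, $\theta=\arg(x+iy)$, together with one added point over each $p_j$ (whose neighbourhoods are the preimages of neighbourhoods of $p_j$). Over $U_k$ it carries the metric and complex structure $$g=\tfrac1V(d\varphi_k+A_k)^2+V(dx^2+dy^2+dz^2),\qquad A_k=\sum_{j\le k}\frac{x\,dy-y\,dx}{2r_j(r_j+z-c_j)}-\sum_{j>k}\frac{x\,dy-y\,dx}{2r_j(r_j-(z-c_j))},$$ $J\partial_{\varphi}=V^{-1}\widehat{\partial_z}$, $J\widehat{\partial_x}=\widehat{\partial_y}$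 (hats are horizontal lifts). Write $\varphi=\varphi_0$, $z_1=\prod_j(r_j-(z-c_j))^{1/2}e^{i\varphi}$, $z_2=x+iy$. (1) Let $X_n$ be the space glued from $n$ copies of $\mathbb C^2$ with coordinates $(\alpha_i,\beta_i)$, $i=1,\dots,n$, by $\alpha_{i+1}=\alpha_i^2\beta_i$, $\beta_{i+1}=\alpha_i^{-1}$ (for $\alpha_i\ne0$). Then $X_n$ is the toric crepant resolution of $\mathbb C^2/\mathbb Z_n$, where $\mathbb Z_n$ acts by $\zeta\cdot(s,t)=(\zeta s,\zeta^{-1}t)$, $\zeta^n=1$: it is a complex manifold with a torus $(\mathbb C^*)^2$ acting with an open dense free orbit, and there is a proper equivariant morphism $X_n\to\mathbb C^2/\mathbb Z_n$ that is biholomorphic over the nonsingular locus and such that $ds\wedge dt$ pulls back to a form that extends to a nowhere vanishing holomorphic 2-form on $X_n$. (2) There is a homeomorphism $X_n\cong M$ (so that $M$ is covered by $n$ charts $\mathbb C^2$ with the above coordinate changes), with $\alpha_1=z_2/z_1$, $\beta_1=z_1$ over $U_0$, under which the $(\alpha_i,\beta_i)$ are smooth and holomorphic for $J$ on the bundle over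 $\mathbb R^3\setminus\{p_j\}$. The torus $T^2$ acts by $(e^{it_1},e^{it_2})\cdot(z_1,z_2)=(e^{it_1}z_1,e^{it_2}z_2)$, that is, by translating $\varphi$ by $t_1$ and rotating $(x,y)$ by $t_2$. (3) The metric $g$ extends to a smooth Ricci-flat Kähler metric on $X_n$. There are constants $C_1,C_2$ such that its Kähler form is $\omega=i\partial\bar\partial\psi^\vee$ with $$\psi^\vee=-\sum_{j}c_j\log(r_j-(z-c_j))+C_1\mu_1+C_2\mu_2$$ on the open dense set where all $r_j-(z-c_j)>0$, where $\mu_1=-z$, $\mu_2=\frac12\sum_j(r_j+z-c_j)$. (4) $(\mu_1,\mu_2)$ is a moment map of the $T^2$-action on all of $X_n$ ($d\mu_k=-\iota_{X_k}\omega$). Its image is the convex region given by $\mu_2+\sum_{j\le k}(\mu_1+c_j)\ge0$, $k=0,\dots,n$. The boundary of this region consists, consecutively, of a ray $L_1$, $n-1$ nondegenerate segments $L_2,\dots,L_n$ and a ray $L_{n+1}$, meeting at the vertices $P_i=(-c_i,\sum_{j<i}(c_i-c_j))$; $L_1$ starts at $P_1$ in direction $(1,0)$, $L_{i+1}=[P_i,P_{i+1}]$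 for $1\le i<n$, and $L_{n+1}$ starts at $P_n$ in direction $(-1,n)$. For $i=1,\dots,n$ the $\alpha_i$-axis $\{\beta_i=0\}$ is mapped onto $L_{i+1}$ (without its end point $P_{i+1}$ if $i<n$) and the $\beta_i$-axis $\{\alpha_i=0\}$ onto $L_i$ (without its end point $P_{i-1}$ if $i>1$). -/

import Mathlib

open scoped ContDiff

/-! ### The surface glued from `n` copies of `ℂ²` -/

/-- The gluing map `(α, β) ↦ (α² β, α⁻¹)` from one copy of `ℂ²` to the next. -/
noncomputable def chartTransition (x : ℂ × ℂ) : ℂ × ℂ := (x.1 ^ 2 * x.2, x.1⁻¹)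

/-- The point `(α, β)` of the `i`-th copy of `ℂ²`, with `α ≠ 0`, is identified with the point
`(α² β, α⁻¹)` of the next copy. -/
def glueRel (n : ℕ) (a b : Fin n × (ℂ × ℂ)) : Prop :=
  a.1.val + 1 = b.1.val ∧ a.2.1 ≠ 0 ∧ b.2 = chartTransition a.2

/-- The space obtained by gluing `n` copies of `ℂ²`, with the quotient topology. -/
def GluedSurface (n : ℕ) : Type := Quot (glueRel n)

instance (n : ℕ) : TopologicalSpace (GluedSurface n) :=
  inferInstanceAs (TopologicalSpace (Quot (glueRel n)))

/-- The inclusion of the `i`-th copy of `ℂ²`; its argument is `(α_i, β_i)`. -/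
def GluedSurface.incl {n : ℕ} (i : Fin n) (x : ℂ × ℂ) : GluedSurface n :=
  Quot.mk (glueRel n) (i, x)

/-- The torus action in the copy of `ℂ²` with (zero-based) index `i`.  In terms of the coordinates
`z₁ = β₀`, `z₂ = α₀ β₀` one has `α_i = z₂ ^ (i + 1) / z₁`, `β_i = z₁ / z₂ ^ i`, and the action is
`(l₁, l₂) · (z₁, z₂) = (l₁ z₁, l₂ z₂)`. -/
noncomputable def chartTorusAct (i : ℕ) (l₁ l₂ : ℂ) (x : ℂ × ℂ) : ℂ × ℂ :=
  (l₂ ^ (i + 1) * l₁⁻¹ * x.1, l₁ * (l₂ ^ i)⁻¹ * x.2)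

theorem glueRel_chartTorusAct {n : ℕ} (l : ℂˣ × ℂˣ) (a b : Fin n × (ℂ × ℂ))
    (h : glueRel n a b) :
    glueRel n (a.1, chartTorusAct a.1 l.1 l.2 a.2) (b.1, chartTorusAct b.1 l.1 l.2 b.2) := by
  obtain ⟨i, x⟩ := a
  obtain ⟨j, y⟩ := b
  obtain ⟨h1, h2, h3⟩ := h
  simp only at h1 h2 h3
  have e1 : (l.1 : ℂ) ≠ 0 := l.1.ne_zero
  have e2 : (l.2 : ℂ) ≠ 0 := l.2.ne_zero
  refine ⟨h1, ?_, ?_⟩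
  · simp [chartTorusAct, h2]
  · subst h3
    simp only [chartTorusAct, chartTransition, ← h1]
    ext
    · field_simp
      ring
    · field_simp

/-- The action of the algebraic torus `(ℂ^*)²` on the glued surface. -/
noncomputable instance (n : ℕ) : MulAction (ℂˣ × ℂˣ) (GluedSurface n) where
  smul l := Quot.map (fun a => (a.1, chartTorusAct a.1 l.1 l.2 a.2)) (glueRel_chartTorusAct l)
  one_smul := by
    rintro ⟨i, x⟩
    change Quot.mk _ _ = Quot.mk _ _
    simp [chartTorusAct]
  mul_smul := by
    rintro l m ⟨i, x⟩
    change Quot.mk _ _ = Quot.mk _ _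
    congr 2
    simp only [chartTorusAct, Prod.fst_mul, Prod.snd_mul, Units.val_mul, mul_pow, mul_inv]
    ext <;> ring

/-! ### The orbifold `ℂ² / ℤ_n` and its toric crepant resolution -/

/-- Two points of `ℂ²` are in the same orbit of `ℤ_n`, acting by `ζ · (s, t) = (ζ s, ζ⁻¹ t)` for
`ζ ^ n = 1`. -/
def cyclicRel (n : ℕ) (p q : ℂ × ℂ) : Prop :=
  ∃ ζ : ℂ, ζ ^ n = 1 ∧ q = (ζ * p.1, ζ⁻¹ * p.2)

/-- The quotient `ℂ² / ℤ_n`, with the quotient topology. -/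
def CyclicQuotient (n : ℕ) : Type := Quot (cyclicRel n)

instance (n : ℕ) : TopologicalSpace (CyclicQuotient n) :=
  inferInstanceAs (TopologicalSpace (Quot (cyclicRel n)))

/-- The quotient map `ℂ² → ℂ² / ℤ_n`. -/
def CyclicQuotient.mk (n : ℕ) (p : ℂ × ℂ) : CyclicQuotient n := Quot.mk (cyclicRel n) p

/-- The preimage in `ℂ²` of the nonsingular locus of `ℂ² / ℤ_n`: the complement of the origin if
`n ≠ 1`, and everything if `n = 1`. -/
def regularLocus (n : ℕ) : Set (ℂ × ℂ) := {p | p ≠ 0 ∨ n = 1}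

/-- `π` makes the glued surface the toric crepant resolution of `ℂ² / ℤ_n`. -/
structure IsToricCrepantResolution (n : ℕ) (π : GluedSurface n → CyclicQuotient n) : Prop where
  /-- the glued surface is a complex manifold: it is Hausdorff, the copies of `ℂ²` are open in it
  and cover it, and the coordinate changes are holomorphic -/
  hausdorff : T2Space (GluedSurface n)
  openEmbedding : ∀ i : Fin n, Topology.IsOpenEmbedding (GluedSurface.incl i)
  cover : ∀ y : GluedSurface n, ∃ i x, GluedSurface.incl i x = y
  transition : ∀ i j : Fin n, ∃ F : ℂ × ℂ → ℂ × ℂ,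
    DifferentiableOn ℂ F (GluedSurface.incl i ⁻¹' Set.range (GluedSurface.incl j)) ∧
    ∀ x ∈ GluedSurface.incl i ⁻¹' Set.range (GluedSurface.incl j),
      GluedSurface.incl j (F x) = GluedSurface.incl i x
  /-- `π` is a morphism to `ℂ² / ℤ_n = Spec ℂ[s, t]^{ℤ_n}`: the functions on `ℂ² / ℤ_n`, i.e. the
  invariant polynomials in `s` and `t`, are pulled back to polynomials in each `(α_i, β_i)` -/
  regular : ∀ f : MvPolynomial (Fin 2) ℂ,
    (∀ p q, cyclicRel n p q →
      MvPolynomial.eval ![p.1, p.2] f = MvPolynomial.eval ![q.1, q.2] f) →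
    ∀ i : Fin n, ∃ P : MvPolynomial (Fin 2) ℂ, ∀ x p : ℂ × ℂ,
      π (GluedSurface.incl i x) = CyclicQuotient.mk n p →
      MvPolynomial.eval ![x.1, x.2] P = MvPolynomial.eval ![p.1, p.2] f
  /-- `π` is proper -/
  proper : IsProperMap π
  /-- over the nonsingular locus `π` is bijective -/
  bijective : ∀ p ∈ regularLocus n, ∃! y, π y = CyclicQuotient.mk n p
  /-- over the nonsingular locus the inverse of `π` is holomorphic, and the pull-back of the
  generator `ds ∧ dt` of the canonical bundle of the nonsingular locus extends to a nowhere
  vanishing holomorphic 2-form `Ω_i dα_i ∧ dβ_i` on the glued surface -/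
  crepant : ∃ Ω : Fin n → ℂ × ℂ → ℂ,
    (∀ i, Differentiable ℂ (Ω i)) ∧ (∀ i x, Ω i x ≠ 0) ∧
    ∀ i : Fin n, ∃ F : ℂ × ℂ → ℂ × ℂ,
      DifferentiableOn ℂ F {p | p ∈ regularLocus n ∧
        ∃ x, π (GluedSurface.incl i x) = CyclicQuotient.mk n p} ∧
      ∀ p ∈ regularLocus n, (∃ x, π (GluedSurface.incl i x) = CyclicQuotient.mk n p) →
        π (GluedSurface.incl i (F p)) = CyclicQuotient.mk n p ∧
        Ω i (F p) * (fderiv ℂ F p).det = 1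
  /-- `π` is equivariant for the action of `(ℂ^*)²` on `ℂ² / ℤ_n` induced by
  `(a, b) · (s, t) = (a s, b t)` -/
  equivariant : ∀ (a b : ℂˣ) (y : GluedSurface n) (p : ℂ × ℂ), π y = CyclicQuotient.mk n p →
    π ((a ^ n, a * b) • y) = CyclicQuotient.mk n (a * p.1, b * p.2)
  /-- the torus acts on the glued surface with an open dense free orbit -/
  toric : ∃ y : GluedSurface n, IsOpen (MulAction.orbit (ℂˣ × ℂˣ) y) ∧
    Dense (MulAction.orbit (ℂˣ × ℂˣ) y) ∧ MulAction.stabilizer (ℂˣ × ℂˣ) y = ⊥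

/-! ### The toric Gibbons–Hawking space -/

/-- The point `p_j = (0, 0, c_j)` of `ℝ³`; points of `ℝ³` are written `(x, y, z)`. -/
def center {n : ℕ} (c : Fin n → ℝ) (j : Fin n) : ℝ × ℝ × ℝ := (0, 0, c j)

/-- The Euclidean distance `r_j` from `(x, y, z)` to `p_j`. -/
noncomputable def rad {n : ℕ} (c : Fin n → ℝ) (j : Fin n) (p : ℝ × ℝ × ℝ) : ℝ :=
  Real.sqrt (p.1 ^ 2 + p.2.1 ^ 2 + (p.2.2 - c j) ^ 2)

/-- The harmonic function `V = ½ ∑ 1 / r_j`. -/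
noncomputable def ghPotential {n : ℕ} (c : Fin n → ℝ) (p : ℝ × ℝ × ℝ) : ℝ :=
  1 / 2 * ∑ j, 1 / rad c j p

/-- The complex number `x + i y`. -/
def horiz (p : ℝ × ℝ × ℝ) : ℂ := ⟨p.1, p.2.1⟩

/-- The `k`-th patch of `ℝ³ ∖ {p_0, …, p_{n-1}}` (zero-based): the complement of the `z`-axis
together with the open interval between `p_{k-1}` and `p_k` on the axis (where `p_{-1}` and `p_n`
are at infinity). -/
def patch {n : ℕ} (c : Fin n → ℝ) (k : Fin (n + 1)) : Set (ℝ × ℝ × ℝ) :=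
  {p | horiz p ≠ 0 ∨
    ∀ j : Fin n, (j.val < k.val → c j < p.2.2) ∧ (k.val ≤ j.val → p.2.2 < c j)}

/-- The trivial circle bundles over the patches, with fibre coordinates `e^{i φ_k}`, are glued by
`φ_k = φ_0 - k θ`, where `θ` is the argument of `x + i y`. -/
def bundleRel {n : ℕ} (c : Fin n → ℝ) (a b : Σ k : Fin (n + 1), patch c k × Circle) : Prop :=
  (a.2.1 : ℝ × ℝ × ℝ) = b.2.1 ∧
    b.2.2 = a.2.2 * Circle.exp (Complex.arg (horiz a.2.1)) ^ ((a.1.val : ℤ) - (b.1.val : ℤ))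

/-- The principal circle bundle over `ℝ³ ∖ {p_j}` underlying the Gibbons–Hawking construction. -/
def GHBundle {n : ℕ} (c : Fin n → ℝ) : Type := Quot (bundleRel c)

/-- The toric Gibbons–Hawking space: the circle bundle over `ℝ³ ∖ {p_j}` together with one point
over each `p_j`. -/
def GHSpace {n : ℕ} (c : Fin n → ℝ) : Type := GHBundle c ⊕ Fin n

/-- The point with coordinates `(φ, x, y, z)` over the `k`-th patch, `e = e^{i φ}`. -/
def GHSpace.mk {n : ℕ} (c : Fin n → ℝ) (k : Fin (n + 1)) (p : patch c k) (e : Circle) :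
    GHSpace c :=
  Sum.inl (Quot.mk (bundleRel c) ⟨k, p, e⟩)

/-- The point over `p_j`. -/
def GHSpace.pt {n : ℕ} (c : Fin n → ℝ) (j : Fin n) : GHSpace c := Sum.inr j

/-- The quotient topology on the bundle; the preimages of the balls around `p_j` form a basis of
neighbourhoods of the point over `p_j`. -/
instance {n : ℕ} (c : Fin n → ℝ) : TopologicalSpace (GHSpace c) where
  IsOpen O :=
    (∀ k, IsOpen {a : patch c k × Circle | GHSpace.mk c k a.1 a.2 ∈ O}) ∧
    ∀ j, GHSpace.pt c j ∈ O → ∃ ε > 0, ∀ (k : Fin (n + 1)) (p : patch c k) (e : Circle),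
      dist (p : ℝ × ℝ × ℝ) (center c j) < ε → GHSpace.mk c k p e ∈ O
  isOpen_univ := ⟨fun k => by simp, fun j _ => ⟨1, one_pos, fun _ _ _ _ => trivial⟩⟩
  isOpen_inter := by
    rintro s t ⟨hs, hs'⟩ ⟨ht, ht'⟩
    refine ⟨fun k => (hs k).inter (ht k), fun j hj => ?_⟩
    obtain ⟨ε, hε, h⟩ := hs' j hj.1
    obtain ⟨δ, hδ, h'⟩ := ht' j hj.2
    exact ⟨min ε δ, lt_min hε hδ, fun k p e hp =>
      ⟨h k p e (hp.trans_le (min_le_left _ _)), h' k p e (hp.trans_le (min_le_right _ _))⟩⟩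
  isOpen_sUnion := by
    intro S hS
    refine ⟨fun k => ?_, ?_⟩
    · have : {a : patch c k × Circle | GHSpace.mk c k a.1 a.2 ∈ ⋃₀ S} =
          ⋃ O ∈ S, {a : patch c k × Circle | GHSpace.mk c k a.1 a.2 ∈ O} := by
        ext a
        simp
      rw [this]
      exact isOpen_biUnion fun O hO => (hS O hO).1 k
    · rintro j ⟨O, hO, hj⟩
      obtain ⟨ε, hε, h⟩ := (hS O hO).2 j hj
      exact ⟨ε, hε, fun k p e hp => ⟨O, hO, h k p e hp⟩⟩

/-- The projection `(x, y, z)` of the Gibbons–Hawking space to `ℝ³`. -/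
def GHSpace.proj {n : ℕ} (c : Fin n → ℝ) : GHSpace c → ℝ × ℝ × ℝ :=
  Sum.elim (Quot.lift (fun a => (a.2.1 : ℝ × ℝ × ℝ)) fun _ _ h => h.1) (center c)

/-- The connection form `dφ_k + α_k` over the `k`-th patch, evaluated at a vector with components
`(φ, x, y, z)`. -/
noncomputable def connectionForm {n : ℕ} (c : Fin n → ℝ) (k : Fin (n + 1)) (p : ℝ × ℝ × ℝ)
    (v : ℝ × ℝ × ℝ × ℝ) : ℝ :=
  v.1 + ∑ j : Fin n,
    if j.val < k.val then
      1 / 2 * ((p.1 * v.2.2.1 - p.2.1 * v.2.1) / (rad c j p * (rad c j p + (p.2.2 - c j))))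
    else
      -(1 / 2 * ((p.1 * v.2.2.1 - p.2.1 * v.2.1) / (rad c j p * (rad c j p - (p.2.2 - c j)))))

/-- The Gibbons–Hawking metric `V⁻¹ (dφ + α)² + V (dx² + dy² + dz²)`. -/
noncomputable def ghMetric {n : ℕ} (c : Fin n → ℝ) (k : Fin (n + 1)) (p : ℝ × ℝ × ℝ)
    (v w : ℝ × ℝ × ℝ × ℝ) : ℝ :=
  1 / ghPotential c p * (connectionForm c k p v * connectionForm c k p w) +
    ghPotential c p * (v.2.1 * w.2.1 + v.2.2.1 * w.2.2.1 + v.2.2.2 * w.2.2.2)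

/-- The horizontal lift of a vector of `ℝ³`. -/
noncomputable def horizontalLift {n : ℕ} (c : Fin n → ℝ) (k : Fin (n + 1)) (p : ℝ × ℝ × ℝ)
    (u : ℝ × ℝ × ℝ) : ℝ × ℝ × ℝ × ℝ :=
  (-connectionForm c k p (0, u), u)

/-- The complex structure with `J ∂_φ = V⁻¹ ∂_z^`, `J ∂_z^ = -V ∂_φ`, `J ∂_x^ = ∂_y^`,
`J ∂_y^ = -∂_x^`, where `^` denotes horizontal lifts. -/
noncomputable def ghJ {n : ℕ} (c : Fin n → ℝ) (k : Fin (n + 1)) (p : ℝ × ℝ × ℝ)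
    (v : ℝ × ℝ × ℝ × ℝ) : ℝ × ℝ × ℝ × ℝ :=
  (-(ghPotential c p * v.2.2.2), 0) +
    horizontalLift c k p (-v.2.2.1, v.2.1, 1 / ghPotential c p * connectionForm c k p v)

/-- The function `z₁ = ∏ (r_j - (z - c_j))^{1/2} e^{iφ}`, `e = e^{iφ}`. -/
noncomputable def ghZ₁ {n : ℕ} (c : Fin n → ℝ) (p : ℝ × ℝ × ℝ) (e : Circle) : ℂ :=
  ((∏ j, Real.sqrt (rad c j p - (p.2.2 - c j)) : ℝ) : ℂ) * (e : ℂ)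

/-- The rotation of `ℝ³` about the `z`-axis by the unit complex number `t`. -/
noncomputable def rotate (t : Circle) (p : ℝ × ℝ × ℝ) : ℝ × ℝ × ℝ :=
  (((t : ℂ) * horiz p).re, ((t : ℂ) * horiz p).im, p.2.2)

theorem rotate_mem {n : ℕ} (c : Fin n → ℝ) (k : Fin (n + 1)) (t : Circle) (p : patch c k) :
    rotate t p ∈ patch c k := by
  rcases p.2 with h | h
  · refine Or.inl ?_
    have : horiz (rotate t p) = (t : ℂ) * horiz p := by
      apply Complex.ext <;> rfl
    rw [this]
    exact mul_ne_zero t.coe_ne_zero h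
  · exact Or.inr h

/-! ### Kähler metrics, Ricci curvature -/

/-- A real bilinear form on the tangent spaces in each of the coordinate charts. -/
abbrev ChartTensor (n : ℕ) : Type := Fin n → ℂ × ℂ → (ℂ × ℂ) →L[ℝ] (ℂ × ℂ) →L[ℝ] ℝ

/-- The form `ω(v, w) = g(i v, w)`. -/
noncomputable def fundamentalForm (g : ℂ × ℂ → (ℂ × ℂ) →L[ℝ] (ℂ × ℂ) →L[ℝ] ℝ)
    (x v w : ℂ × ℂ) : ℝ :=
  g x (Complex.I • v) w

/-- `G` is a smooth Kähler metric on the glued surface. -/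
structure IsKahlerMetric (n : ℕ) (G : ChartTensor n) : Prop where
  smooth : ∀ i, ContDiff ℝ ∞ (G i)
  compatible : ∀ i j : Fin n, i.val + 1 = j.val → ∀ x : ℂ × ℂ, x.1 ≠ 0 → ∀ v w : ℂ × ℂ,
    G j (chartTransition x) (fderiv ℝ chartTransition x v) (fderiv ℝ chartTransition x w) =
      G i x v w
  symm : ∀ i x v w, G i x v w = G i x w v
  pos : ∀ i x v, v ≠ 0 → 0 < G i x v v
  hermitian : ∀ i x v w, G i x (Complex.I • v) (Complex.I • w) = G i x v w
  closed : ∀ i x u v w,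
    fderiv ℝ (fun y => fundamentalForm (G i) y v w) x u -
      fderiv ℝ (fun y => fundamentalForm (G i) y u w) x v +
      fderiv ℝ (fun y => fundamentalForm (G i) y u v) x w = 0

/-- The standard real basis of `ℂ²`. -/
noncomputable def realBasis : Fin 4 → ℂ × ℂ := ![(1, 0), (Complex.I, 0), (0, 1), (0, Complex.I)]

/-- The partial derivative along the `a`-th real coordinate of `ℂ² = ℝ⁴`. -/
noncomputable def partialD (a : Fin 4) (f : ℂ × ℂ → ℝ) (x : ℂ × ℂ) : ℝ :=
  fderiv ℝ f x (realBasis a)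

/-- The matrix `g_{ab}` of a metric in the real coordinates of `ℂ² = ℝ⁴`. -/
noncomputable def metricMatrix (g : ℂ × ℂ → (ℂ × ℂ) →L[ℝ] (ℂ × ℂ) →L[ℝ] ℝ) (x : ℂ × ℂ) :
    Matrix (Fin 4) (Fin 4) ℝ :=
  Matrix.of fun a b => g x (realBasis a) (realBasis b)

/-- The Christoffel symbols `Γ^k_{ab}` of the Levi-Civita connection. -/
noncomputable def christoffel (g : ℂ × ℂ → (ℂ × ℂ) →L[ℝ] (ℂ × ℂ) →L[ℝ] ℝ) (k a b : Fin 4)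
    (x : ℂ × ℂ) : ℝ :=
  1 / 2 * ∑ d, (metricMatrix g x)⁻¹ k d *
    (partialD a (fun y => metricMatrix g y b d) x + partialD b (fun y => metricMatrix g y a d) x -
      partialD d (fun y => metricMatrix g y a b) x)

/-- The components `R_{ab}` of the Ricci tensor. -/
noncomputable def ricci (g : ℂ × ℂ → (ℂ × ℂ) →L[ℝ] (ℂ × ℂ) →L[ℝ] ℝ) (a b : Fin 4)
    (x : ℂ × ℂ) : ℝ :=
  (∑ k, (partialD k (christoffel g k a b) x - partialD b (christoffel g k a k) x)) +
    ∑ k, ∑ d, (christoffel g k k d x * christoffel g d a b x -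
      christoffel g k b d x * christoffel g d a k x)

/-- The Ricci tensor of `G` vanishes. -/
def IsRicciFlat (n : ℕ) (G : ChartTensor n) : Prop := ∀ i a b x, ricci (G i) a b x = 0

/-- In the coordinates `(φ, x, y, z)` over each patch, the metric `G` (transported by `Φ`) is the
Gibbons–Hawking metric, and the chart coordinates `(α_i, β_i)` are smooth functions that are
holomorphic for the complex structure of the Gibbons–Hawking construction. -/
def IsGibbonsHawking {n : ℕ} (c : Fin n → ℝ) (Φ : GluedSurface n → GHSpace c)
    (G : ChartTensor n) : Prop :=
  ∀ (i : Fin n) (k : Fin (n + 1)), ∃ F : ℝ × ℝ × ℝ × ℝ → ℂ × ℂ,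
    ContDiffOn ℝ ∞ F {q | ∃ hq : q.2 ∈ patch c k,
      GHSpace.mk c k ⟨q.2, hq⟩ (Circle.exp q.1) ∈ Set.range (Φ ∘ GluedSurface.incl i)} ∧
    ∀ (q : ℝ × ℝ × ℝ × ℝ) (hq : q.2 ∈ patch c k),
      GHSpace.mk c k ⟨q.2, hq⟩ (Circle.exp q.1) ∈ Set.range (Φ ∘ GluedSurface.incl i) →
      Φ (GluedSurface.incl i (F q)) = GHSpace.mk c k ⟨q.2, hq⟩ (Circle.exp q.1) ∧
      (∀ v w, G i (F q) (fderiv ℝ F q v) (fderiv ℝ F q w) = ghMetric c k q.2 v w) ∧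
      ∀ v, fderiv ℝ F q (ghJ c k q.2 v) = Complex.I • fderiv ℝ F q v

/-! ### Kähler potential -/

/-- The coordinate vectors and coordinates of `ℂ²`. -/
noncomputable def complexBasis : Fin 2 → ℂ × ℂ := ![(1, 0), (0, 1)]

def coords (v : ℂ × ℂ) : Fin 2 → ℂ := ![v.1, v.2]

/-- The Wirtinger derivative with respect to the `a`-th complex coordinate. -/
noncomputable def wirtinger (a : Fin 2) (f : ℂ × ℂ → ℂ) (x : ℂ × ℂ) : ℂ :=
  (fderiv ℝ f x (complexBasis a) - Complex.I * fderiv ℝ f x (Complex.I • complexBasis a)) / 2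

/-- The Wirtinger derivative with respect to the conjugate of the `a`-th complex coordinate. -/
noncomputable def wirtingerBar (a : Fin 2) (f : ℂ × ℂ → ℂ) (x : ℂ × ℂ) : ℂ :=
  (fderiv ℝ f x (complexBasis a) + Complex.I * fderiv ℝ f x (Complex.I • complexBasis a)) / 2

/-- The 2-form `i ∂ ∂bar f = i ∑ ∂_a ∂bar_b f dζ_a ∧ dζbar_b`, evaluated on two vectors. -/
noncomputable def iDDbar (f : ℂ × ℂ → ℝ) (x v w : ℂ × ℂ) : ℂ :=
  Complex.I * ∑ a, ∑ b, wirtinger a (wirtingerBar b fun y => (f y : ℂ)) x *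
    (coords v a * (starRingEnd ℂ) (coords w b) - coords w a * (starRingEnd ℂ) (coords v b))

/-! ### Moment map -/

/-- The functions `μ₁ = -z` and `μ₂ = ½ ∑ (r_j + z - c_j)` on `ℝ³`. -/
noncomputable def mu {n : ℕ} (c : Fin n → ℝ) (p : ℝ × ℝ × ℝ) : ℝ × ℝ :=
  (-p.2.2, 1 / 2 * ∑ j, (rad c j p + (p.2.2 - c j)))

/-- The function `-∑ c_j log (r_j - (z - c_j)) + C₁ μ₁ + C₂ μ₂` on `ℝ³`. -/
noncomputable def kahlerPotential {n : ℕ} (c : Fin n → ℝ) (C₁ C₂ : ℝ) (p : ℝ × ℝ × ℝ) : ℝ :=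
  -(∑ j, c j * Real.log (rad c j p - (p.2.2 - c j))) + C₁ * (mu c p).1 + C₂ * (mu c p).2

/-- The vector fields on `ℂ²`, in the chart of index `i`, that generate the two circle actions
`(e^{it}, 1)` and `(1, e^{it})`. -/
noncomputable def torusField₁ (i : ℕ) (x : ℂ × ℂ) : ℂ × ℂ :=
  deriv (fun t : ℝ => chartTorusAct i (Circle.exp t) 1 x) 0

noncomputable def torusField₂ (i : ℕ) (x : ℂ × ℂ) : ℂ × ℂ :=
  deriv (fun t : ℝ => chartTorusAct i 1 (Circle.exp t) x) 0

/-- `m` is a moment map on the glued surface for the action of the compact torus: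
`dm_k = -ω(X_k, ·)`. -/
def IsMomentMap (n : ℕ) (G : ChartTensor n) (m : GluedSurface n → ℝ × ℝ) : Prop :=
  ∀ i : Fin n, ContDiff ℝ ∞ (fun x => m (GluedSurface.incl i x)) ∧
    ∀ x v, fderiv ℝ (fun x => m (GluedSurface.incl i x)) x v =
      (-fundamentalForm (G i) x (torusField₁ i x) v, -fundamentalForm (G i) x (torusField₂ i x) v)

/-- The linear functions `l_k = μ₂ + ∑_{j < k} (μ₁ + c_j)`, `k = 0, …, n` (with zero-based `j`). -/
noncomputable def facet {n : ℕ} (c : Fin n → ℝ) (k : Fin (n + 1)) (m : ℝ × ℝ) : ℝ :=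
  m.2 + ∑ j : Fin n, if j.val < k.val then m.1 + c j else 0

/-- The region `l_0 ≥ 0, …, l_n ≥ 0`. -/
def polygon {n : ℕ} (c : Fin n → ℝ) : Set (ℝ × ℝ) := {m | ∀ k, 0 ≤ facet c k m}

/-- The edge of the region on the line `l_k = 0`. -/
def edge {n : ℕ} (c : Fin n → ℝ) (k : Fin (n + 1)) : Set (ℝ × ℝ) :=
  {m | m ∈ polygon c ∧ facet c k m = 0}

/-- The point `(-c_i, ∑_{j < i} (c_i - c_j))`. -/
noncomputable def vertex {n : ℕ} (c : Fin n → ℝ) (i : Fin n) : ℝ × ℝ :=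
  (-c i, ∑ j : Fin n, if j.val < i.val then c i - c j else 0)

/-!
The proof rests on explicit coordinates. Put `a_j = r_j - (z - c_j)` and `b_j = r_j + (z - c_j)`, so
that `a_j b_j = x² + y² = |z₂|²` and `∏ a_j = |z₁|²`. In the chart of index `i` (counted from `0`)
one has `α = z₂ ^ (i + 1) / z₁` and `β = z₁ / z₂ ^ i`, hence `z₂ = α β`, and the height `z` solves
`|α|² ∏_{j > i} a_j = ∏_{j ≤ i} b_j` and `|β|² ∏_{j < i} b_j = ∏_{j ≥ i} a_j`. By monotonicity and
the intermediate value theorem there is exactly one solution (`IsHeight.unique`, `exists_isHeight`),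
on the axes of the chart as well as off them. So the chart determines a point of `ℝ³`, the phases of
`α` and `β` determine the point of the fibre, and the charts become open embeddings into the circle
bundle (`isOpenEmbedding_chartMap`) that fit together to the homeomorphism `ghHomeomorph`. By the
implicit function theorem the positive function `t` with `a_i = t |β|²`, `b_i = |α|² / t` is smooth
(`contDiff_scale`), and with it the height (`contDiff_height`).

The resolution is the map determined by `z₁ = s ^ n`, `z₂ = s t`. The functions `z₁`, `z₂` and
`z₂ ^ n / z₁` on the surface correspond to the generators `s ^ n`, `s t`, `t ^ n` of the invariants,
which embed the quotient in `ℂ³` as a closed subset; bounds on them bound a point in one of the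
charts, and this gives properness (`isProperMap_surfaceInv`, `isToricCrepantResolution`).

For the metric let `λ₁ = dz₁ / z₁`, `λ₂ = dz₂ / z₂`, `S = ½ ∑ b_j / r_j` and `η = λ₁ - S λ₂`. Off
the axes `η = -V dz + i (dφ + A)` (`potential_mul_fderiv_height`, `etaForm_fderiv_ghCoord`), so that
`g = V⁻¹ Re (η conj η) + V |z₂|² Re (λ₂ conj λ₂)` (`chartMetric_eq_logMetric`). Written in `(α, β)`, this is
a Hermitian form whose coefficients are smooth on the whole chart, since in them the singular terms
of `V` and `S` at `p_i` cancel, and whose determinant is `1` (`metric_det`). Every identity between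
the metric and other continuous data need therefore be proved only off the axes and follows
everywhere by density (`eq_of_eq_off_axes`, `eq_of_eq_off_axis`). Off the axes, the Kähler form is
`dμ₁ ∧ Im λ₁ + dμ₂ ∧ Im λ₂` (`fundamentalForm_eq_wedge`). As the `λ_k` are closed, so is this form;
contracting it with the generators of the torus action, on which `(λ₁, λ₂)` takes the values
`(i, 0)` and `(0, i)`, shows that `(μ₁, μ₂)` is a moment map (`moment_eq`). A Kähler metric whose
determinant in holomorphic coordinates is constant is Ricci-flat (`ricci_hermForm`). For `C₁ = n`,
`C₂ = 2` the function `ψ` satisfies `dψ = 2 Re (μ₁ λ₁ + μ₂ λ₂)` (`hasFDerivAt_chartPotential`), whence `i ∂ ∂bar ψ` is the Kähler form.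

The `k`-th facet function `μ₂ + ∑_{j < k} (μ₁ + c_j)` equals `½ ∑_{j < k} a_j + ½ ∑_{j ≥ k} b_j`
(`facet_mu`). It is nonnegative, and on the axis it vanishes exactly between the centers of index
`k - 1` and `k`, so the edges of the polygon are the images of the intervals into which the centers
divide the axis (`mem_edge_iff`); the axes of the charts lie over these intervals. At constant
height, `μ₂` increases from its value on the axis to infinity, so that the image is the whole
polygon (`exists_mu_eq`).
-/

/-! ### The functions `r_j ∓ (z - c_j)` and their partial products -/

/-- The function `r - s` with `r = √(R + s²)`; for `R = x² + y²` and `s = z - c_j` it is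
`r_j - (z - c_j)`. -/
noncomputable def rMinus (R s : ℝ) : ℝ := Real.sqrt (R + s ^ 2) - s

/-- The function `r + s` with `r = √(R + s²)`. -/
noncomputable def rPlus (R s : ℝ) : ℝ := Real.sqrt (R + s ^ 2) + s

theorem rPlus_eq_rMinus_neg (R s : ℝ) : rPlus R s = rMinus R (-s) := by
  simp [rPlus, rMinus]

theorem rMinus_eq_rPlus_neg (R s : ℝ) : rMinus R s = rPlus R (-s) := by
  simp [rPlus, rMinus, sub_eq_add_neg]

theorem rPlus_nonneg {R : ℝ} (hR : 0 ≤ R) (s : ℝ) : 0 ≤ rPlus R s := by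
  have : -s ≤ Real.sqrt (R + s ^ 2) := Real.le_sqrt_of_sq_le (by nlinarith)
  unfold rPlus; linarith

theorem rMinus_nonneg {R : ℝ} (hR : 0 ≤ R) (s : ℝ) : 0 ≤ rMinus R s := by
  rw [rMinus_eq_rPlus_neg]; exact rPlus_nonneg hR _

theorem rMinus_mul_rPlus {R : ℝ} (hR : 0 ≤ R) (s : ℝ) : rMinus R s * rPlus R s = R := by
  have h := Real.sq_sqrt (show 0 ≤ R + s ^ 2 by positivity)
  unfold rMinus rPlus; linear_combination h

theorem rPlus_pos_iff {R : ℝ} (hR : 0 ≤ R) (s : ℝ) : 0 < rPlus R s ↔ 0 < R ∨ 0 < s := by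
  constructor
  · intro h
    by_contra! hc
    have hR0 : R = 0 := le_antisymm hc.1 hR
    subst hR0
    simp [rPlus, Real.sqrt_sq_eq_abs, abs_of_nonpos hc.2] at h
  · rintro (h | h)
    · refine lt_of_le_of_ne (rPlus_nonneg hR s) fun h0 => ?_
      have := rMinus_mul_rPlus hR s
      rw [← h0] at this
      linarith
    · have := Real.sqrt_nonneg (R + s ^ 2)
      unfold rPlus; linarith

theorem rMinus_pos_iff {R : ℝ} (hR : 0 ≤ R) (s : ℝ) : 0 < rMinus R s ↔ 0 < R ∨ s < 0 := by
  rw [rMinus_eq_rPlus_neg, rPlus_pos_iff hR]; simp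

theorem sqrt_pos_of_rPlus_pos {R : ℝ} (hR : 0 ≤ R) {s : ℝ} (h : 0 < rPlus R s) :
    0 < R + s ^ 2 := by
  rcases (rPlus_pos_iff hR s).1 h with h | h <;> positivity

theorem sqrt_pos_of_rMinus_pos {R : ℝ} (hR : 0 ≤ R) {s : ℝ} (h : 0 < rMinus R s) :
    0 < R + s ^ 2 := by
  rw [rMinus_eq_rPlus_neg] at h
  simpa using sqrt_pos_of_rPlus_pos hR h

theorem rPlus_mono {R : ℝ} (hR : 0 ≤ R) {s s' : ℝ} (h : s ≤ s') : rPlus R s ≤ rPlus R s' := by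
  have h1 := Real.sq_sqrt (show 0 ≤ R + s ^ 2 by positivity)
  have h2 := Real.sq_sqrt (show 0 ≤ R + s' ^ 2 by positivity)
  have h3 := rPlus_nonneg hR s
  have h4 := rPlus_nonneg hR s'
  have h5 := Real.sqrt_nonneg (R + s ^ 2)
  have h6 := Real.sqrt_nonneg (R + s' ^ 2)
  have h7 := rMinus_nonneg hR s
  unfold rPlus rMinus at *
  by_contra! hc
  nlinarith

theorem rMinus_anti {R : ℝ} (hR : 0 ≤ R) {s s' : ℝ} (h : s ≤ s') : rMinus R s' ≤ rMinus R s := by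
  rw [rMinus_eq_rPlus_neg, rMinus_eq_rPlus_neg]
  exact rPlus_mono hR (neg_le_neg h)

theorem le_rMinus {R : ℝ} (hR : 0 ≤ R) (s : ℝ) : -(2 * s) ≤ rMinus R s := by
  have := rPlus_nonneg hR s
  unfold rPlus at this
  unfold rMinus; linarith

theorem le_rPlus {R : ℝ} (hR : 0 ≤ R) (s : ℝ) : 2 * s ≤ rPlus R s := by
  have := rMinus_nonneg hR s
  unfold rMinus at this
  unfold rPlus; linarith

theorem continuous_rPlus : Continuous fun q : ℝ × ℝ => rPlus q.1 q.2 := by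
  unfold rPlus; fun_prop

theorem continuous_rMinus : Continuous fun q : ℝ × ℝ => rMinus q.1 q.2 := by
  unfold rMinus; fun_prop

/-- If `√(R + s²)` is half of `a + b`, where `ab = R` and `b - a = 2 s`, then `r - s = a`. -/
theorem sqrt_eq_of_factors {a b R s : ℝ} (ha : 0 ≤ a) (hb : 0 ≤ b) (hR : a * b = R)
    (hs : b - a = 2 * s) : Real.sqrt (R + s ^ 2) = (a + b) / 2 := by
  have : R + s ^ 2 = ((a + b) / 2) ^ 2 := by
    have : s = (b - a) / 2 := by linarith
    rw [this, ← hR]; ring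
  rw [this, Real.sqrt_sq (by positivity)]

section Products

variable {n : ℕ}

/-- The product of `r_j + (z - c_j)` over `j < k`. -/
noncomputable def loProd (c : Fin n → ℝ) (k : ℕ) (R z : ℝ) : ℝ :=
  ∏ j : Fin n, if j.val < k then rPlus R (z - c j) else 1

/-- The product of `r_j - (z - c_j)` over `j ≥ k`. -/
noncomputable def hiProd (c : Fin n → ℝ) (k : ℕ) (R z : ℝ) : ℝ :=
  ∏ j : Fin n, if j.val < k then 1 else rMinus R (z - c j)

variable (c : Fin n → ℝ)

theorem loProd_nonneg (k : ℕ) {R : ℝ} (hR : 0 ≤ R) (z : ℝ) : 0 ≤ loProd c k R z :=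
  Finset.prod_nonneg fun j _ => by split_ifs <;> simp [rPlus_nonneg hR]

theorem hiProd_nonneg (k : ℕ) {R : ℝ} (hR : 0 ≤ R) (z : ℝ) : 0 ≤ hiProd c k R z :=
  Finset.prod_nonneg fun j _ => by split_ifs <;> simp [rMinus_nonneg hR]

theorem loProd_pos_iff (k : ℕ) {R : ℝ} (hR : 0 ≤ R) (z : ℝ) :
    0 < loProd c k R z ↔ ∀ j : Fin n, j.val < k → 0 < R ∨ c j < z := by
  have : 0 < loProd c k R z ↔ ∀ j : Fin n, j.val < k → 0 < rPlus R (z - c j) := by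
    constructor
    · intro h j hj
      refine lt_of_le_of_ne (rPlus_nonneg hR _) fun h0 => h.ne' ?_
      exact Finset.prod_eq_zero (Finset.mem_univ j) (by simp [hj, ← h0])
    · intro h
      exact Finset.prod_pos fun j _ => by
        split_ifs with hj
        · exact h j hj
        · exact one_pos
  simp [this, rPlus_pos_iff hR]

theorem hiProd_pos_iff (k : ℕ) {R : ℝ} (hR : 0 ≤ R) (z : ℝ) :
    0 < hiProd c k R z ↔ ∀ j : Fin n, k ≤ j.val → 0 < R ∨ z < c j := by
  have : 0 < hiProd c k R z ↔ ∀ j : Fin n, k ≤ j.val → 0 < rMinus R (z - c j) := by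
    constructor
    · intro h j hj
      refine lt_of_le_of_ne (rMinus_nonneg hR _) fun h0 => h.ne' ?_
      exact Finset.prod_eq_zero (Finset.mem_univ j) (by simp [hj.not_gt, ← h0])
    · intro h
      exact Finset.prod_pos fun j _ => by
        split_ifs with hj
        · exact one_pos
        · exact h j (not_lt.1 hj)
  simp [this, rMinus_pos_iff hR]

theorem loProd_mono (k : ℕ) {R : ℝ} (hR : 0 ≤ R) {z z' : ℝ} (h : z ≤ z') :
    loProd c k R z ≤ loProd c k R z' :=
  Finset.prod_le_prod (fun j _ => by split_ifs <;> simp [rPlus_nonneg hR]) fun j _ => by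
    split_ifs
    · exact rPlus_mono hR (by linarith)
    · exact le_rfl

theorem hiProd_anti (k : ℕ) {R : ℝ} (hR : 0 ≤ R) {z z' : ℝ} (h : z ≤ z') :
    hiProd c k R z' ≤ hiProd c k R z :=
  Finset.prod_le_prod (fun j _ => by split_ifs <;> simp [rMinus_nonneg hR]) fun j _ => by
    split_ifs
    · exact le_rfl
    · exact rMinus_anti hR (by linarith)

theorem loProd_succ (i : Fin n) (R z : ℝ) :
    loProd c (i.val + 1) R z = loProd c i.val R z * rPlus R (z - c i) := by
  unfold loProd
  rw [← Finset.mul_prod_erase _ _ (Finset.mem_univ i),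
    ← Finset.mul_prod_erase _ (fun j : Fin n => if j.val < i.val then _ else _)
      (Finset.mem_univ i)]
  simp only [lt_add_iff_pos_right, zero_lt_one, if_true, lt_irrefl, if_false, one_mul]
  rw [mul_comm]
  congr 1
  refine Finset.prod_congr rfl fun j hj => ?_
  have : j.val ≠ i.val := fun h => (Finset.ne_of_mem_erase hj) (Fin.ext h)
  simp only [show (j.val < i.val + 1) = (j.val < i.val) from propext (by omega)]

theorem hiProd_eq_mul_succ (i : Fin n) (R z : ℝ) :
    hiProd c i.val R z = rMinus R (z - c i) * hiProd c (i.val + 1) R z := by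
  unfold hiProd
  rw [← Finset.mul_prod_erase _ _ (Finset.mem_univ i),
    ← Finset.mul_prod_erase _ (fun j : Fin n => if j.val < i.val + 1 then _ else _)
      (Finset.mem_univ i)]
  simp only [lt_add_iff_pos_right, zero_lt_one, if_true, lt_irrefl, if_false, one_mul]
  congr 1
  refine Finset.prod_congr rfl fun j hj => ?_
  have : j.val ≠ i.val := fun h => (Finset.ne_of_mem_erase hj) (Fin.ext h)
  simp only [show (j.val < i.val + 1) = (j.val < i.val) from propext (by omega)]

theorem loProd_zero (R z : ℝ) : loProd c 0 R z = 1 := by simp [loProd]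

theorem loProd_mul_hiProd_zero {k : ℕ} (hk : k ≤ n) {R : ℝ} (hR : 0 ≤ R) (z : ℝ) :
    loProd c k R z * hiProd c 0 R z = R ^ k * hiProd c k R z := by
  induction k with
  | zero => simp [loProd_zero]
  | succ k ih =>
    have h1 := loProd_succ c ⟨k, hk⟩ R z
    have h2 := hiProd_eq_mul_succ c ⟨k, hk⟩ R z
    have h3 := ih (by omega)
    have h4 := rMinus_mul_rPlus hR (z - c ⟨k, hk⟩)
    simp only at h1 h2
    rw [h1]
    rw [h2] at h3
    linear_combination rPlus R (z - c ⟨k, hk⟩) * h3 + R ^ k * hiProd c (k + 1) R z * h4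

theorem continuous_loProd (k : ℕ) : Continuous fun q : ℝ × ℝ => loProd c k q.1 q.2 := by
  unfold loProd
  refine continuous_finsetProd _ fun j _ => ?_
  split_ifs
  · exact continuous_rPlus.comp (by fun_prop : Continuous fun q : ℝ × ℝ => (q.1, q.2 - c j))
  · exact continuous_const

theorem continuous_hiProd (k : ℕ) : Continuous fun q : ℝ × ℝ => hiProd c k q.1 q.2 := by
  unfold hiProd
  refine continuous_finsetProd _ fun j _ => ?_
  split_ifs
  · exact continuous_const
  · exact continuous_rMinus.comp (by fun_prop : Continuous fun q : ℝ × ℝ => (q.1, q.2 - c j))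

/-! ### The height of the point with given moduli of the chart coordinates -/

/-- `z` is the height of a point whose coordinates in chart `i` have squared moduli `A` and `B`:
`A = |z₂|^{2(i+1)} / |z₁|²` and `B = |z₁|² / |z₂|^{2i}`, with denominators cleared so that the
equations make sense on the axis. -/
def IsHeight (i : Fin n) (A B z : ℝ) : Prop :=
  A * hiProd c (i.val + 1) (A * B) z = loProd c (i.val + 1) (A * B) z ∧
    B * loProd c i.val (A * B) z = hiProd c i.val (A * B) z

variable {c}

/-- The part of the axis in the chart of index `i` lies between the centers of index `i - 1` and
`i + 1`, so only the factors of index `i` can vanish in the equations for the height. -/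
theorem IsHeight.pos (hc : StrictMono c) {i : Fin n} {A B z : ℝ} (hA : 0 ≤ A) (hB : 0 ≤ B)
    (h : IsHeight c i A B z) :
    0 < loProd c i.val (A * B) z ∧ 0 < hiProd c (i.val + 1) (A * B) z := by
  have hR : 0 ≤ A * B := mul_nonneg hA hB
  rw [loProd_pos_iff c _ hR, hiProd_pos_iff c _ hR]
  rcases hR.lt_or_eq with hR' | hR'
  · exact ⟨fun _ _ => Or.inl hR', fun _ _ => Or.inl hR'⟩
  refine ⟨fun j hj => ?_, fun j hj => ?_⟩
  · by_contra! hz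
    have hi : 0 < hiProd c i.val (A * B) z := (hiProd_pos_iff c _ hR z).2 fun k hk =>
      Or.inr (hz.2.trans_lt (hc (lt_of_lt_of_le hj hk)))
    have lo : ¬ 0 < loProd c i.val (A * B) z := fun h' => by
      rcases (loProd_pos_iff c _ hR z).1 h' j hj with h' | h' <;> linarith
    have lo' : loProd c i.val (A * B) z = 0 :=
      le_antisymm (not_lt.1 lo) (loProd_nonneg c _ hR z)
    have := h.2
    rw [lo', mul_zero] at this
    linarith
  · by_contra! hz
    have lo : 0 < loProd c (i.val + 1) (A * B) z := (loProd_pos_iff c _ hR z).2 fun k hk =>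
      Or.inr ((hc (Fin.lt_def.2 (lt_of_lt_of_le hk hj))).trans_le hz.2)
    have hi : ¬ 0 < hiProd c (i.val + 1) (A * B) z := fun h' => by
      rcases (hiProd_pos_iff c _ hR z).1 h' j hj with h' | h' <;> linarith
    have hi' : hiProd c (i.val + 1) (A * B) z = 0 :=
      le_antisymm (not_lt.1 hi) (hiProd_nonneg c _ hR z)
    have := h.1
    rw [hi', mul_zero] at this
    linarith

/-- If the height increases, the left side of the first equation and the right side of the second one
decrease, while the other two sides increase. -/
theorem IsHeight.unique_aux (hc : StrictMono c) {i : Fin n} {A B z z' : ℝ} (hA : 0 ≤ A)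
    (hB : 0 ≤ B) (h : IsHeight c i A B z) (h' : IsHeight c i A B z') (hz : z ≤ z') : z = z' := by
  have hR : 0 ≤ A * B := mul_nonneg hA hB
  have p := h.pos hc hA hB
  have p' := h'.pos hc hA hB
  have l1 := loProd_mono c i.val hR hz
  have l2 := loProd_mono c (i.val + 1) hR hz
  have u1 := hiProd_anti c i.val hR hz
  have u2 := hiProd_anti c (i.val + 1) hR hz
  have e1 := h.1
  have e2 := h.2
  have e1' := h'.1
  have e2' := h'.2
  -- both sides of either equation move in opposite directions, hence are constant
  have q1 : loProd c (i.val + 1) (A * B) z = loProd c (i.val + 1) (A * B) z' := by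
    nlinarith [mul_le_mul_of_nonneg_left u2 hA]
  have q2 : hiProd c i.val (A * B) z = hiProd c i.val (A * B) z' := by
    nlinarith [mul_le_mul_of_nonneg_left l1 hB]
  rw [loProd_succ, loProd_succ] at q1
  rw [hiProd_eq_mul_succ, hiProd_eq_mul_succ] at q2
  have b1 := rPlus_mono hR (show z - c i ≤ z' - c i by linarith)
  have a1 := rMinus_anti hR (show z - c i ≤ z' - c i by linarith)
  have bn := rPlus_nonneg hR (z - c i)
  have an := rMinus_nonneg hR (z' - c i)
  have b2 : rPlus (A * B) (z' - c i) ≤ rPlus (A * B) (z - c i) := by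
    by_contra! hlt
    nlinarith [mul_lt_mul_of_pos_left hlt p'.1, mul_le_mul_of_nonneg_right l1 bn]
  have a2 : rMinus (A * B) (z - c i) ≤ rMinus (A * B) (z' - c i) := by
    by_contra! hlt
    nlinarith [mul_lt_mul_of_pos_right hlt p.2, mul_le_mul_of_nonneg_left u2 an]
  unfold rPlus rMinus at *
  linarith

theorem IsHeight.unique (hc : StrictMono c) {i : Fin n} {A B z z' : ℝ} (hA : 0 ≤ A)
    (hB : 0 ≤ B) (h : IsHeight c i A B z) (h' : IsHeight c i A B z') : z = z' := by
  rcases le_total z z' with hz | hz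
  · exact h.unique_aux hc hA hB h' hz
  · exact (h'.unique_aux hc hA hB h hz).symm

variable (c)

/-- The two equations for the height are equivalent to the vanishing of a single function, which
decreases from `+∞` to `-∞`. -/
theorem exists_isHeight (i : Fin n) {A B : ℝ} (hA : 0 ≤ A) (hB : 0 ≤ B) :
    ∃ z, IsHeight c i A B z := by
  have hR : 0 ≤ A * B := mul_nonneg hA hB
  set R := A * B with hRdef
  let h : ℝ → ℝ := fun z => A * hiProd c (i.val + 1) R z + hiProd c i.val R z
    - B * loProd c i.val R z - loProd c (i.val + 1) R z
  have hcont : Continuous h := by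
    have l (k : ℕ) : Continuous fun z => loProd c k R z :=
      (continuous_loProd c k).comp (by fun_prop : Continuous fun z : ℝ => (R, z))
    have u (k : ℕ) : Continuous fun z => hiProd c k R z :=
      (continuous_hiProd c k).comp (by fun_prop : Continuous fun z : ℝ => (R, z))
    have := l i.val; have := l (i.val + 1); have := u i.val; have := u (i.val + 1)
    fun_prop
  obtain ⟨m, hm⟩ : ∃ m : ℝ, ∀ j, |c j| ≤ m := by
    refine ⟨∑ j, |c j|, fun j => ?_⟩
    exact Finset.single_le_sum (f := fun j => |c j|) (fun _ _ => abs_nonneg _) (Finset.mem_univ j)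
  -- far below the centers, the factors of `hiProd` exceed any given bound, in particular the value
  -- `N` at `-m` of the terms that decrease as `z` does
  have hlow : ∃ z, 0 ≤ h z := by
    let N := B * loProd c i.val R (-m) + loProd c (i.val + 1) R (-m)
    have hN : 0 ≤ N := by
      have := loProd_nonneg c i.val hR (-m)
      have := loProd_nonneg c (i.val + 1) hR (-m)
      positivity
    refine ⟨-m - 1 - N, ?_⟩
    have l1 := loProd_mono c i.val hR (show -m - 1 - N ≤ -m by linarith)
    have l2 := loProd_mono c (i.val + 1) hR (show -m - 1 - N ≤ -m by linarith)
    have u1 := hiProd_nonneg c (i.val + 1) hR (-m - 1 - N)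
    have big (j : Fin n) : 1 + N ≤ rMinus R (-m - 1 - N - c j) := by
      have := le_rMinus hR (-m - 1 - N - c j)
      have := (abs_le.1 (hm j)).1
      linarith
    have u2 : 1 + N ≤ hiProd c i.val R (-m - 1 - N) := by
      rw [hiProd_eq_mul_succ]
      have : 1 ≤ hiProd c (i.val + 1) R (-m - 1 - N) := by
        refine Finset.prod_induction _ (fun x : ℝ => 1 ≤ x)
          (fun a b ha hb => one_le_mul_of_one_le_of_one_le ha hb) le_rfl fun j _ => ?_
        split_ifs
        · exact le_rfl
        · linarith [big j]
      nlinarith [big i]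
    have := mul_le_mul_of_nonneg_left l1 hB
    have := mul_nonneg hA u1
    simp only [h, N] at *
    linarith
  -- far above the centers, the same holds with the roles of `loProd` and `hiProd` exchanged
  have hhigh : ∃ z, h z ≤ 0 := by
    let N := A * hiProd c (i.val + 1) R m + hiProd c i.val R m
    have hN : 0 ≤ N := by
      have := hiProd_nonneg c i.val hR m
      have := hiProd_nonneg c (i.val + 1) hR m
      positivity
    refine ⟨m + 1 + N, ?_⟩
    have l1 := hiProd_anti c i.val hR (show m ≤ m + 1 + N by linarith)
    have l2 := hiProd_anti c (i.val + 1) hR (show m ≤ m + 1 + N by linarith)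
    have u1 := loProd_nonneg c i.val hR (m + 1 + N)
    have big (j : Fin n) : 1 + N ≤ rPlus R (m + 1 + N - c j) := by
      have := le_rPlus hR (m + 1 + N - c j)
      have := (abs_le.1 (hm j)).2
      linarith
    have u2 : 1 + N ≤ loProd c (i.val + 1) R (m + 1 + N) := by
      rw [loProd_succ]
      have : 1 ≤ loProd c i.val R (m + 1 + N) := by
        refine Finset.prod_induction _ (fun x : ℝ => 1 ≤ x)
          (fun a b ha hb => one_le_mul_of_one_le_of_one_le ha hb) le_rfl fun j _ => ?_
        split_ifs
        · linarith [big j]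
        · exact le_rfl
      nlinarith [big i]
    have := mul_le_mul_of_nonneg_left l2 hA
    have := mul_nonneg hB u1
    simp only [h, N] at *
    linarith
  obtain ⟨z₀, h₀⟩ := hlow
  obtain ⟨z₁, h₁⟩ := hhigh
  obtain ⟨z, hz⟩ := mem_range_of_exists_le_of_exists_ge hcont ⟨z₁, h₁⟩ ⟨z₀, h₀⟩
  -- with `X X' = Y Y'`, the equation `X + Y' = X' + Y` forces `X = Y` and `X' = Y'`
  have e1 := loProd_succ c i R z
  have e2 := hiProd_eq_mul_succ c i R z
  have e3 := rMinus_mul_rPlus hR (z - c i)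
  have n1 := mul_nonneg hA (hiProd_nonneg c (i.val + 1) hR z)
  have n2 := hiProd_nonneg c i.val hR z
  have n3 := mul_nonneg hB (loProd_nonneg c i.val hR z)
  have n4 := loProd_nonneg c (i.val + 1) hR z
  have prod : (A * hiProd c (i.val + 1) R z) * (B * loProd c i.val R z) =
      loProd c (i.val + 1) R z * hiProd c i.val R z := by
    rw [e1, e2]
    linear_combination (-(loProd c i.val R z * hiProd c (i.val + 1) R z)) * e3
      - (loProd c i.val R z * hiProd c (i.val + 1) R z) * hRdef
  have sum : A * hiProd c (i.val + 1) R z + hiProd c i.val R z =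
      B * loProd c i.val R z + loProd c (i.val + 1) R z := by
    simp only [h] at hz
    linarith
  have key : (A * hiProd c (i.val + 1) R z + hiProd c i.val R z) *
      (A * hiProd c (i.val + 1) R z - loProd c (i.val + 1) R z) = 0 := by
    linear_combination prod + A * hiProd c (i.val + 1) R z * sum
  refine ⟨z, ?_⟩
  rcases mul_eq_zero.1 key with h0 | h0
  · constructor <;> rw [← hRdef] <;> linarith
  · constructor <;> rw [← hRdef] <;> linarith

end Products

/-! ### Differentiating `r ∓ s` -/

section Deriv

variable {E : Type*} [NormedAddCommGroup E] [NormedSpace ℝ E] {R s : E → ℝ} {R' s' : E →L[ℝ] ℝ}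
  {x : E}

theorem HasFDerivAt.sqrt_add_sq (hR : HasFDerivAt R R' x) (hs : HasFDerivAt s s' x)
    (h : 0 < R x + s x ^ 2) :
    HasFDerivAt (fun y => Real.sqrt (R y + s y ^ 2))
      ((1 / (2 * Real.sqrt (R x + s x ^ 2))) • R' + (s x / Real.sqrt (R x + s x ^ 2)) • s') x := by
  have := (hR.add (hs.pow 2)).sqrt h.ne'
  refine this.congr_fderiv ?_
  have h0 : Real.sqrt (R x + s x ^ 2) ≠ 0 := (Real.sqrt_pos.2 h).ne'
  ext v
  simp
  field_simp

theorem HasFDerivAt.log_rMinus (hR : HasFDerivAt R R' x) (hs : HasFDerivAt s s' x)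
    (h0 : 0 ≤ R x) (h : 0 < rMinus (R x) (s x)) :
    HasFDerivAt (fun y => Real.log (rMinus (R y) (s y)))
      ((1 / (2 * Real.sqrt (R x + s x ^ 2) * rMinus (R x) (s x))) • R' -
        (1 / Real.sqrt (R x + s x ^ 2)) • s') x := by
  have hp := sqrt_pos_of_rMinus_pos h0 h
  have := ((hR.sqrt_add_sq hs hp).fun_sub hs).log h.ne'
  refine this.congr_fderiv ?_
  have h1 : Real.sqrt (R x + s x ^ 2) ≠ 0 := (Real.sqrt_pos.2 hp).ne'
  have h2 : Real.sqrt (R x + s x ^ 2) - s x ≠ 0 := h.ne'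
  ext v
  simp only [rMinus, smul_apply, sub_apply,
    add_apply, smul_eq_mul]
  field_simp
  ring

theorem HasFDerivAt.log_rPlus (hR : HasFDerivAt R R' x) (hs : HasFDerivAt s s' x)
    (h0 : 0 ≤ R x) (h : 0 < rPlus (R x) (s x)) :
    HasFDerivAt (fun y => Real.log (rPlus (R y) (s y)))
      ((1 / (2 * Real.sqrt (R x + s x ^ 2) * rPlus (R x) (s x))) • R' +
        (1 / Real.sqrt (R x + s x ^ 2)) • s') x := by
  simp only [rPlus_eq_rMinus_neg] at h ⊢
  refine (hR.log_rMinus hs.neg h0 h).congr_fderiv ?_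
  simp [sub_eq_add_neg]

variable {m : WithTop ℕ∞}

theorem ContDiffAt.sqrt_add_sq (hR : ContDiffAt ℝ m R x) (hs : ContDiffAt ℝ m s x)
    (h : 0 < R x + s x ^ 2) : ContDiffAt ℝ m (fun y => Real.sqrt (R y + s y ^ 2)) x :=
  (hR.add (hs.pow 2)).sqrt h.ne'

theorem ContDiffAt.rMinus (hR : ContDiffAt ℝ m R x) (hs : ContDiffAt ℝ m s x)
    (h : 0 < R x + s x ^ 2) : ContDiffAt ℝ m (fun y => rMinus (R y) (s y)) x :=
  (hR.sqrt_add_sq hs h).sub hs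

theorem ContDiffAt.rPlus (hR : ContDiffAt ℝ m R x) (hs : ContDiffAt ℝ m s x)
    (h : 0 < R x + s x ^ 2) : ContDiffAt ℝ m (fun y => rPlus (R y) (s y)) x :=
  (hR.sqrt_add_sq hs h).add hs

end Deriv

/-! ### Height and scale as functions of the chart coordinates -/

section Height

variable {n : ℕ} (c : Fin n → ℝ) (i : Fin n)

/-- The function `|α β|² = x² + y²` of the chart coordinates. -/
noncomputable def modSq (x : ℂ × ℂ) : ℝ := Complex.normSq x.1 * Complex.normSq x.2

theorem modSq_nonneg (x : ℂ × ℂ) : 0 ≤ modSq x :=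
  mul_nonneg (Complex.normSq_nonneg _) (Complex.normSq_nonneg _)

theorem modSq_pos {x : ℂ × ℂ} (h₁ : x.1 ≠ 0) (h₂ : x.2 ≠ 0) : 0 < modSq x :=
  mul_pos (Complex.normSq_pos.2 h₁) (Complex.normSq_pos.2 h₂)

theorem contDiff_normSq : ContDiff ℝ ∞ (Complex.normSq : ℂ → ℝ) := by
  have : (Complex.normSq : ℂ → ℝ) = fun z => Complex.reCLM z * Complex.reCLM z +
      Complex.imCLM z * Complex.imCLM z := by
    ext z; simp [Complex.normSq_apply]
  rw [this]
  fun_prop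

theorem contDiff_modSq : ContDiff ℝ ∞ modSq :=
  (contDiff_normSq.comp contDiff_fst).mul (contDiff_normSq.comp contDiff_snd)

/-- The coordinate `z` as a function of the coordinates `(α_i, β_i)`. -/
noncomputable def height (x : ℂ × ℂ) : ℝ :=
  Classical.choose
    (exists_isHeight c i (Complex.normSq_nonneg x.1) (Complex.normSq_nonneg x.2))

theorem isHeight_height (x : ℂ × ℂ) :
    IsHeight c i (Complex.normSq x.1) (Complex.normSq x.2) (height c i x) :=
  Classical.choose_spec
    (exists_isHeight c i (Complex.normSq_nonneg x.1) (Complex.normSq_nonneg x.2))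

/-- The positive function `t` with `r_i - (z - c_i) = t |β|²` and `r_i + (z - c_i) = |α|² / t`. -/
noncomputable def scale (x : ℂ × ℂ) : ℝ :=
  loProd c i.val (modSq x) (height c i x) / hiProd c (i.val + 1) (modSq x) (height c i x)

variable {c}

theorem height_unique (hc : StrictMono c) {x : ℂ × ℂ} {z : ℝ}
    (h : IsHeight c i (Complex.normSq x.1) (Complex.normSq x.2) z) : height c i x = z :=
  (isHeight_height c i x).unique hc (Complex.normSq_nonneg _) (Complex.normSq_nonneg _) h

theorem loProd_height_pos (hc : StrictMono c) (x : ℂ × ℂ) :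
    0 < loProd c i.val (modSq x) (height c i x) :=
  ((isHeight_height c i x).pos hc (Complex.normSq_nonneg _) (Complex.normSq_nonneg _)).1

theorem hiProd_height_pos (hc : StrictMono c) (x : ℂ × ℂ) :
    0 < hiProd c (i.val + 1) (modSq x) (height c i x) :=
  ((isHeight_height c i x).pos hc (Complex.normSq_nonneg _) (Complex.normSq_nonneg _)).2

theorem scale_pos (hc : StrictMono c) (x : ℂ × ℂ) : 0 < scale c i x :=
  div_pos (loProd_height_pos i hc x) (hiProd_height_pos i hc x)

theorem rMinus_height_self (hc : StrictMono c) (x : ℂ × ℂ) :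
    rMinus (modSq x) (height c i x - c i) = scale c i x * Complex.normSq x.2 := by
  have h := (isHeight_height c i x).2
  have := (hiProd_height_pos i hc x).ne'
  rw [hiProd_eq_mul_succ] at h
  unfold scale
  field_simp
  exact h.symm.trans (mul_comm _ _)

theorem rPlus_height_self (hc : StrictMono c) (x : ℂ × ℂ) :
    rPlus (modSq x) (height c i x - c i) = Complex.normSq x.1 / scale c i x := by
  have h := (isHeight_height c i x).1
  have h1 := (hiProd_height_pos i hc x).ne'
  have h2 := (loProd_height_pos i hc x).ne'
  rw [loProd_succ] at h
  unfold scale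
  field_simp
  exact (mul_comm _ _).trans h.symm

theorem height_eq (hc : StrictMono c) (x : ℂ × ℂ) :
    height c i x =
      c i + (Complex.normSq x.1 / scale c i x - scale c i x * Complex.normSq x.2) / 2 := by
  rw [← rMinus_height_self i hc, ← rPlus_height_self i hc]
  unfold rMinus rPlus; ring

theorem sqrt_height_self (hc : StrictMono c) (x : ℂ × ℂ) :
    Real.sqrt (modSq x + (height c i x - c i) ^ 2) =
      (Complex.normSq x.1 / scale c i x + scale c i x * Complex.normSq x.2) / 2 := by
  rw [← rMinus_height_self i hc, ← rPlus_height_self i hc]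
  unfold rMinus rPlus; ring

/-- Off the special point over `c i`, the chart contains no other special point. -/
theorem radicand_height_pos (hc : StrictMono c) {j : Fin n} (hj : j ≠ i) (x : ℂ × ℂ) :
    0 < modSq x + (height c i x - c j) ^ 2 := by
  have hR := modSq_nonneg x
  rcases lt_or_gt_of_ne hj with h | h
  · rcases (loProd_pos_iff c _ hR _).1 (loProd_height_pos i hc x) j h with h | h
    · positivity
    · have : 0 < height c i x - c j := by linarith
      positivity
  · rcases (hiProd_pos_iff c _ hR _).1 (hiProd_height_pos i hc x) j h with h | h
    · positivity
    · have : 0 < c j - height c i x := by linarith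
      have h2 : (height c i x - c j) ^ 2 = (c j - height c i x) ^ 2 := by ring
      rw [h2]
      positivity

theorem rPlus_height_pos (hc : StrictMono c) {j : Fin n} (hj : j < i) (x : ℂ × ℂ) :
    0 < rPlus (modSq x) (height c i x - c j) := by
  rw [rPlus_pos_iff (modSq_nonneg x), sub_pos]
  exact (loProd_pos_iff c _ (modSq_nonneg x) _).1 (loProd_height_pos i hc x) j hj

theorem rMinus_height_pos (hc : StrictMono c) {j : Fin n} (hj : i < j) (x : ℂ × ℂ) :
    0 < rMinus (modSq x) (height c i x - c j) := by
  rw [rMinus_pos_iff (modSq_nonneg x), sub_neg]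
  exact (hiProd_pos_iff c _ (modSq_nonneg x) _).1 (hiProd_height_pos i hc x) j hj

/-- The scale is the only solution of the equation it satisfies, the height being expressed in
terms of it. -/
theorem scale_unique (hc : StrictMono c) {x : ℂ × ℂ} {T z : ℝ} (hT : 0 < T)
    (hz : z = c i + (Complex.normSq x.1 / T - T * Complex.normSq x.2) / 2)
    (h : T * hiProd c (i.val + 1) (modSq x) z = loProd c i.val (modSq x) z) :
    scale c i x = T := by
  have hA := Complex.normSq_nonneg x.1
  have hB := Complex.normSq_nonneg x.2
  have hr : Real.sqrt (modSq x + (z - c i) ^ 2) =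
      (T * Complex.normSq x.2 + Complex.normSq x.1 / T) / 2 := by
    refine sqrt_eq_of_factors (by positivity) (by positivity) ?_ ?_
    · unfold modSq; field_simp
    · rw [hz]; ring
  have ha : rMinus (modSq x) (z - c i) = T * Complex.normSq x.2 := by
    unfold rMinus; rw [hr, hz]; ring
  have hb : rPlus (modSq x) (z - c i) = Complex.normSq x.1 / T := by
    unfold rPlus; rw [hr, hz]; ring
  have hh : height c i x = z := by
    refine height_unique i hc ⟨?_, ?_⟩
    · change _ * hiProd c (i.val + 1) (modSq x) z = loProd c (i.val + 1) (modSq x) z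
      rw [loProd_succ, hb, ← h]
      field_simp
    · change _ * loProd c i.val (modSq x) z = hiProd c i.val (modSq x) z
      rw [hiProd_eq_mul_succ, ha, ← h]
      ring
  have hp := hiProd_height_pos i hc x
  unfold scale
  rw [hh] at hp ⊢
  rw [← h]
  field_simp

/-! ### Smoothness of the scale -/

/-- The terms of the logarithm of the equation for the scale. -/
noncomputable def scaleTerm (c : Fin n → ℝ) (i j : Fin n) (R z : ℝ) : ℝ :=
  if j < i then -Real.log (rPlus R (z - c j))
  else if i < j then Real.log (rMinus R (z - c j)) else 0

/-- The height as a function of the chart coordinates and the logarithm of the scale. -/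
noncomputable def trialHeight (c : Fin n → ℝ) (i : Fin n) (q : (ℂ × ℂ) × ℝ) : ℝ :=
  c i + (Complex.normSq q.1.1 * Real.exp (-q.2) - Real.exp q.2 * Complex.normSq q.1.2) / 2

/-- The logarithm of the equation for the scale `e^s`. -/
noncomputable def scaleEq (c : Fin n → ℝ) (i : Fin n) (q : (ℂ × ℂ) × ℝ) : ℝ :=
  q.2 + ∑ j, scaleTerm c i j (modSq q.1) (trialHeight c i q)

theorem sum_scaleTerm {R z : ℝ} (hlo : 0 < loProd c i.val R z)
    (hhi : 0 < hiProd c (i.val + 1) R z) :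
    ∑ j, scaleTerm c i j R z =
      Real.log (hiProd c (i.val + 1) R z) - Real.log (loProd c i.val R z) := by
  unfold loProd at hlo ⊢
  unfold hiProd at hhi ⊢
  rw [Real.log_prod fun j _ => Finset.prod_ne_zero_iff.1 hlo.ne' j (Finset.mem_univ j),
    Real.log_prod fun j _ => Finset.prod_ne_zero_iff.1 hhi.ne' j (Finset.mem_univ j),
    ← Finset.sum_sub_distrib]
  refine Finset.sum_congr rfl fun j _ => ?_
  unfold scaleTerm
  rcases lt_trichotomy j i with h | h | h
  · have h' : j.val < i.val := h
    simp [h, h', show j.val < i.val + 1 by omega]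
  · subst h; simp
  · have h' : i.val < j.val := h
    simp [h, h.not_gt, h'.not_gt, show ¬ j.val < i.val + 1 by omega]

theorem scaleEq_eq_zero_iff {q : (ℂ × ℂ) × ℝ}
    (hlo : 0 < loProd c i.val (modSq q.1) (trialHeight c i q))
    (hhi : 0 < hiProd c (i.val + 1) (modSq q.1) (trialHeight c i q)) :
    scaleEq c i q = 0 ↔ Real.exp q.2 * hiProd c (i.val + 1) (modSq q.1) (trialHeight c i q) =
      loProd c i.val (modSq q.1) (trialHeight c i q) := by
  rw [scaleEq, sum_scaleTerm i hlo hhi]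
  constructor
  · intro h
    have h' := congrArg Real.exp (show q.2 +
      Real.log (hiProd c (i.val + 1) (modSq q.1) (trialHeight c i q)) =
      Real.log (loProd c i.val (modSq q.1) (trialHeight c i q)) by linarith)
    rwa [Real.exp_add, Real.exp_log hhi, Real.exp_log hlo] at h'
  · intro h
    rw [← h, Real.log_mul (Real.exp_pos _).ne' hhi.ne', Real.log_exp]
    ring

theorem trialHeight_log_scale (hc : StrictMono c) (x : ℂ × ℂ) :
    trialHeight c i (x, Real.log (scale c i x)) = height c i x := by
  have := scale_pos i hc x
  rw [height_eq i hc, trialHeight]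
  simp only [Real.exp_neg, Real.exp_log this]
  rfl

theorem contDiff_trialHeight : ContDiff ℝ ∞ (trialHeight c i) := by
  unfold trialHeight
  have h1 : ContDiff ℝ ∞ fun q : (ℂ × ℂ) × ℝ => Complex.normSq q.1.1 :=
    contDiff_normSq.comp (by fun_prop)
  have h2 : ContDiff ℝ ∞ fun q : (ℂ × ℂ) × ℝ => Complex.normSq q.1.2 :=
    contDiff_normSq.comp (by fun_prop)
  fun_prop

theorem contDiffAt_scaleEq (hc : StrictMono c) (x : ℂ × ℂ) :
    ContDiffAt ℝ ∞ (scaleEq c i) (x, Real.log (scale c i x)) := by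
  refine contDiffAt_snd.add (ContDiffAt.sum fun j _ => ?_)
  have hz : ContDiffAt ℝ ∞ (fun q => trialHeight c i q - c j) (x, Real.log (scale c i x)) :=
    (contDiff_trialHeight i).contDiffAt.sub contDiffAt_const
  have hR : ContDiffAt ℝ ∞ (fun q : (ℂ × ℂ) × ℝ => modSq q.1) (x, Real.log (scale c i x)) :=
    (contDiff_modSq.comp contDiff_fst).contDiffAt
  unfold scaleTerm
  split_ifs with h1 h2
  · refine ((hR.rPlus hz ?_).log ?_).neg <;> simp only [trialHeight_log_scale i hc]
    · exact radicand_height_pos i hc h1.ne x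
    · exact (rPlus_height_pos i hc h1 x).ne'
  · refine (hR.rMinus hz ?_).log ?_ <;> simp only [trialHeight_log_scale i hc]
    · exact radicand_height_pos i hc h2.ne' x
    · exact (rMinus_height_pos i hc h2 x).ne'
  · exact contDiffAt_const

/-- The height decreases with the scale, and each term decreases with the height. -/
theorem exists_hasDerivAt_scaleEq (hc : StrictMono c) (x : ℂ × ℂ) :
    ∃ d : ℝ, 1 ≤ d ∧
      HasDerivAt (fun s => scaleEq c i (x, s)) d (Real.log (scale c i x)) := by
  set s₀ := Real.log (scale c i x) with hs₀
  obtain ⟨z', hz', hz⟩ : ∃ z' ≤ 0, HasDerivAt (fun s => trialHeight c i (x, s)) z' s₀ := by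
    refine ⟨(Complex.normSq x.1 * (Real.exp (-s₀) * -1) - Real.exp s₀ * Complex.normSq x.2) / 2,
      ?_, ?_⟩
    · have := Complex.normSq_nonneg x.1
      have := Complex.normSq_nonneg x.2
      have : 0 ≤ Complex.normSq x.1 * Real.exp (-s₀) := by positivity
      have : 0 ≤ Real.exp s₀ * Complex.normSq x.2 := by positivity
      linarith
    · change HasDerivAt (fun s => c i + (Complex.normSq x.1 * Real.exp (-s) -
        Real.exp s * Complex.normSq x.2) / 2) _ _
      exact (((((hasDerivAt_neg s₀).exp).const_mul _).fun_sub
        ((Real.hasDerivAt_exp s₀).mul_const _)).div_const 2).const_add _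
  have hterm (j : Fin n) : ∃ d : ℝ, 0 ≤ d ∧
      HasDerivAt (fun s => scaleTerm c i j (modSq x) (trialHeight c i (x, s))) d s₀ := by
    have hR : HasFDerivAt (fun _ : ℝ => modSq x) (0 : ℝ →L[ℝ] ℝ) s₀ := hasFDerivAt_const _ _
    have hzj := (hz.sub_const (c j)).hasFDerivAt
    unfold scaleTerm
    split_ifs with h1 h2
    · have := (hR.log_rPlus hzj (modSq_nonneg x) (by
        rw [hs₀, trialHeight_log_scale i hc]; exact rPlus_height_pos i hc h1 x)).neg.hasDerivAt
      refine ⟨_, ?_, this⟩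
      simp only [one_div, smul_zero, zero_add, neg_apply,
        smul_apply, ContinuousLinearMap.toSpanSingleton_apply, smul_eq_mul,
        one_mul]
      rw [neg_nonneg]
      exact mul_nonpos_of_nonneg_of_nonpos (by positivity) hz'
    · have := (hR.log_rMinus hzj (modSq_nonneg x) (by
        rw [hs₀, trialHeight_log_scale i hc]; exact rMinus_height_pos i hc h2 x)).hasDerivAt
      refine ⟨_, ?_, this⟩
      simp only [one_div, smul_zero, zero_sub, neg_apply,
        smul_apply, ContinuousLinearMap.toSpanSingleton_apply, smul_eq_mul,
        one_mul]
      rw [neg_nonneg]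
      exact mul_nonpos_of_nonneg_of_nonpos (by positivity) hz'
    · exact ⟨0, le_rfl, hasDerivAt_const _ _⟩
  choose d hd hd' using hterm
  refine ⟨1 + ∑ j, d j, by linarith [Finset.sum_nonneg fun j (_ : j ∈ Finset.univ) => hd j], ?_⟩
  exact (hasDerivAt_id s₀).add (HasDerivAt.fun_sum fun j _ => hd' j)

/-- The implicit function theorem for one real unknown. -/
theorem exists_contDiffAt_implicit {E : Type*} [NormedAddCommGroup E] [NormedSpace ℝ E]
    [CompleteSpace E] {f : E × ℝ → ℝ} {x : E} {s d : ℝ} (hf : ContDiffAt ℝ ∞ f (x, s))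
    (hd : d ≠ 0) (hderiv : HasDerivAt (fun s => f (x, s)) d s) (h0 : f (x, s) = 0) :
    ∃ ψ : E → ℝ, ContDiffAt ℝ ∞ ψ x ∧ (∀ᶠ y in nhds x, f (y, ψ y) = 0) ∧ ψ x = s := by
  have pn : (∞ : WithTop ℕ∞) ≠ 0 := by simp
  have hinv : (fderiv ℝ f (x, s) ∘L .inr ℝ E ℝ).IsInvertible := by
    have hval : fderiv ℝ f (x, s) ∘L .inr ℝ E ℝ = ContinuousLinearMap.toSpanSingleton ℝ d := by
      ext
      have h1 := (hf.differentiableAt pn).hasFDerivAt.comp_hasDerivAt s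
        ((hasDerivAt_const _ x).prodMk (hasDerivAt_id _))
      have h2 := h1.unique hderiv
      simpa using h2
    refine ⟨ContinuousLinearEquiv.unitsEquivAut ℝ (Units.mk0 d hd), ?_⟩
    rw [hval]
    ext
    simp
  refine ⟨hf.implicitFunction pn hinv, hf.contDiffAt_implicitFunction pn hinv, ?_,
    hf.implicitFunction_apply_self pn hinv⟩
  have := hf.eventually_apply_implicitFunction pn hinv
  rwa [h0] at this

/-- The implicit function theorem provides a smooth local solution of the equation for the logarithm of
the scale; by uniqueness it is the scale. The scale is used instead of the height because `r_i` is
not smooth at `p_i`. -/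
theorem contDiff_scale (hc : StrictMono c) : ContDiff ℝ ∞ (scale c i) := by
  rw [contDiff_iff_contDiffAt]
  intro x
  have hval : scaleEq c i (x, Real.log (scale c i x)) = 0 := by
    have e := trialHeight_log_scale i hc x
    rw [scaleEq_eq_zero_iff i (by rw [e]; exact loProd_height_pos i hc x)
      (by rw [e]; exact hiProd_height_pos i hc x), e]
    have := (hiProd_height_pos i hc x).ne'
    simp only [Real.exp_log (scale_pos i hc x)]
    unfold scale
    field_simp
  obtain ⟨d, hd, hderiv⟩ := exists_hasDerivAt_scaleEq i hc x
  obtain ⟨ψ, hsm, happ, hself⟩ := exists_contDiffAt_implicit (contDiffAt_scaleEq i hc x)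
    (by positivity : d ≠ 0) hderiv hval
  have hcont : ContinuousAt (fun y => (y, ψ y)) x := continuousAt_id.prodMk hsm.continuousAt
  have e : trialHeight c i (x, ψ x) = height c i x := by
    rw [hself]
    exact trialHeight_log_scale i hc x
  have hpair : ContinuousAt (fun y => (modSq y, trialHeight c i (y, ψ y))) x :=
    contDiff_modSq.continuous.continuousAt.prodMk
      (ContinuousAt.comp (f := fun y => (y, ψ y)) (g := trialHeight c i)
        (contDiff_trialHeight i).continuous.continuousAt hcont)
  have hlo : ∀ᶠ y in nhds x, 0 < loProd c i.val (modSq y) (trialHeight c i (y, ψ y)) := by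
    have h := (continuous_loProd c i.val).continuousAt.tendsto.comp hpair.tendsto
    simp only [e] at h
    exact h.eventually_const_lt (loProd_height_pos i hc x)
  have hhi : ∀ᶠ y in nhds x,
      0 < hiProd c (i.val + 1) (modSq y) (trialHeight c i (y, ψ y)) := by
    have h := (continuous_hiProd c (i.val + 1)).continuousAt.tendsto.comp hpair.tendsto
    simp only [e] at h
    exact h.eventually_const_lt (hiProd_height_pos i hc x)
  have hev : scale c i =ᶠ[nhds x] fun y => Real.exp (ψ y) := by
    refine (happ.and (hlo.and hhi)).mono fun y hy => ?_
    have h1 := (scaleEq_eq_zero_iff (q := (y, ψ y)) i hy.2.1 hy.2.2).1 hy.1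
    have h2 : trialHeight c i (y, ψ y) = c i + (Complex.normSq y.1 / Real.exp (ψ y) -
        Real.exp (ψ y) * Complex.normSq y.2) / 2 := by
      simp only [trialHeight, Real.exp_neg, div_eq_mul_inv]
    exact scale_unique (x := y) (T := Real.exp (ψ y)) (z := trialHeight c i (y, ψ y))
      i hc (Real.exp_pos _) h2 h1
  exact hsm.exp.congr_of_eventuallyEq hev

theorem contDiff_height (hc : StrictMono c) : ContDiff ℝ ∞ (height c i) := by
  have : height c i = fun x =>
      c i + (Complex.normSq x.1 / scale c i x - scale c i x * Complex.normSq x.2) / 2 :=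
    funext (height_eq i hc)
  rw [this]
  have h1 : ContDiff ℝ ∞ fun x : ℂ × ℂ => Complex.normSq x.1 := contDiff_normSq.comp contDiff_fst
  have h2 : ContDiff ℝ ∞ fun x : ℂ × ℂ => Complex.normSq x.2 := contDiff_normSq.comp contDiff_snd
  have h3 := contDiff_scale i hc
  exact contDiff_const.add (((h1.div h3 fun x => (scale_pos i hc x).ne').sub
    (h3.mul h2)).div_const 2)

end Height

/-! ### Phases of complex numbers -/

/-- The phase `z / |z|` of a complex number, with `1` as the phase of `0`. -/
noncomputable def phase (z : ℂ) : Circle := Circle.exp (Complex.arg z)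

theorem norm_mul_phase (z : ℂ) : (‖z‖ : ℂ) * (phase z : ℂ) = z := by
  rw [phase, Circle.coe_exp]; exact Complex.norm_mul_exp_arg_mul_I z

theorem coe_phase {z : ℂ} (hz : z ≠ 0) : (phase z : ℂ) = z / ‖z‖ := by
  have : (‖z‖ : ℂ) ≠ 0 := by exact_mod_cast norm_ne_zero_iff.2 hz
  rw [eq_div_iff this, mul_comm, norm_mul_phase]

theorem phase_eq_of_eq_mul {z : ℂ} {r : ℝ} {e : Circle} (hr : 0 < r) (h : z = r * e) :
    phase z = e := by
  have hn : ‖z‖ = r := by rw [h, norm_mul, Circle.norm_coe, mul_one]; simp [abs_of_pos hr]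
  have h0 : (r : ℂ) ≠ 0 := by exact_mod_cast hr.ne'
  have hz : z ≠ 0 := by rw [h]; exact mul_ne_zero h0 e.coe_ne_zero
  ext
  rw [coe_phase hz, hn, h]
  field_simp

theorem phase_mul {z w : ℂ} (hz : z ≠ 0) (hw : w ≠ 0) : phase (z * w) = phase z * phase w := by
  refine phase_eq_of_eq_mul (r := ‖z‖ * ‖w‖)
    (mul_pos (norm_pos_iff.2 hz) (norm_pos_iff.2 hw)) ?_
  conv_lhs => rw [← norm_mul_phase z, ← norm_mul_phase w]
  push_cast
  ring

theorem continuousOn_phase : ContinuousOn phase {z | z ≠ 0} := by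
  have hi : Topology.IsInducing ((↑) : Circle → ℂ) := Topology.IsInducing.subtypeVal
  refine hi.continuousOn_iff.2 ?_
  have h : ContinuousOn (fun z : ℂ => z / (‖z‖ : ℂ)) {z | z ≠ 0} :=
    continuousOn_id.div (by fun_prop) fun z hz => by exact_mod_cast norm_ne_zero_iff.2 hz
  exact h.congr fun z hz => coe_phase hz

/-! ### Patches and the circle bundle -/

section Bundle

variable {n : ℕ} {c : Fin n → ℝ}

/-- The function `x² + y²`. -/
noncomputable def horizSq (p : ℝ × ℝ × ℝ) : ℝ := Complex.normSq (horiz p)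

theorem horizSq_nonneg (p : ℝ × ℝ × ℝ) : 0 ≤ horizSq p := Complex.normSq_nonneg _

theorem horizSq_pos_iff (p : ℝ × ℝ × ℝ) : 0 < horizSq p ↔ horiz p ≠ 0 := Complex.normSq_pos

theorem horizSq_eq (p : ℝ × ℝ × ℝ) : horizSq p = p.1 ^ 2 + p.2.1 ^ 2 := by
  simp [horizSq, horiz, Complex.normSq_apply, sq]

theorem rad_eq (j : Fin n) (p : ℝ × ℝ × ℝ) :
    rad c j p = Real.sqrt (horizSq p + (p.2.2 - c j) ^ 2) := by
  rw [horizSq_eq]; rfl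

theorem rad_sub_eq (j : Fin n) (p : ℝ × ℝ × ℝ) :
    rad c j p - (p.2.2 - c j) = rMinus (horizSq p) (p.2.2 - c j) := by
  rw [rad_eq]; rfl

theorem rad_add_eq (j : Fin n) (p : ℝ × ℝ × ℝ) :
    rad c j p + (p.2.2 - c j) = rPlus (horizSq p) (p.2.2 - c j) := by
  rw [rad_eq]; rfl

theorem mem_patch_iff (k : Fin (n + 1)) (p : ℝ × ℝ × ℝ) :
    p ∈ patch c k ↔
      0 < loProd c k.val (horizSq p) p.2.2 ∧ 0 < hiProd c k.val (horizSq p) p.2.2 := by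
  rw [loProd_pos_iff c _ (horizSq_nonneg p), hiProd_pos_iff c _ (horizSq_nonneg p)]
  simp only [patch, Set.mem_ofPred_eq, horizSq_pos_iff]
  by_cases h : horiz p = 0
  · simp only [h, ne_eq, not_true, false_or]
    exact ⟨fun H => ⟨fun j hj => (H j).1 hj, fun j hj => (H j).2 hj⟩,
      fun H j => ⟨H.1 j, H.2 j⟩⟩
  · simp [h]

theorem continuous_horiz : Continuous horiz := by
  have : horiz = fun p : ℝ × ℝ × ℝ => (p.1 : ℂ) + (p.2.1 : ℂ) * Complex.I := by
    funext p
    apply Complex.ext <;> simp [horiz]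
  rw [this]
  fun_prop

theorem continuous_horizSq : Continuous horizSq :=
  Complex.continuous_normSq.comp continuous_horiz

theorem continuous_loProd_horizSq (k : ℕ) :
    Continuous fun p : ℝ × ℝ × ℝ => loProd c k (horizSq p) p.2.2 :=
  (continuous_loProd c k).comp (continuous_horizSq.prodMk (by fun_prop))

theorem continuous_hiProd_horizSq (k : ℕ) :
    Continuous fun p : ℝ × ℝ × ℝ => hiProd c k (horizSq p) p.2.2 :=
  (continuous_hiProd c k).comp (continuous_horizSq.prodMk (by fun_prop))

theorem isOpen_patch (k : Fin (n + 1)) : IsOpen (patch c k) := by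
  have : patch c k = {p | 0 < loProd c k.val (horizSq p) p.2.2} ∩
      {p | 0 < hiProd c k.val (horizSq p) p.2.2} := by
    ext p; exact mem_patch_iff k p
  rw [this]
  exact (isOpen_lt continuous_const (continuous_loProd_horizSq k)).inter
    (isOpen_lt continuous_const (continuous_hiProd_horizSq k))

/-- The patches meet the axis in disjoint intervals. -/
theorem patch_axis_unique {k l : Fin (n + 1)} {p : ℝ × ℝ × ℝ} (h0 : horiz p = 0)
    (hk : p ∈ patch c k) (hl : p ∈ patch c l) : k = l := by
  wlog hkl : k ≤ l generalizing k l
  · exact (this hl hk (le_of_not_ge hkl)).symm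
  refine hkl.lt_or_eq.resolve_left fun hlt => ?_
  have hk' := hk.resolve_left (not_not.2 h0)
  have hl' := hl.resolve_left (not_not.2 h0)
  have hlt' : k.val < l.val := hlt
  have h1 := (hk' ⟨k.val, by omega⟩).2 le_rfl
  have h2 := (hl' ⟨k.val, by omega⟩).1 hlt'
  linarith

theorem bundleRel_equivalence : Equivalence (bundleRel c) where
  refl a := ⟨rfl, by simp⟩
  symm := by
    rintro ⟨k, p, e⟩ ⟨l, q, f⟩ ⟨h1, h2⟩
    refine ⟨h1.symm, ?_⟩
    simp only at h1 h2 ⊢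
    rw [h2, h1, mul_assoc, ← zpow_add]
    simp
  trans := by
    rintro ⟨k, p, e⟩ ⟨l, q, f⟩ ⟨m, r, g⟩ ⟨h1, h2⟩ ⟨h3, h4⟩
    refine ⟨h1.trans h3, ?_⟩
    simp only at h1 h2 h3 h4 ⊢
    rw [h4, h2, h1, mul_assoc, ← zpow_add]
    congr 2
    ring

theorem GHSpace.mk_eq_mk_iff {k l : Fin (n + 1)} {p : patch c k} {q : patch c l}
    {e f : Circle} : GHSpace.mk c k p e = GHSpace.mk c l q f ↔
      (p : ℝ × ℝ × ℝ) = q ∧ f = e * phase (horiz p) ^ ((k.val : ℤ) - (l.val : ℤ)) := by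
  exact ⟨fun h => (bundleRel_equivalence.eqvGen_iff).1 (Quot.eqvGen_exact (Sum.inl.inj h)),
    fun h => congrArg Sum.inl (Quot.sound h)⟩

theorem GHSpace.mk_ne_pt {k : Fin (n + 1)} {p : patch c k} {e : Circle} {j : Fin n} :
    GHSpace.mk c k p e ≠ GHSpace.pt c j := by
  exact Sum.inl_ne_inr

theorem GHSpace.exists_rep (y : GHSpace c) :
    (∃ k p e, y = GHSpace.mk c k p e) ∨ ∃ j, y = GHSpace.pt c j := by
  rcases y with ⟨⟨k, p, e⟩⟩ | j
  · exact Or.inl ⟨k, p, e, rfl⟩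
  · exact Or.inr ⟨j, rfl⟩

theorem GHSpace.proj_mk (k : Fin (n + 1)) (p : patch c k) (e : Circle) :
    GHSpace.proj c (GHSpace.mk c k p e) = p := rfl

theorem GHSpace.proj_pt (j : Fin n) : GHSpace.proj c (GHSpace.pt c j) = center c j := rfl

theorem GHSpace.continuous_mk (k : Fin (n + 1)) :
    Continuous fun a : patch c k × Circle => GHSpace.mk c k a.1 a.2 :=
  ⟨fun _ hO => hO.1 k⟩

/-! ### The chart coordinates on the bundle -/

/-- The function `z₁ / z₂ ^ k` on the part of the bundle over the patch of index `k`, where it has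
no zero; its modulus is a function on the patch, and its phase is the fibre coordinate. -/
noncomputable def patchCoord (c : Fin n → ℝ) (k : ℕ) (p : ℝ × ℝ × ℝ) (e : Circle) : ℂ :=
  (Real.sqrt (hiProd c k (horizSq p) p.2.2 / loProd c k (horizSq p) p.2.2) : ℂ) * e

/-- The coordinates `α_i = z₂ ^ (i + 1) / z₁`, `β_i = z₁ / z₂ ^ i` in terms of the trivialization
over the patch of index `k`. -/
noncomputable def chartCoord (c : Fin n → ℝ) (i k : ℕ) (p : ℝ × ℝ × ℝ) (e : Circle) : ℂ × ℂ :=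
  (horiz p ^ ((i : ℤ) + 1 - k) * (patchCoord c k p e)⁻¹,
    horiz p ^ ((k : ℤ) - i) * patchCoord c k p e)

/-- The points of the patch of index `k` over which the bundle lies in the chart of index `i`. -/
def InChart (i : Fin n) (k : Fin (n + 1)) (p : ℝ × ℝ × ℝ) : Prop :=
  horiz p ≠ 0 ∨ k = i.castSucc ∨ k = i.succ

theorem normSq_patchCoord {k : Fin (n + 1)} {p : ℝ × ℝ × ℝ} (hp : p ∈ patch c k) (e : Circle) :
    Complex.normSq (patchCoord c k p e) =
      hiProd c k (horizSq p) p.2.2 / loProd c k (horizSq p) p.2.2 := by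
  obtain ⟨h1, h2⟩ := (mem_patch_iff k p).1 hp
  rw [patchCoord, map_mul, Circle.normSq_coe, Complex.normSq_ofReal, mul_one,
    Real.mul_self_sqrt (div_pos h2 h1).le]

theorem patchCoord_ne_zero {k : Fin (n + 1)} {p : ℝ × ℝ × ℝ} (hp : p ∈ patch c k) (e : Circle) :
    patchCoord c k p e ≠ 0 := by
  obtain ⟨h1, h2⟩ := (mem_patch_iff k p).1 hp
  rw [← Complex.normSq_pos, normSq_patchCoord hp]
  exact div_pos h2 h1

theorem phase_patchCoord {k : Fin (n + 1)} {p : ℝ × ℝ × ℝ} (hp : p ∈ patch c k) (e : Circle) :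
    phase (patchCoord c k p e) = e := by
  obtain ⟨h1, h2⟩ := (mem_patch_iff k p).1 hp
  exact phase_eq_of_eq_mul (Real.sqrt_pos.2 (div_pos h2 h1)) rfl

theorem phase_zpow {z : ℂ} (hz : z ≠ 0) (m : ℤ) : phase (z ^ m) = phase z ^ m := by
  refine phase_eq_of_eq_mul (r := ‖z‖ ^ m) (zpow_pos (norm_pos_iff.2 hz) m) ?_
  conv_lhs => rw [← norm_mul_phase z, mul_zpow]
  push_cast
  rfl

theorem phase_inv {z : ℂ} (hz : z ≠ 0) : phase z⁻¹ = (phase z)⁻¹ := by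
  simpa using phase_zpow hz (-1)

theorem eq_of_normSq_eq_of_phase_eq {z w : ℂ} (h1 : Complex.normSq z = Complex.normSq w)
    (h2 : phase z = phase w) : z = w := by
  rw [← norm_mul_phase z, ← norm_mul_phase w, h2]
  congr 2
  rw [Complex.normSq_eq_norm_sq, Complex.normSq_eq_norm_sq] at h1
  exact (sq_eq_sq₀ (norm_nonneg _) (norm_nonneg _)).1 h1

theorem normSq_zpow (z : ℂ) (m : ℤ) : Complex.normSq (z ^ m) = Complex.normSq z ^ m :=
  map_zpow₀ Complex.normSq z m

theorem loProd_div_hiProd {k : ℕ} (hk : k ≤ n) {R : ℝ} (hR : 0 < R) (z : ℝ) :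
    loProd c k R z / hiProd c k R z = R ^ k / hiProd c 0 R z := by
  have h := loProd_mul_hiProd_zero c hk hR.le z
  have h1 : 0 < hiProd c k R z := (hiProd_pos_iff c k hR.le z).2 fun _ _ => Or.inl hR
  have h2 : 0 < hiProd c 0 R z := (hiProd_pos_iff c 0 hR.le z).2 fun _ _ => Or.inl hR
  rw [div_eq_div_iff h1.ne' h2.ne', h]

/-- The transition between the trivializations, in terms of the functions `z₁ / z₂ ^ k`. -/
theorem patchCoord_change {k l : Fin (n + 1)} {p : ℝ × ℝ × ℝ} (h0 : horiz p ≠ 0) (e : Circle) :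
    patchCoord c l p (e * phase (horiz p) ^ ((k.val : ℤ) - (l.val : ℤ))) =
      patchCoord c k p e * horiz p ^ ((k.val : ℤ) - (l.val : ℤ)) := by
  have hk : p ∈ patch c k := Or.inl h0
  have hl : p ∈ patch c l := Or.inl h0
  refine eq_of_normSq_eq_of_phase_eq ?_ ?_
  · have hR := (horizSq_pos_iff p).2 h0
    rw [map_mul, normSq_patchCoord hk, normSq_patchCoord hl, normSq_zpow, ← inv_div,
      loProd_div_hiProd (by omega) hR, ← inv_div (loProd _ _ _ _),
      loProd_div_hiProd (by omega) hR, inv_div, inv_div]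
    change _ = _ * horizSq p ^ _
    rw [zpow_sub₀ hR.ne', zpow_natCast, zpow_natCast]
    field_simp
  · rw [phase_patchCoord hl, phase_mul (patchCoord_ne_zero hk e) (zpow_ne_zero _ h0),
      phase_patchCoord hk, phase_zpow h0]

theorem chartCoord_fst_mul_snd {i : Fin n} {k : Fin (n + 1)} {p : ℝ × ℝ × ℝ}
    (hp : p ∈ patch c k) (hi : InChart i k p) (e : Circle) :
    (chartCoord c i k p e).1 * (chartCoord c i k p e).2 = horiz p := by
  have h := patchCoord_ne_zero hp e
  have : horiz p ^ ((i : ℤ) + 1 - k) * horiz p ^ ((k : ℤ) - i) = horiz p := by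
    rcases hi with h | rfl | rfl
    · rw [← zpow_add₀ h]; simp
    · simp
    · simp
  simp only [chartCoord]
  rw [mul_mul_mul_comm, this, inv_mul_cancel₀ h, mul_one]

theorem chartCoord_congr {i : Fin n} {k l : Fin (n + 1)} {p : patch c k} {q : patch c l}
    {e f : Circle} (h : GHSpace.mk c k p e = GHSpace.mk c l q f) :
    chartCoord c i k p e = chartCoord c i l q f := by
  obtain ⟨h1, h2⟩ := GHSpace.mk_eq_mk_iff.1 h
  obtain ⟨p, hp⟩ := p
  obtain ⟨q, hq⟩ := q
  simp only at h1 h2 ⊢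
  subst h1
  by_cases h0 : horiz p = 0
  · obtain rfl := patch_axis_unique h0 hp hq
    simp [h2]
  · simp only [chartCoord]
    rw [h2, patchCoord_change h0]
    have := patchCoord_ne_zero hp e
    ext
    · simp only
      rw [mul_inv, ← zpow_neg, mul_left_comm, ← zpow_add₀ h0, mul_comm]
      congr 2; ring
    · simp only
      rw [mul_left_comm, ← zpow_add₀ h0, mul_comm]
      congr 2; ring

/-- The coordinates `(α_i, β_i)` of a point of the bundle satisfy the equations for its height. -/
theorem isHeight_chartCoord {i : Fin n} {k : Fin (n + 1)} {p : ℝ × ℝ × ℝ}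
    (hp : p ∈ patch c k) (hi : InChart i k p) (e : Circle) :
    IsHeight c i (Complex.normSq (chartCoord c i k p e).1)
      (Complex.normSq (chartCoord c i k p e).2) p.2.2 := by
  obtain ⟨hlo, hhi⟩ := (mem_patch_iff k p).1 hp
  have hR : Complex.normSq (chartCoord c i k p e).1 * Complex.normSq (chartCoord c i k p e).2 =
      horizSq p := by
    rw [← map_mul, chartCoord_fst_mul_snd hp hi]; rfl
  rw [IsHeight, hR]
  simp only [chartCoord, map_mul, normSq_zpow, map_inv₀, normSq_patchCoord hp, inv_div]
  change horizSq p ^ _ * _ * _ = _ ∧ horizSq p ^ _ * _ * _ = _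
  have hab := rMinus_mul_rPlus (horizSq_nonneg p) (p.2.2 - c i)
  rcases hi with h0 | rfl | rfl
  · have hR := (horizSq_pos_iff p).2 h0
    have h00 : 0 < hiProd c 0 (horizSq p) p.2.2 :=
      (hiProd_pos_iff c 0 hR.le _).2 fun _ _ => Or.inl hR
    have e1 := loProd_mul_hiProd_zero c (k := i.val + 1) (by omega) hR.le p.2.2
    have e2 := loProd_mul_hiProd_zero c (k := i.val) (by omega) hR.le p.2.2
    constructor
    · rw [loProd_div_hiProd (by omega) hR, zpow_sub₀ hR.ne', zpow_natCast]
      norm_cast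
      field_simp
      exact e1.symm.trans (mul_comm _ _)
    · rw [← inv_div, loProd_div_hiProd (by omega) hR, inv_div, zpow_sub₀ hR.ne', zpow_natCast,
        zpow_natCast]
      field_simp
      rw [mul_comm, e2, mul_comm]
  · simp only [Fin.val_castSucc] at hlo hhi ⊢
    rw [hiProd_eq_mul_succ] at hhi ⊢
    have h1 := hhi.ne'
    have h2 := left_ne_zero_of_mul h1
    have h3 := right_ne_zero_of_mul h1
    simp only [add_sub_cancel_left, zpow_one, sub_self, zpow_zero, one_mul]
    constructor
    · rw [loProd_succ]
      field_simp
      exact hab.symm.trans (mul_comm _ _) |>.trans (mul_comm _ _)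
    · field_simp
  · simp only [Fin.val_succ] at hlo hhi ⊢
    rw [loProd_succ] at hlo ⊢
    have h1 := hlo.ne'
    have h2 := left_ne_zero_of_mul h1
    have h3 := right_ne_zero_of_mul h1
    push_cast
    simp only [add_sub_cancel_left, zpow_one, sub_self, zpow_zero, one_mul]
    constructor
    · field_simp
    · rw [hiProd_eq_mul_succ]
      field_simp
      exact hab.symm.trans (mul_comm _ _)

theorem height_chartCoord (hc : StrictMono c) {i : Fin n} {k : Fin (n + 1)} {p : ℝ × ℝ × ℝ}
    (hp : p ∈ patch c k) (hi : InChart i k p) (e : Circle) :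
    height c i (chartCoord c i k p e) = p.2.2 :=
  height_unique i hc (isHeight_chartCoord hp hi e)

/-! ### The charts of the Gibbons–Hawking space -/

/-- The point of `ℝ³` below the point with coordinates `(α_i, β_i)`. -/
noncomputable def position (c : Fin n → ℝ) (i : Fin n) (x : ℂ × ℂ) : ℝ × ℝ × ℝ :=
  ((x.1 * x.2).re, (x.1 * x.2).im, height c i x)

theorem horiz_position (i : Fin n) (x : ℂ × ℂ) : horiz (position c i x) = x.1 * x.2 := rfl

theorem horizSq_position (i : Fin n) (x : ℂ × ℂ) : horizSq (position c i x) = modSq x := by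
  rw [horizSq, horiz_position, map_mul]; rfl

theorem position_chartCoord (hc : StrictMono c) {i : Fin n} {k : Fin (n + 1)} {p : ℝ × ℝ × ℝ}
    (hp : p ∈ patch c k) (hi : InChart i k p) (e : Circle) :
    position c i (chartCoord c i k p e) = p := by
  rw [position, chartCoord_fst_mul_snd hp hi, height_chartCoord hc hp hi]; rfl

theorem position_mem_succ (hc : StrictMono c) (i : Fin n) {x : ℂ × ℂ} (hx : x.1 ≠ 0) :
    position c i x ∈ patch c i.succ := by
  rw [mem_patch_iff, horizSq_position]
  have h := (isHeight_height c i x).1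
  refine ⟨?_, hiProd_height_pos i hc x⟩
  have := mul_pos (Complex.normSq_pos.2 hx) (hiProd_height_pos i hc x)
  exact lt_of_lt_of_eq this h

theorem position_mem_castSucc (hc : StrictMono c) (i : Fin n) {x : ℂ × ℂ} (hx : x.2 ≠ 0) :
    position c i x ∈ patch c i.castSucc := by
  rw [mem_patch_iff, horizSq_position]
  have h := (isHeight_height c i x).2
  refine ⟨loProd_height_pos i hc x, ?_⟩
  have := mul_pos (Complex.normSq_pos.2 hx) (loProd_height_pos i hc x)
  exact lt_of_lt_of_eq this h

open Classical in
/-- The point of the Gibbons–Hawking space with coordinates `(α_i, β_i)`.  As `z₁ / z₂ ^ (i + 1)`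
is `α_i⁻¹` and `z₁ / z₂ ^ i` is `β_i`, these numbers determine the fibre coordinates over the two
patches that meet the chart in points of the axis. -/
noncomputable def chartMap (hc : StrictMono c) (i : Fin n) (x : ℂ × ℂ) : GHSpace c :=
  if h₁ : x.1 ≠ 0 then
    GHSpace.mk c i.succ ⟨position c i x, position_mem_succ hc i h₁⟩ (phase x.1)⁻¹
  else if h₂ : x.2 ≠ 0 then
    GHSpace.mk c i.castSucc ⟨position c i x, position_mem_castSucc hc i h₂⟩ (phase x.2)
  else GHSpace.pt c i

theorem chartMap_of_fst_ne (hc : StrictMono c) (i : Fin n) {x : ℂ × ℂ} (h : x.1 ≠ 0) :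
    chartMap hc i x =
      GHSpace.mk c i.succ ⟨position c i x, position_mem_succ hc i h⟩ (phase x.1)⁻¹ :=
  dif_pos h

theorem chartMap_of_snd_ne (hc : StrictMono c) (i : Fin n) {x : ℂ × ℂ} (h : x.2 ≠ 0) :
    chartMap hc i x =
      GHSpace.mk c i.castSucc ⟨position c i x, position_mem_castSucc hc i h⟩ (phase x.2) := by
  by_cases h1 : x.1 = 0
  · unfold chartMap
    rw [dif_neg (not_not.2 h1), dif_pos h]
  · rw [chartMap_of_fst_ne hc i h1, GHSpace.mk_eq_mk_iff]
    refine ⟨rfl, ?_⟩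
    simp only [horiz_position, phase_mul h1 h, Fin.val_succ, Fin.val_castSucc]
    push_cast
    simp

theorem chartMap_zero (hc : StrictMono c) (i : Fin n) : chartMap hc i 0 = GHSpace.pt c i := by
  simp [chartMap]

theorem eq_zero_or (x : ℂ × ℂ) : x.1 ≠ 0 ∨ x.2 ≠ 0 ∨ x = 0 := by
  by_cases h1 : x.1 = 0
  · by_cases h2 : x.2 = 0
    · exact Or.inr (Or.inr (Prod.ext h1 h2))
    · exact Or.inr (Or.inl h2)
  · exact Or.inl h1

theorem proj_chartMap (hc : StrictMono c) (i : Fin n) (x : ℂ × ℂ) :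
    GHSpace.proj c (chartMap hc i x) = position c i x := by
  rcases eq_zero_or x with h | h | rfl
  · rw [chartMap_of_fst_ne hc i h]; rfl
  · rw [chartMap_of_snd_ne hc i h]; rfl
  · rw [chartMap_zero, GHSpace.proj_pt]
    simp [center, position, height_eq i hc]

theorem chartMap_chartCoord (hc : StrictMono c) {i : Fin n} {k : Fin (n + 1)} (p : patch c k)
    (hi : InChart i k p) (e : Circle) :
    chartMap hc i (chartCoord c i k p e) = GHSpace.mk c k p e := by
  obtain ⟨p, hp⟩ := p
  have hP := patchCoord_ne_zero hp e
  have hpos := position_chartCoord hc hp hi e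
  by_cases h1 : (chartCoord c i k p e).1 = 0
  · have h0 : horiz p = 0 := by rw [← chartCoord_fst_mul_snd hp hi e, h1, zero_mul]
    have hk : k = i.castSucc := by
      rcases hi with h | h | rfl
      · exact absurd h0 h
      · exact h
      · exfalso
        simp [chartCoord] at h1
        exact hP h1
    subst hk
    have h2 : (chartCoord c i i.castSucc p e).2 = patchCoord c i.castSucc p e := by
      simp [chartCoord]
    rw [chartMap_of_snd_ne hc i (by rw [h2]; exact hP), GHSpace.mk_eq_mk_iff]
    refine ⟨hpos, ?_⟩
    rw [sub_self, zpow_zero, mul_one]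
    exact ((congrArg phase h2).trans (phase_patchCoord hp e)).symm
  · rw [chartMap_of_fst_ne hc i h1, GHSpace.mk_eq_mk_iff]
    refine ⟨hpos, ?_⟩
    simp only [hpos]
    simp only [chartCoord] at h1 ⊢
    by_cases h0 : horiz p = 0
    · have hk : (i.val : ℤ) + 1 - k.val = 0 := by
        by_contra hne
        exact h1 (by rw [h0, zero_zpow _ hne, zero_mul])
      rw [hk, show ((i.succ.val : ℤ) - k.val) = 0 by rw [← hk]; simp, zpow_zero, zpow_zero,
        one_mul, phase_inv hP, phase_patchCoord hp]
      simp
    · rw [phase_mul (zpow_ne_zero _ h0) (inv_ne_zero hP), phase_inv hP, phase_patchCoord hp,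
        phase_zpow h0]
      simp

/-- The coordinates of a point of the chart in terms of the trivialization over the patch with
index `i + 1`. -/
theorem chartCoord_of_fst_ne (hc : StrictMono c) (i : Fin n) {x : ℂ × ℂ} (h : x.1 ≠ 0) :
    chartCoord c i i.succ (position c i x) (phase x.1)⁻¹ = x := by
  have hm := position_mem_succ hc i h
  have hP : patchCoord c i.succ (position c i x) (phase x.1)⁻¹ = x.1⁻¹ := by
    refine eq_of_normSq_eq_of_phase_eq ?_ ?_
    · rw [normSq_patchCoord hm, map_inv₀, horizSq_position]
      have h1 := (isHeight_height c i x).1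
      have h2 := hiProd_height_pos i hc x
      have h3 := Complex.normSq_pos.2 h
      have h4 : loProd c i.succ.val (modSq x) (position c i x).2.2 =
        Complex.normSq x.1 * hiProd c i.succ.val (modSq x) (position c i x).2.2 := h1.symm
      have h5 : 0 < hiProd c i.succ.val (modSq x) (position c i x).2.2 := h2
      rw [h4]
      field_simp
    · rw [phase_patchCoord hm, phase_inv h]
  rw [chartCoord, hP, horiz_position]
  simp only [Fin.val_succ]
  push_cast
  ext
  · simp
  · simp only [add_sub_cancel_left, zpow_one]
    field_simp

theorem chartCoord_of_snd_ne (hc : StrictMono c) (i : Fin n) {x : ℂ × ℂ} (h : x.2 ≠ 0) :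
    chartCoord c i i.castSucc (position c i x) (phase x.2) = x := by
  have hm := position_mem_castSucc hc i h
  have hP : patchCoord c i.castSucc (position c i x) (phase x.2) = x.2 := by
    refine eq_of_normSq_eq_of_phase_eq ?_ ?_
    · rw [normSq_patchCoord hm, horizSq_position]
      have h4 : hiProd c i.castSucc.val (modSq x) (position c i x).2.2 =
        Complex.normSq x.2 * loProd c i.castSucc.val (modSq x) (position c i x).2.2 :=
        (isHeight_height c i x).2.symm
      have h5 : 0 < loProd c i.castSucc.val (modSq x) (position c i x).2.2 :=
        loProd_height_pos i hc x
      rw [h4]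
      field_simp
    · rw [phase_patchCoord hm]
  rw [chartCoord, hP, horiz_position]
  simp only [Fin.val_castSucc]
  ext
  · simp [h]
  · simp

theorem chartMap_eq_mk (hc : StrictMono c) {i : Fin n} {k : Fin (n + 1)} {x : ℂ × ℂ}
    {p : patch c k} {e : Circle} (h : chartMap hc i x = GHSpace.mk c k p e) :
    InChart i k p ∧ chartCoord c i k p e = x := by
  rcases eq_zero_or x with h1 | h1 | rfl
  · rw [chartMap_of_fst_ne hc i h1] at h
    refine ⟨?_, (chartCoord_congr h).symm.trans (chartCoord_of_fst_ne hc i h1)⟩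
    by_cases h0 : horiz p = 0
    · have hp := (GHSpace.mk_eq_mk_iff.1 h).1
      simp only at hp
      refine Or.inr (Or.inr (patch_axis_unique h0 p.2 ?_))
      rw [← hp]
      exact position_mem_succ hc i h1
    · exact Or.inl h0
  · rw [chartMap_of_snd_ne hc i h1] at h
    refine ⟨?_, (chartCoord_congr h).symm.trans (chartCoord_of_snd_ne hc i h1)⟩
    by_cases h0 : horiz p = 0
    · have hp := (GHSpace.mk_eq_mk_iff.1 h).1
      simp only at hp
      refine Or.inr (Or.inl (patch_axis_unique h0 p.2 ?_))
      rw [← hp]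
      exact position_mem_castSucc hc i h1
    · exact Or.inl h0
  · rw [chartMap_zero] at h
    exact absurd h.symm GHSpace.mk_ne_pt

theorem chartMap_eq_pt (hc : StrictMono c) {i j : Fin n} {x : ℂ × ℂ}
    (h : chartMap hc i x = GHSpace.pt c j) : i = j ∧ x = 0 := by
  rcases eq_zero_or x with h1 | h1 | rfl
  · rw [chartMap_of_fst_ne hc i h1] at h
    exact absurd h GHSpace.mk_ne_pt
  · rw [chartMap_of_snd_ne hc i h1] at h
    exact absurd h GHSpace.mk_ne_pt
  · rw [chartMap_zero] at h
    exact ⟨Sum.inr.inj h, rfl⟩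

/-- `chartMap` inverts `chartCoord` over each patch. -/
theorem chartMap_eq_mk_iff (hc : StrictMono c) {i : Fin n} {k : Fin (n + 1)} {x : ℂ × ℂ}
    {p : patch c k} {e : Circle} : chartMap hc i x = GHSpace.mk c k p e ↔
    InChart i k p ∧ chartCoord c i k p e = x :=
  ⟨chartMap_eq_mk hc, fun h => by rw [← h.2, chartMap_chartCoord hc p h.1]⟩

theorem chartMap_injective (hc : StrictMono c) (i : Fin n) :
    Function.Injective (chartMap hc i) := by
  intro x y h
  rcases GHSpace.exists_rep (chartMap hc i y) with ⟨k, p, e, h'⟩ | ⟨j, h'⟩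
  · rw [h'] at h
    rw [← (chartMap_eq_mk hc h).2, ← (chartMap_eq_mk hc h').2]
  · rw [h'] at h
    rw [(chartMap_eq_pt hc h).2, (chartMap_eq_pt hc h').2]

end Bundle

/-! ### The charts are open embeddings -/

section Homeo

variable {n : ℕ} {c : Fin n → ℝ}

theorem continuous_position (hc : StrictMono c) (i : Fin n) : Continuous (position c i) := by
  have := (contDiff_height i hc).continuous
  unfold position
  fun_prop

theorem continuous_chartMap (hc : StrictMono c) (i : Fin n) : Continuous (chartMap hc i) := by
  have hpos := continuous_position hc i
  rw [continuous_iff_continuousAt]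
  intro x
  rcases eq_zero_or x with h | h | rfl
  · have ho : IsOpen {y : ℂ × ℂ | y.1 ≠ 0} := isOpen_ne_fun continuous_fst continuous_const
    refine ContinuousOn.continuousAt (s := {y | y.1 ≠ 0}) ?_ (ho.mem_nhds h)
    rw [continuousOn_iff_continuous_domRestrict]
    have h1 : Continuous fun y : {y : ℂ × ℂ | y.1 ≠ 0} =>
        ((⟨position c i y, position_mem_succ hc i y.2⟩ : patch c i.succ),
          (phase (y : ℂ × ℂ).1)⁻¹) := by
      refine ((hpos.comp continuous_subtype_val).subtype_mk _).prodMk ?_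
      exact (continuousOn_phase.comp_continuous (continuous_fst.comp continuous_subtype_val)
        fun y => y.2).inv
    exact ((GHSpace.continuous_mk i.succ).comp h1).congr fun y =>
      (chartMap_of_fst_ne hc i y.2).symm
  · have ho : IsOpen {y : ℂ × ℂ | y.2 ≠ 0} := isOpen_ne_fun continuous_snd continuous_const
    refine ContinuousOn.continuousAt (s := {y | y.2 ≠ 0}) ?_ (ho.mem_nhds h)
    rw [continuousOn_iff_continuous_domRestrict]
    have h1 : Continuous fun y : {y : ℂ × ℂ | y.2 ≠ 0} =>
        ((⟨position c i y, position_mem_castSucc hc i y.2⟩ : patch c i.castSucc),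
          (phase (y : ℂ × ℂ).2)) := by
      refine ((hpos.comp continuous_subtype_val).subtype_mk _).prodMk ?_
      exact (continuousOn_phase.comp_continuous (continuous_snd.comp continuous_subtype_val)
        fun y => y.2)
    exact ((GHSpace.continuous_mk i.castSucc).comp h1).congr fun y =>
      (chartMap_of_snd_ne hc i y.2).symm
  · rw [ContinuousAt, chartMap_zero, tendsto_nhds]
    intro O hO hmem
    obtain ⟨ε, hε, h⟩ := hO.2 i hmem
    have h0 : position c i 0 = center c i := by
      rw [← proj_chartMap hc, chartMap_zero]; rfl
    have hball := hpos.continuousAt.preimage_mem_nhds (x := 0)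
      (by rw [h0]; exact Metric.ball_mem_nhds (center c i) hε)
    filter_upwards [hball] with y hy
    rcases eq_zero_or y with hy' | hy' | rfl
    · rw [Set.mem_preimage, chartMap_of_fst_ne hc i hy']
      exact h _ _ _ hy
    · rw [Set.mem_preimage, chartMap_of_snd_ne hc i hy']
      exact h _ _ _ hy
    · rw [Set.mem_preimage, chartMap_zero]
      exact hmem

theorem isOpen_inChart (i : Fin n) (k : Fin (n + 1)) : IsOpen {p | InChart i k p} := by
  by_cases h : k = i.castSucc ∨ k = i.succ
  · have : {p | InChart i k p} = Set.univ := by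
      ext p; simp [InChart, h]
    rw [this]; exact isOpen_univ
  · have : {p | InChart i k p} = {p | horiz p ≠ 0} := by
      ext p; simp [InChart, h]
    rw [this]
    exact isOpen_ne_fun continuous_horiz continuous_const

theorem continuous_circle_coe : Continuous ((↑) : Circle → ℂ) := continuous_subtype_val

theorem continuousAt_horiz_zpow {X : Type*} [TopologicalSpace X] {f : X → ℂ} {x : X} {m : ℤ}
    (hf : ContinuousAt f x) (h : f x ≠ 0 ∨ 0 ≤ m) : ContinuousAt (fun y => f y ^ m) x :=
  hf.zpow₀ m h

theorem InChart.exponents {i : Fin n} {k : Fin (n + 1)} {p : ℝ × ℝ × ℝ} (h : InChart i k p) :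
    (horiz p ≠ 0 ∨ (0 : ℤ) ≤ (i : ℤ) + 1 - k) ∧ (horiz p ≠ 0 ∨ (0 : ℤ) ≤ (k : ℤ) - i) := by
  rcases h with h | rfl | rfl
  · exact ⟨Or.inl h, Or.inl h⟩
  · constructor <;> right <;> simp
  · constructor <;> right <;> simp

theorem continuousAt_chartCoord {i : Fin n} {k : Fin (n + 1)} {a : (ℝ × ℝ × ℝ) × Circle}
    (ha : a.1 ∈ patch c k) (hi : InChart i k a.1) :
    ContinuousAt (fun a : (ℝ × ℝ × ℝ) × Circle => chartCoord c i k a.1 a.2) a := by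
  obtain ⟨h1, h2⟩ := (mem_patch_iff k a.1).1 ha
  have hP : ContinuousAt (fun a : (ℝ × ℝ × ℝ) × Circle => patchCoord c k a.1 a.2) a := by
    unfold patchCoord
    have hd : ContinuousAt (fun a : (ℝ × ℝ × ℝ) × Circle =>
        hiProd c k (horizSq a.1) a.1.2.2 / loProd c k (horizSq a.1) a.1.2.2) a :=
      ((continuous_hiProd_horizSq k.val).comp continuous_fst).continuousAt.div
        ((continuous_loProd_horizSq k.val).comp continuous_fst).continuousAt h1.ne'
    have hs := Complex.continuous_ofReal.continuousAt.comp hd.sqrt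
    exact hs.mul (continuous_circle_coe.comp continuous_snd).continuousAt
  have hh : ContinuousAt (fun a : (ℝ × ℝ × ℝ) × Circle => horiz a.1) a :=
    (continuous_horiz.comp continuous_fst).continuousAt
  exact ((continuousAt_horiz_zpow hh hi.exponents.1).mul (hP.inv₀ (patchCoord_ne_zero ha a.2))).prodMk
    ((continuousAt_horiz_zpow hh hi.exponents.2).mul hP)

/-- Near the special point over `c i`, the bundle lies in the chart of index `i`. -/
theorem inChart_of_pos {i : Fin n} {k : Fin (n + 1)} {p : ℝ × ℝ × ℝ}
    (hp : p ∈ patch c k) (h1 : 0 < loProd c i.val (horizSq p) p.2.2)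
    (h2 : 0 < hiProd c (i.val + 1) (horizSq p) p.2.2) : InChart i k p := by
  by_cases h0 : horiz p = 0
  · right
    have hR : ¬ 0 < horizSq p := by rw [horizSq_pos_iff]; simpa using h0
    have h1' := (loProd_pos_iff c _ (horizSq_nonneg p) _).1 h1
    have h2' := (hiProd_pos_iff c _ (horizSq_nonneg p) _).1 h2
    have hk := hp.resolve_left (not_not.2 h0)
    have hge : i.val ≤ k.val := by
      by_contra! hlt
      have e1 := (h1' ⟨k.val, by omega⟩ hlt).resolve_left hR
      have e2 := (hk ⟨k.val, by omega⟩).2 le_rfl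
      linarith
    have hle : k.val ≤ i.val + 1 := by
      by_contra! hlt
      have e1 := (h2' ⟨i.val + 1, by omega⟩ le_rfl).resolve_left hR
      have e2 := (hk ⟨i.val + 1, by omega⟩).1 hlt
      linarith
    rcases hge.eq_or_lt with h | h
    · exact Or.inl (Fin.ext h.symm)
    · exact Or.inr (Fin.ext (by simp; omega))
  · exact Or.inl h0

/-- The image of a neighbourhood of a point is a neighbourhood: over a patch because `chartCoord` is a
continuous inverse, and at the added point because the chart coordinates are small over a small ball
around `p_i`. -/
theorem isOpenMap_chartMap (hc : StrictMono c) (i : Fin n) : IsOpenMap (chartMap hc i) := by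
  intro U hU
  refine ⟨fun k => ?_, fun j hj => ?_⟩
  · have : {a : patch c k × Circle | GHSpace.mk c k a.1 a.2 ∈ chartMap hc i '' U} =
        {a | InChart i k a.1 ∧ chartCoord c i k a.1 a.2 ∈ U} := by
      ext a
      constructor
      · rintro ⟨x, hx, hxa⟩
        obtain ⟨h1, h2⟩ := chartMap_eq_mk hc hxa
        exact ⟨h1, by rwa [h2]⟩
      · rintro ⟨h1, h2⟩
        exact ⟨_, h2, chartMap_chartCoord hc a.1 h1 a.2⟩
    rw [this, isOpen_iff_mem_nhds]
    rintro ⟨p, e⟩ ⟨h1, h2⟩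
    have hval : Continuous fun a : patch c k × Circle => ((a.1 : ℝ × ℝ × ℝ), a.2) := by fun_prop
    have e1 : ∀ᶠ a : patch c k × Circle in nhds (p, e), InChart i k a.1 :=
      ((isOpen_inChart i k).preimage (continuous_fst.comp hval)).mem_nhds h1
    have hcont := ContinuousAt.comp (x := (p, e)) (f := fun a : patch c k × Circle =>
      ((a.1 : ℝ × ℝ × ℝ), a.2)) (continuousAt_chartCoord p.2 h1) hval.continuousAt
    have e2 : ∀ᶠ a : patch c k × Circle in nhds (p, e), chartCoord c i k a.1 a.2 ∈ U :=
      hcont.preimage_mem_nhds (hU.mem_nhds h2)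
    exact e1.and e2
  · obtain ⟨x, hx, hxj⟩ := hj
    obtain ⟨rfl, rfl⟩ := chartMap_eq_pt hc hxj
    -- the squared moduli of the coordinates are continuous near the special point
    have c1 := continuous_loProd_horizSq (c := c) i.val
    have c2 := continuous_hiProd_horizSq (c := c) (i.val + 1)
    have c3 := continuous_loProd_horizSq (c := c) (i.val + 1)
    have c4 := continuous_hiProd_horizSq (c := c) i.val
    have z0 := proj_chartMap hc i 0
    rw [chartMap_zero, GHSpace.proj_pt] at z0
    have p1 : 0 < loProd c i.val (horizSq (center c i)) (center c i).2.2 := by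
      rw [z0, horizSq_position]; exact loProd_height_pos i hc 0
    have p2 : 0 < hiProd c (i.val + 1) (horizSq (center c i)) (center c i).2.2 := by
      rw [z0, horizSq_position]; exact hiProd_height_pos i hc 0
    have q1 : loProd c (i.val + 1) (horizSq (center c i)) (center c i).2.2 = 0 := by
      have h := (isHeight_height c i 0).1
      rw [z0, horizSq_position]
      refine h.symm.trans ?_
      simp
    have q2 : hiProd c i.val (horizSq (center c i)) (center c i).2.2 = 0 := by
      have h := (isHeight_height c i 0).2
      rw [z0, horizSq_position]
      refine h.symm.trans ?_
      simp
    obtain ⟨δ, hδ, hU'⟩ := Metric.isOpen_iff.1 hU 0 hx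
    have e1 : ∀ᶠ p in nhds (center c i), 0 < loProd c i.val (horizSq p) p.2.2 :=
      c1.continuousAt.eventually_const_lt p1
    have e2 : ∀ᶠ p in nhds (center c i), 0 < hiProd c (i.val + 1) (horizSq p) p.2.2 :=
      c2.continuousAt.eventually_const_lt p2
    have e3 : ∀ᶠ p in nhds (center c i), loProd c (i.val + 1) (horizSq p) p.2.2 /
        hiProd c (i.val + 1) (horizSq p) p.2.2 < δ ^ 2 := by
      refine (c3.continuousAt.div c2.continuousAt p2.ne').eventually_lt_const ?_
      rw [Pi.div_apply, q1, zero_div]; positivity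
    have e4 : ∀ᶠ p in nhds (center c i), hiProd c i.val (horizSq p) p.2.2 /
        loProd c i.val (horizSq p) p.2.2 < δ ^ 2 := by
      refine (c4.continuousAt.div c1.continuousAt p1.ne').eventually_lt_const ?_
      rw [Pi.div_apply, q2, zero_div]; positivity
    obtain ⟨ε, hε, H⟩ := Metric.eventually_nhds_iff.1 (e1.and (e2.and (e3.and e4)))
    refine ⟨ε, hε, fun k p e hp => ?_⟩
    obtain ⟨H1, H2, H3, H4⟩ := H hp
    have hin := inChart_of_pos p.2 H1 H2
    refine ⟨_, hU' ?_, chartMap_chartCoord hc p hin e⟩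
    have hh := isHeight_chartCoord p.2 hin e
    have hR : Complex.normSq (chartCoord c i k p e).1 * Complex.normSq (chartCoord c i k p e).2 =
        horizSq p := by
      rw [← map_mul, chartCoord_fst_mul_snd p.2 hin]; rfl
    rw [IsHeight, hR, ← eq_div_iff H2.ne', ← eq_div_iff H1.ne'] at hh
    rw [mem_ball_zero_iff, Prod.norm_def, max_lt_iff]
    rw [← hh.1, Complex.normSq_eq_norm_sq] at H3
    rw [← hh.2, Complex.normSq_eq_norm_sq] at H4
    exact ⟨lt_of_pow_lt_pow_left₀ 2 hδ.le H3, lt_of_pow_lt_pow_left₀ 2 hδ.le H4⟩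

theorem isOpenEmbedding_chartMap (hc : StrictMono c) (i : Fin n) :
    Topology.IsOpenEmbedding (chartMap hc i) :=
  .of_continuous_injective_isOpenMap (continuous_chartMap hc i) (chartMap_injective hc i)
    (isOpenMap_chartMap hc i)

theorem exists_chartMap_eq (hc : StrictMono c) (hn : 1 ≤ n) (y : GHSpace c) :
    ∃ i x, chartMap hc i x = y := by
  rcases GHSpace.exists_rep y with ⟨k, p, e, rfl⟩ | ⟨j, rfl⟩
  · refine Fin.cases (motive := fun k => ∀ p : patch c k, ∃ i x, chartMap hc i x =
      GHSpace.mk c k p e) (fun p => ?_) (fun i p => ?_) k p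
    · exact ⟨⟨0, hn⟩, _, chartMap_chartCoord hc p (Or.inr (Or.inl (Fin.ext rfl))) e⟩
    · exact ⟨i, _, chartMap_chartCoord hc p (Or.inr (Or.inr rfl)) e⟩
  · exact ⟨j, 0, chartMap_zero hc j⟩

/-! ### The homeomorphism -/

/-- The heights of the points of consecutive charts match. -/
theorem position_transition (hc : StrictMono c) {i j : Fin n} (hij : i.val + 1 = j.val)
    {x : ℂ × ℂ} (hx : x.1 ≠ 0) :
    position c j (chartTransition x) = position c i x := by
  have hprod : (chartTransition x).1 * (chartTransition x).2 = x.1 * x.2 := by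
    simp only [chartTransition]; field_simp
  have hmod : Complex.normSq (chartTransition x).1 * Complex.normSq (chartTransition x).2 =
      modSq x := by rw [← map_mul, hprod, map_mul]; rfl
  have hh : height c j (chartTransition x) = height c i x := by
    refine height_unique j hc ?_
    rw [IsHeight, hmod]
    obtain ⟨h1, h2⟩ := isHeight_height c i x
    change _ * hiProd c (i.val + 1) (modSq x) _ = loProd c (i.val + 1) (modSq x) _ at h1
    have hA := (Complex.normSq_pos.2 hx).ne'
    have hab := rMinus_mul_rPlus (modSq_nonneg x) (height c i x - c j)
    simp only [chartTransition, map_mul, map_pow, map_inv₀]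
    rw [loProd_succ, ← hij, ← h1]
    have hlt : hiProd c (i.val + 1) (modSq x) (height c i x) =
        rMinus (modSq x) (height c i x - c j) * hiProd c (j.val + 1) (modSq x) (height c i x) := by
      rw [hij]; exact hiProd_eq_mul_succ c j _ _
    constructor
    · rw [← hij] at hlt
      rw [hlt]
      have hm : modSq x = Complex.normSq x.1 * Complex.normSq x.2 := rfl
      linear_combination (-Complex.normSq x.1 * hiProd c (i.val + 1 + 1) (modSq x) (height c i x))
        * (hab.trans hm)
    · field_simp
  rw [position, position, hprod, hh]

/-- The gluing of the charts is the change between the functions `z₂ ^ (i + 1) / z₁`, `z₁ / z₂ ^ i`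
for consecutive indices. -/
theorem chartMap_transition (hc : StrictMono c) {i j : Fin n} (hij : i.val + 1 = j.val)
    {x : ℂ × ℂ} (hx : x.1 ≠ 0) :
    chartMap hc j (chartTransition x) = chartMap hc i x := by
  have h2 : (chartTransition x).2 ≠ 0 := inv_ne_zero hx
  rw [chartMap_of_snd_ne hc j h2, chartMap_of_fst_ne hc i hx, GHSpace.mk_eq_mk_iff]
  refine ⟨position_transition hc hij hx, ?_⟩
  have : (j.castSucc.val : ℤ) - i.succ.val = 0 := by
    simp only [Fin.val_castSucc, Fin.val_succ]; omega
  rw [this, zpow_zero, mul_one]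
  simp only [chartTransition, phase_inv hx]

/-- The map from the glued surface to the Gibbons–Hawking space. -/
noncomputable def toGH (hc : StrictMono c) : GluedSurface n → GHSpace c :=
  Quot.lift (fun a => chartMap hc a.1 a.2) fun a b h => by
    rw [h.2.2, chartMap_transition hc h.1 h.2.1]

theorem toGH_incl (hc : StrictMono c) (i : Fin n) (x : ℂ × ℂ) :
    toGH hc (GluedSurface.incl i x) = chartMap hc i x := rfl

theorem exists_incl_eq (y : GluedSurface n) : ∃ i x, GluedSurface.incl i x = y := by
  obtain ⟨⟨i, x⟩, rfl⟩ := Quot.exists_rep y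
  exact ⟨i, x, rfl⟩

theorem incl_transition {i j : Fin n} (hij : i.val + 1 = j.val) {x : ℂ × ℂ} (hx : x.1 ≠ 0) :
    GluedSurface.incl j (chartTransition x) = GluedSurface.incl i x :=
  (Quot.sound ⟨hij, hx, rfl⟩).symm

/-- The `β_i`-axis lies over the part of the axis below `c i`. -/
theorem height_le_of_fst_eq_zero (hc : StrictMono c) {i : Fin n} {x : ℂ × ℂ} (h : x.1 = 0) :
    height c i x ≤ c i := by
  have := scale_pos i hc x
  rw [height_eq i hc, h]
  have := mul_nonneg this.le (Complex.normSq_nonneg x.2)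
  simp only [map_zero, zero_div]
  linarith

theorem le_height_of_snd_eq_zero (hc : StrictMono c) {i : Fin n} {x : ℂ × ℂ} (h : x.2 = 0) :
    c i ≤ height c i x := by
  have := scale_pos i hc x
  rw [height_eq i hc, h]
  have := div_nonneg (Complex.normSq_nonneg x.1) this.le
  simp only [map_zero, mul_zero]
  linarith

theorem modSq_eq_zero_of_fst {x : ℂ × ℂ} (h : x.1 = 0) : modSq x = 0 := by simp [modSq, h]

theorem modSq_eq_zero_of_snd {x : ℂ × ℂ} (h : x.2 = 0) : modSq x = 0 := by simp [modSq, h]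

theorem lt_height_of_lt (hc : StrictMono c) {i j : Fin n} {x : ℂ × ℂ} (h : modSq x = 0)
    (hj : j < i) : c j < height c i x :=
  ((loProd_pos_iff c _ (modSq_nonneg x) _).1 (loProd_height_pos i hc x) j hj).resolve_left
    (by rw [h]; exact lt_irrefl 0)

theorem height_lt_of_lt (hc : StrictMono c) {i j : Fin n} {x : ℂ × ℂ} (h : modSq x = 0)
    (hj : i < j) : height c i x < c j :=
  ((hiProd_pos_iff c _ (modSq_nonneg x) _).1 (hiProd_height_pos i hc x) j hj).resolve_left
    (by rw [h]; exact lt_irrefl 0)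

/-- The axis in a chart only meets the chart itself and the neighbouring one. -/
theorem overlap_conditions (hc : StrictMono c) {i j : Fin n} {x y : ℂ × ℂ}
    (h : chartMap hc i x = chartMap hc j y) :
    (x.1 = 0 → j ≤ i ∧ i.val ≤ j.val + 1) ∧ (x.2 = 0 → i ≤ j ∧ j.val ≤ i.val + 1) := by
  have hp : position c i x = position c j y := by
    rw [← proj_chartMap hc, ← proj_chartMap hc, h]
  have hz : height c i x = height c j y := congrArg (fun p : ℝ × ℝ × ℝ => p.2.2) hp
  have hm : modSq x = modSq y := by
    rw [← horizSq_position (c := c) i x, ← horizSq_position (c := c) j y, hp]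
  constructor
  · intro hx
    have h0 := modSq_eq_zero_of_fst hx
    have h1 := height_le_of_fst_eq_zero hc (i := i) hx
    constructor
    · by_contra! hlt
      have := lt_height_of_lt hc (hm ▸ h0) hlt
      linarith
    · by_contra! hlt
      have e1 := lt_height_of_lt hc (i := i) (j := ⟨j.val + 1, by omega⟩) h0 hlt
      have e2 := height_lt_of_lt hc (i := j) (j := ⟨j.val + 1, by omega⟩) (hm ▸ h0)
        (Fin.lt_def.2 (Nat.lt_succ_self _))
      linarith
  · intro hx
    have h0 := modSq_eq_zero_of_snd hx
    have h1 := le_height_of_snd_eq_zero hc (i := i) hx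
    constructor
    · by_contra! hlt
      have := height_lt_of_lt hc (hm ▸ h0) hlt
      linarith
    · by_contra! hlt
      have e1 := height_lt_of_lt hc (i := i) (j := ⟨i.val + 1, by omega⟩) h0
        (Fin.lt_def.2 (Nat.lt_succ_self _))
      have e2 := lt_height_of_lt hc (i := j) (j := ⟨i.val + 1, by omega⟩) (hm ▸ h0) hlt
      linarith

/-- A common point of the charts of index `i < j` is off the `β_i`-axis, so it lies in the chart of
index `i + 1` as well, and one descends to equal indices. -/
theorem incl_eq_of_chartMap_eq (hc : StrictMono c) {i j : Fin n} (hij : i ≤ j) {x y : ℂ × ℂ}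
    (h : chartMap hc i x = chartMap hc j y) : GluedSurface.incl i x = GluedSurface.incl j y := by
  obtain ⟨d, hd⟩ : ∃ d, j.val = i.val + d := ⟨j.val - i.val, by have : i.val ≤ j.val := hij; omega⟩
  induction d generalizing i x with
  | zero =>
    obtain rfl : i = j := Fin.ext hd.symm
    rw [chartMap_injective hc i h]
  | succ d ih =>
    have hx : x.1 ≠ 0 := fun h0 => by
      have : j.val ≤ i.val := ((overlap_conditions hc h).1 h0).1
      omega
    have hi : i.val + 1 < n := by omega
    rw [← incl_transition (j := ⟨i.val + 1, hi⟩) rfl hx]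
    rw [← chartMap_transition hc (j := ⟨i.val + 1, hi⟩) rfl hx] at h
    exact ih (Fin.le_def.2 (by simp; omega)) h (by simp; omega)

theorem toGH_injective (hc : StrictMono c) : Function.Injective (toGH hc) := by
  intro a b h
  obtain ⟨i, x, rfl⟩ := exists_incl_eq a
  obtain ⟨j, y, rfl⟩ := exists_incl_eq b
  rw [toGH_incl, toGH_incl] at h
  rcases le_total i j with hij | hij
  · exact incl_eq_of_chartMap_eq hc hij h
  · exact (incl_eq_of_chartMap_eq hc hij h.symm).symm

theorem continuous_incl (i : Fin n) : Continuous (GluedSurface.incl i : ℂ × ℂ → GluedSurface n) :=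
  continuous_quot_mk.comp (by fun_prop : Continuous fun x : ℂ × ℂ => (i, x))

theorem isOpen_gluedSurface_iff {O : Set (GluedSurface n)} :
    IsOpen O ↔ ∀ i, IsOpen (GluedSurface.incl i ⁻¹' O) := by
  constructor
  · exact fun h i => h.preimage (continuous_incl i)
  · intro h
    have : IsOpen (Quot.mk (glueRel n) ⁻¹' O) := by
      rw [isOpen_prod_iff]
      intro i x hx
      exact ⟨{i}, _, isOpen_discrete _, h i, rfl, hx, by
        rintro ⟨j, y⟩ ⟨hj, hy⟩
        obtain rfl : j = i := hj
        exact hy⟩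
    exact isQuotientMap_quot_mk.isOpen_preimage.1 this

theorem continuous_of_incl {X : Type*} [TopologicalSpace X] {f : GluedSurface n → X}
    (h : ∀ i, Continuous fun x => f (GluedSurface.incl i x)) : Continuous f :=
  ⟨fun _ hO => isOpen_gluedSurface_iff.2 fun i => hO.preimage (h i)⟩

/-- The glued surface is homeomorphic to the Gibbons–Hawking space. -/
noncomputable def ghHomeomorph (hc : StrictMono c) (hn : 1 ≤ n) : GluedSurface n ≃ₜ GHSpace c :=
  (Equiv.ofBijective (toGH hc) ⟨toGH_injective hc, fun y => by
    obtain ⟨i, x, h⟩ := exists_chartMap_eq hc hn y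
    exact ⟨GluedSurface.incl i x, h⟩⟩).toHomeomorphOfContinuousOpen
    (continuous_of_incl fun i => continuous_chartMap hc i) (by
      intro O hO
      have : toGH hc '' O = ⋃ i, chartMap hc i '' (GluedSurface.incl i ⁻¹' O) := by
        ext y
        simp only [Set.mem_image, Set.mem_iUnion, Set.mem_preimage]
        constructor
        · rintro ⟨a, ha, rfl⟩
          obtain ⟨i, x, rfl⟩ := exists_incl_eq a
          exact ⟨i, x, ha, rfl⟩
        · rintro ⟨i, x, hx, rfl⟩
          exact ⟨_, hx, rfl⟩
      change IsOpen (toGH hc '' O)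
      rw [this]
      exact isOpen_iUnion fun i => isOpenMap_chartMap hc i _ (hO.preimage (continuous_incl i)))

theorem ghHomeomorph_incl (hc : StrictMono c) (hn : 1 ≤ n) (i : Fin n) (x : ℂ × ℂ) :
    ghHomeomorph hc hn (GluedSurface.incl i x) = chartMap hc i x := rfl

theorem isOpenEmbedding_incl (hc : StrictMono c) (hn : 1 ≤ n) (i : Fin n) :
    Topology.IsOpenEmbedding (GluedSurface.incl i : ℂ × ℂ → GluedSurface n) :=
  ((ghHomeomorph hc hn).isOpenEmbedding.of_comp_iff _).1 (isOpenEmbedding_chartMap hc i)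

theorem chartMap_eq_iff_transition (hc : StrictMono c) {i j : Fin n} (hij : i.val + 1 = j.val)
    (x y : ℂ × ℂ) : chartMap hc i x = chartMap hc j y ↔
      x.1 ≠ 0 ∧ y = (x.1 ^ 2 * x.2, x.1⁻¹) := by
  constructor
  · intro h
    have hx : x.1 ≠ 0 := fun h0 => by
      have : j.val ≤ i.val := ((overlap_conditions hc h).1 h0).1
      omega
    refine ⟨hx, ?_⟩
    rw [← chartMap_transition hc hij hx] at h
    exact (chartMap_injective hc j h).symm
  · rintro ⟨hx, rfl⟩
    exact (chartMap_transition hc hij hx).symm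

/-! ### The first chart and the torus action -/

theorem ghZ₁_eq (p : ℝ × ℝ × ℝ) (e : Circle) : ghZ₁ c p e = patchCoord c 0 p e := by
  unfold ghZ₁ patchCoord
  congr 2
  rw [loProd_zero, div_one, hiProd]
  simp only [not_lt_zero, if_false, rad_sub_eq]
  rw [Real.sqrt_eq_rpow, ← Real.finsetProd_rpow _ _ fun j _ => rMinus_nonneg (horizSq_nonneg p) _]
  simp only [Real.sqrt_eq_rpow]

theorem chartMap_first (hc : StrictMono c) (hn : 1 ≤ n) (p : patch c 0) (e : Circle) :
    chartMap hc ⟨0, hn⟩ (horiz p / ghZ₁ c p e, ghZ₁ c p e) = GHSpace.mk c 0 p e := by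
  rw [← chartMap_chartCoord hc (i := ⟨0, hn⟩) p (Or.inr (Or.inl (Fin.ext rfl))) e]
  congr 1
  simp [chartCoord, ghZ₁_eq, div_eq_mul_inv]

theorem horiz_rotate (t : Circle) (p : ℝ × ℝ × ℝ) : horiz (rotate t p) = t * horiz p := by
  apply Complex.ext <;> rfl

theorem horizSq_rotate (t : Circle) (p : ℝ × ℝ × ℝ) : horizSq (rotate t p) = horizSq p := by
  rw [horizSq, horiz_rotate, map_mul, Circle.normSq_coe, one_mul]; rfl

theorem patchCoord_rotate (t f e : Circle) (k : ℕ) (p : ℝ × ℝ × ℝ) :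
    patchCoord c k (rotate t p) (f * e) = f * patchCoord c k p e := by
  rw [patchCoord, patchCoord, horizSq_rotate]
  change _ * ((f : ℂ) * e) = _
  rw [mul_left_comm]
  rfl

theorem chartCoord_rotate (t₁ t₂ : Circle) (i k : ℕ) (p : ℝ × ℝ × ℝ) (e : Circle) :
    chartCoord c i k (rotate t₂ p) (t₁ * (t₂ ^ k)⁻¹ * e) =
      chartTorusAct i t₁ t₂ (chartCoord c i k p e) := by
  have h2 : (t₂ : ℂ) ≠ 0 := t₂.coe_ne_zero
  have e1 : (t₂ : ℂ) ^ ((i : ℤ) + 1 - k) = (t₂ : ℂ) ^ (i + 1) * ((t₂ : ℂ) ^ k)⁻¹ := by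
    rw [zpow_sub₀ h2, div_eq_mul_inv, zpow_natCast]
    norm_cast
  have e2 : (t₂ : ℂ) ^ ((k : ℤ) - i) = (t₂ : ℂ) ^ k * ((t₂ : ℂ) ^ i)⁻¹ := by
    rw [zpow_sub₀ h2, div_eq_mul_inv, zpow_natCast, zpow_natCast]
  have h3 : (t₂ : ℂ) ^ k ≠ 0 := pow_ne_zero _ h2
  simp only [chartCoord, chartTorusAct, patchCoord_rotate, horiz_rotate, mul_zpow, e1, e2,
    Circle.coe_mul, Circle.coe_inv, Circle.coe_pow, mul_inv, inv_inv]
  ext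
  · simp only
    linear_combination ((t₂ : ℂ) ^ (i + 1) * horiz p ^ ((i : ℤ) + 1 - k) * (t₁ : ℂ)⁻¹ *
      (patchCoord c k p e)⁻¹) * mul_inv_cancel₀ h3
  · simp only
    linear_combination (((t₂ : ℂ) ^ i)⁻¹ * horiz p ^ ((k : ℤ) - i) * (t₁ : ℂ) *
      patchCoord c k p e) * mul_inv_cancel₀ h3

theorem smul_incl (l : ℂˣ × ℂˣ) (i : Fin n) (x : ℂ × ℂ) :
    l • GluedSurface.incl i x = GluedSurface.incl i (chartTorusAct i l.1 l.2 x) := rfl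

theorem ghHomeomorph_smul (hc : StrictMono c) (hn : 1 ≤ n) (t₁ t₂ : Circle) (k : Fin (n + 1))
    (p : patch c k) (e : Circle) :
    ghHomeomorph hc hn ((Circle.toUnits t₁, Circle.toUnits t₂) •
        (ghHomeomorph hc hn).symm (GHSpace.mk c k p e)) =
      GHSpace.mk c k ⟨rotate t₂ p, rotate_mem c k t₂ p⟩ (t₁ * (t₂ ^ k.val)⁻¹ * e) := by
  obtain ⟨i, x, hx⟩ := exists_chartMap_eq hc hn (GHSpace.mk c k p e)
  have hs : (ghHomeomorph hc hn).symm (GHSpace.mk c k p e) = GluedSurface.incl i x := by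
    rw [Homeomorph.symm_apply_eq, ghHomeomorph_incl, hx]
  obtain ⟨h1, h2⟩ := chartMap_eq_mk hc hx
  rw [hs, smul_incl, ghHomeomorph_incl, chartMap_eq_mk_iff]
  constructor
  · rcases h1 with h | h
    · exact Or.inl (by rw [horiz_rotate]; exact mul_ne_zero t₂.coe_ne_zero h)
    · exact Or.inr h
  · simp only
    rw [chartCoord_rotate, h2]
    simp

end Homeo

/-! ### The invariants of the cyclic group -/

section Invariants

variable {n : ℕ}

/-- The generators `sⁿ`, `s t`, `tⁿ` of the invariant polynomials. -/
def cyclicInv (n : ℕ) (p : ℂ × ℂ) : ℂ × ℂ × ℂ := (p.1 ^ n, p.1 * p.2, p.2 ^ n)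

/-- The invariants separate the orbits of the cyclic group. -/
theorem cyclicRel_iff (hn : 1 ≤ n) (p q : ℂ × ℂ) :
    cyclicRel n p q ↔ cyclicInv n p = cyclicInv n q := by
  have hn0 : n ≠ 0 := by omega
  constructor
  · rintro ⟨ζ, hζ, rfl⟩
    have h0 : ζ ≠ 0 := by rintro rfl; simp [hn0] at hζ
    simp only [cyclicInv, mul_pow, hζ, inv_pow, one_mul, inv_one, Prod.mk.injEq, true_and,
      and_true]
    field_simp
  · obtain ⟨s, t⟩ := p
    obtain ⟨s', t'⟩ := q
    simp only [cyclicInv, Prod.mk.injEq, and_imp]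
    intro h1 h2 h3
    by_cases hs : s = 0
    · subst hs
      have hs' : s' = 0 := by
        rw [zero_pow hn0] at h1
        exact pow_eq_zero_iff hn0 |>.1 h1.symm
      subst hs'
      by_cases ht : t = 0
      · subst ht
        have ht' : t' = 0 := by
          rw [zero_pow hn0] at h3
          exact pow_eq_zero_iff hn0 |>.1 h3.symm
        exact ⟨1, by simp, by simp [ht']⟩
      · have ht' : t' ≠ 0 := by
          rintro rfl
          rw [zero_pow hn0] at h3
          exact ht (pow_eq_zero_iff hn0 |>.1 h3)
        refine ⟨t / t', ?_, ?_⟩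
        · rw [div_pow, h3, div_self (pow_ne_zero _ ht')]
        · ext
          · simp
          · simp only; field_simp
    · have hs' : s' ≠ 0 := by
        rintro rfl
        rw [zero_pow hn0] at h1
        exact hs (pow_eq_zero_iff hn0 |>.1 h1)
      refine ⟨s' / s, ?_, ?_⟩
      · rw [div_pow, h1, div_self (pow_ne_zero _ hs')]
      · ext
        · simp only; field_simp
        · simp only
          field_simp
          linear_combination (-1 : ℂ) * h2

/-- The embedding of `ℂ² / ℤ_n` into `ℂ³` given by the generators of the invariants. -/
def quotInv (hn : 1 ≤ n) : CyclicQuotient n → ℂ × ℂ × ℂ :=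
  Quot.lift (cyclicInv n) fun p q h => (cyclicRel_iff hn p q).1 h

theorem quotInv_mk (hn : 1 ≤ n) (p : ℂ × ℂ) :
    quotInv hn (CyclicQuotient.mk n p) = cyclicInv n p := rfl

theorem quotInv_injective (hn : 1 ≤ n) : Function.Injective (quotInv hn) := by
  rintro ⟨p⟩ ⟨q⟩ h
  exact Quot.sound ((cyclicRel_iff hn p q).2 h)

theorem continuous_cyclicInv : Continuous (cyclicInv n) := by unfold cyclicInv; fun_prop

/-- The invariants define a proper map because `|s|ⁿ` and `|t|ⁿ` are among the moduli. -/
theorem isProperMap_cyclicInv (hn : 1 ≤ n) : IsProperMap (cyclicInv n) := by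
  rw [isProperMap_iff_isCompact_preimage]
  refine ⟨continuous_cyclicInv, fun K hK => ?_⟩
  obtain ⟨M, hM⟩ := hK.isBounded.exists_norm_le
  refine Metric.isCompact_of_isClosed_isBounded (hK.isClosed.preimage continuous_cyclicInv) ?_
  refine (Metric.isBounded_closedBall (x := (0 : ℂ × ℂ)) (r := max 1 M)).subset fun p hp => ?_
  have h := hM _ hp
  have bound (z : ℂ) (hz : ‖z ^ n‖ ≤ M) : ‖z‖ ≤ max 1 M := by
    by_contra! hlt
    have h1 : 1 < ‖z‖ := (le_max_left _ _).trans_lt hlt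
    have h2 : M < ‖z‖ := (le_max_right _ _).trans_lt hlt
    have h3 : ‖z‖ ≤ ‖z‖ ^ n := le_self_pow₀ h1.le (by omega)
    rw [norm_pow] at hz
    linarith
  rw [mem_closedBall_zero_iff, Prod.norm_def]
  have h1 : ‖p.1 ^ n‖ ≤ M := (norm_fst_le (cyclicInv n p)).trans h
  have h2 : ‖p.2 ^ n‖ ≤ M :=
    ((norm_snd_le (cyclicInv n p).2).trans (norm_snd_le (cyclicInv n p))).trans h
  exact max_le (bound _ h1) (bound _ h2)

/-- The quotient has the topology of the variety of invariants, as `cyclicInv` is proper. -/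
theorem isClosedEmbedding_quotInv (hn : 1 ≤ n) : Topology.IsClosedEmbedding (quotInv hn) := by
  refine .of_continuous_injective_isClosedMap ?_ (quotInv_injective hn) ?_
  · exact continuous_quot_lift _ continuous_cyclicInv
  · intro C hC
    have hC' : IsClosed (CyclicQuotient.mk n ⁻¹' C) := hC.preimage continuous_quot_mk
    have : quotInv hn '' C = cyclicInv n '' (CyclicQuotient.mk n ⁻¹' C) := by
      ext y
      constructor
      · rintro ⟨⟨p⟩, hp, rfl⟩
        exact ⟨p, hp, rfl⟩
      · rintro ⟨p, hp, rfl⟩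
        exact ⟨_, hp, rfl⟩
    rw [this]
    exact (isProperMap_cyclicInv hn).isClosedMap _ hC'

/-! ### The resolution map -/

/-- The functions `z₁`, `z₂` and `z₂ⁿ / z₁` in the chart of index `i`. -/
def chartInv (i : Fin n) (x : ℂ × ℂ) : ℂ × ℂ × ℂ :=
  (x.1 ^ i.val * x.2 ^ (i.val + 1), x.1 * x.2, x.1 ^ (n - i.val) * x.2 ^ (n - i.val - 1))

theorem chartInv_transition {i j : Fin n} (hij : i.val + 1 = j.val) {x : ℂ × ℂ} (hx : x.1 ≠ 0) :
    chartInv j (chartTransition x) = chartInv i x := by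
  have hj := j.isLt
  obtain ⟨d, hd⟩ : ∃ d, n = i.val + 2 + d := ⟨n - (i.val + 2), by omega⟩
  have e1 : n - (i.val + 1) = d + 1 := by omega
  have e2 : n - i.val = d + 2 := by omega
  simp only [chartInv, chartTransition, ← hij, e1, e2, Nat.add_sub_cancel,
    show d + 2 - 1 = d + 1 by omega, inv_pow]
  ext
  · simp only
    field_simp
    ring
  · simp only
    field_simp
  · simp only
    field_simp
    ring

/-- The functions `z₁`, `z₂` and `z₂ⁿ / z₁` on the glued surface. -/
def surfaceInv (n : ℕ) : GluedSurface n → ℂ × ℂ × ℂ :=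
  Quot.lift (fun a => chartInv a.1 a.2) fun a b h => by
    rw [h.2.2, chartInv_transition h.1 h.2.1]

theorem surfaceInv_incl (i : Fin n) (x : ℂ × ℂ) :
    surfaceInv n (GluedSurface.incl i x) = chartInv i x := rfl

theorem continuous_surfaceInv : Continuous (surfaceInv n) :=
  continuous_of_incl fun i => by
    change Continuous (chartInv i)
    unfold chartInv
    fun_prop

theorem exists_pow_eq (hn : 1 ≤ n) (z : ℂ) : ∃ s : ℂ, s ^ n = z :=
  IsAlgClosed.exists_pow_nat_eq z hn

theorem chartInv_mul (i : Fin n) (x : ℂ × ℂ) :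
    (chartInv i x).1 * (chartInv i x).2.2 = (chartInv i x).2.1 ^ n := by
  obtain ⟨d, hd⟩ : ∃ d, n = i.val + 1 + d := ⟨n - (i.val + 1), by omega⟩
  have e1 : n - i.val = d + 1 := by omega
  simp only [chartInv, e1, Nat.add_sub_cancel]
  conv_rhs => rw [hd]
  ring

theorem exists_cyclicInv_eq (hn : 1 ≤ n) (y : GluedSurface n) :
    ∃ p : ℂ × ℂ, cyclicInv n p = surfaceInv n y := by
  have hn0 : n ≠ 0 := by omega
  obtain ⟨i, x, rfl⟩ := exists_incl_eq y
  rw [surfaceInv_incl]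
  have hmul := chartInv_mul i x
  obtain ⟨s, hs⟩ := exists_pow_eq hn (chartInv i x).1
  by_cases h0 : s = 0
  · obtain ⟨t, ht⟩ := exists_pow_eq hn (chartInv i x).2.2
    have h1 : (chartInv i x).1 = 0 := by rw [← hs, h0, zero_pow hn0]
    have h2 : (chartInv i x).2.1 = 0 := by
      rw [h1, zero_mul] at hmul
      exact pow_eq_zero_iff hn0 |>.1 hmul.symm
    refine ⟨(s, t), ?_⟩
    ext
    · exact hs
    · simp [cyclicInv, h0, h2]
    · exact ht
  · refine ⟨(s, (chartInv i x).2.1 / s), ?_⟩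
    have h3 : s ^ n ≠ 0 := pow_ne_zero _ h0
    have h4 : ((chartInv i x).2.1 / s) ^ n = (chartInv i x).2.2 := by
      rw [div_pow, ← hmul, ← hs]
      field_simp
    simp only [cyclicInv, hs, h4, mul_div_cancel₀ _ h0]

/-- The resolution of `ℂ² / ℤ_n`, determined by `sⁿ = z₁` and `s t = z₂`. -/
noncomputable def resolution (hn : 1 ≤ n) (y : GluedSurface n) : CyclicQuotient n :=
  CyclicQuotient.mk n (Classical.choose (exists_cyclicInv_eq hn y))

theorem quotInv_resolution (hn : 1 ≤ n) (y : GluedSurface n) :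
    quotInv hn (resolution hn y) = surfaceInv n y :=
  Classical.choose_spec (exists_cyclicInv_eq hn y)

theorem resolution_eq_iff (hn : 1 ≤ n) (y : GluedSurface n) (p : ℂ × ℂ) :
    resolution hn y = CyclicQuotient.mk n p ↔ surfaceInv n y = cyclicInv n p := by
  rw [← (quotInv_injective hn).eq_iff, quotInv_resolution, quotInv_mk]

/-- A point of the surface is represented by a point of a polydisc in some chart whose radius only
depends on the values of `z₁` and `z₂ⁿ / z₁`. -/
theorem exists_bounded_rep {M : ℝ} (hM : 1 ≤ M) (y : GluedSurface n)
    (h1 : ‖(surfaceInv n y).1‖ ≤ M) (h2 : ‖(surfaceInv n y).2.2‖ ≤ M) :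
    ∃ j z, GluedSurface.incl j z = y ∧ ‖z.1‖ ≤ M ∧ ‖z.2‖ ≤ M := by
  -- where `|α| > M`, pass to the next chart, in which `|β| = 1 / |α| ≤ 1`; in the last chart `α` is
  -- `z₂ ^ n / z₁`
  have up (d : ℕ) : ∀ (i : Fin n) (x : ℂ × ℂ), n - 1 - i.val = d → GluedSurface.incl i x = y →
      ‖x.2‖ ≤ M → ∃ j z, GluedSurface.incl j z = y ∧ ‖z.1‖ ≤ M ∧ ‖z.2‖ ≤ M := by
    induction d with
    | zero =>
      rintro i x hi rfl hx
      refine ⟨i, x, rfl, ?_, hx⟩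
      have : n - i.val = 1 := by omega
      simpa [surfaceInv_incl, chartInv, this] using h2
    | succ d ih =>
      rintro i x hi rfl hx
      by_cases hle : ‖x.1‖ ≤ M
      · exact ⟨i, x, rfl, hle, hx⟩
      · have hx1 : x.1 ≠ 0 := by
          intro h0
          rw [h0, norm_zero] at hle
          linarith
        refine ih ⟨i.val + 1, by omega⟩ (chartTransition x) (by simp; omega)
          (incl_transition rfl hx1) ?_
        simp only [chartTransition, norm_inv]
        exact (inv_le_one_of_one_le₀ (by linarith)).trans hM
  -- where `|β| > M`, pass to the previous chart, in which `|α| = 1 / |β| ≤ 1`; in the first chart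
  -- `β` is `z₁`
  have down (d : ℕ) : ∀ (i : Fin n) (x : ℂ × ℂ), i.val = d → GluedSurface.incl i x = y →
      ‖x.1‖ ≤ M → ∃ j z, GluedSurface.incl j z = y ∧ ‖z.1‖ ≤ M ∧ ‖z.2‖ ≤ M := by
    induction d with
    | zero =>
      rintro i x hi rfl hx
      refine ⟨i, x, rfl, hx, ?_⟩
      simpa [surfaceInv_incl, chartInv, hi] using h1
    | succ d ih =>
      rintro i x hi rfl hx
      by_cases hle : ‖x.2‖ ≤ M
      · exact ⟨i, x, rfl, hx, hle⟩
      · have hx2 : x.2 ≠ 0 := by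
          intro h0
          rw [h0, norm_zero] at hle
          linarith
        have hx' : (x.2⁻¹, x.1 * x.2 ^ 2).1 ≠ 0 := inv_ne_zero hx2
        have e : chartTransition (x.2⁻¹, x.1 * x.2 ^ 2) = x := by
          simp only [chartTransition]
          ext
          · simp only; field_simp
          · simp
        refine ih ⟨d, by omega⟩ (x.2⁻¹, x.1 * x.2 ^ 2) rfl ?_ ?_
        · rw [← incl_transition (j := i) (by simp; omega) hx', e]
        · simp only [norm_inv]
          exact (inv_le_one_of_one_le₀ (by linarith)).trans hM
  obtain ⟨i, x, rfl⟩ := exists_incl_eq y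
  by_cases hle : ‖x.1‖ ≤ M
  · exact down _ i x rfl rfl hle
  · have hx1 : x.1 ≠ 0 := by
      intro h0
      rw [h0, norm_zero] at hle
      linarith
    have hi : i.val + 1 < n := by
      by_contra! hlt
      have : n - i.val = 1 := by omega
      apply hle
      simpa [surfaceInv_incl, chartInv, this] using h2
    refine up _ ⟨i.val + 1, hi⟩ (chartTransition x) rfl (incl_transition rfl hx1) ?_
    simp only [chartTransition, norm_inv]
    exact (inv_le_one_of_one_le₀ (by linarith)).trans hM

/-- The preimage of a bounded set is covered by finitely many polydiscs. -/
theorem isProperMap_surfaceInv : IsProperMap (surfaceInv n) := by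
  rw [isProperMap_iff_isCompact_preimage]
  refine ⟨continuous_surfaceInv, fun K hK => ?_⟩
  obtain ⟨M, hM⟩ := hK.isBounded.exists_norm_le
  have hcomp : IsCompact (⋃ i : Fin n, GluedSurface.incl i ''
      Metric.closedBall (0 : ℂ × ℂ) (max 1 M)) :=
    isCompact_iUnion fun i => (isCompact_closedBall _ _).image (continuous_incl i)
  refine hcomp.of_isClosed_subset (hK.isClosed.preimage continuous_surfaceInv) fun y hy => ?_
  have h := hM _ hy
  obtain ⟨j, z, hz, b1, b2⟩ := exists_bounded_rep (le_max_left 1 M) y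
    (((norm_fst_le _).trans h).trans (le_max_right _ _))
    ((((norm_snd_le _).trans (norm_snd_le _)).trans h).trans (le_max_right _ _))
  refine Set.mem_iUnion.2 ⟨j, z, ?_, hz⟩
  rw [mem_closedBall_zero_iff, Prod.norm_def]
  exact max_le b1 b2

theorem isProperMap_resolution (hn : 1 ≤ n) : IsProperMap (resolution hn) := by
  have hcomp : quotInv hn ∘ resolution hn = surfaceInv n := funext (quotInv_resolution hn)
  have he := isClosedEmbedding_quotInv hn
  refine isProperMap_of_comp_of_inj (g := quotInv hn) ?_ he.continuous ?_ he.injective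
  · rw [he.isInducing.continuous_iff, hcomp]
    exact continuous_surfaceInv
  · rw [hcomp]
    exact isProperMap_surfaceInv

end Invariants

/-! ### The resolution is toric and crepant -/

section Resolution

variable {n : ℕ} {c : Fin n → ℝ}

/-- The coordinates in chart `j` of a point with coordinates `x` in chart `i`, off the axes. -/
noncomputable def torusTransition (i j : ℕ) (x : ℂ × ℂ) : ℂ × ℂ :=
  ((x.1 * x.2) ^ ((j : ℤ) + 1 - i) * x.2⁻¹, (x.1 * x.2) ^ ((i : ℤ) - j) * x.2)

theorem incl_torusTransition (i j : Fin n) {x : ℂ × ℂ} (h1 : x.1 ≠ 0) (h2 : x.2 ≠ 0) :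
    GluedSurface.incl j (torusTransition i j x) = GluedSurface.incl i x := by
  have hn : 1 ≤ n := by have := i.isLt; omega
  -- any configuration of special points gives a model in which the charts can be compared
  have hc : StrictMono fun k : Fin n => (k.val : ℝ) := fun a b h => Nat.cast_lt.2 h
  apply toGH_injective hc
  rw [toGH_incl, toGH_incl, chartMap_of_snd_ne hc i h2, chartMap_eq_mk_iff]
  have h0 : horiz (position (fun k : Fin n => (k.val : ℝ)) i x) ≠ 0 := mul_ne_zero h1 h2
  refine ⟨Or.inl h0, ?_⟩
  have hx := chartCoord_of_snd_ne hc i h2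
  have hP : patchCoord (fun k : Fin n => (k.val : ℝ)) i.castSucc
      (position (fun k : Fin n => (k.val : ℝ)) i x) (phase x.2) = x.2 := by
    have := congrArg Prod.snd hx
    simpa [chartCoord] using this
  simp only [chartCoord, hP, horiz_position, torusTransition]
  simp

theorem exists_transition (hc : StrictMono c) (i j : Fin n) : ∃ F : ℂ × ℂ → ℂ × ℂ,
    DifferentiableOn ℂ F (GluedSurface.incl i ⁻¹' Set.range (GluedSurface.incl j)) ∧
    ∀ x ∈ GluedSurface.incl i ⁻¹' Set.range (GluedSurface.incl j),
      GluedSurface.incl j (F x) = GluedSurface.incl i x := by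
  have cond (x : ℂ × ℂ) (hx : x ∈ GluedSurface.incl i ⁻¹' Set.range (GluedSurface.incl j)) :
      (x.1 = 0 → j ≤ i ∧ i.val ≤ j.val + 1) ∧ (x.2 = 0 → i ≤ j ∧ j.val ≤ i.val + 1) := by
    obtain ⟨y, hy⟩ := hx
    exact overlap_conditions hc (congrArg (toGH hc) hy.symm)
  by_cases h0 : i = j
  · subst h0
    exact ⟨id, differentiableOn_id, fun _ _ => rfl⟩
  by_cases h1 : i.val + 1 = j.val
  · have ne (x : ℂ × ℂ) (hx : x ∈ GluedSurface.incl i ⁻¹' Set.range (GluedSurface.incl j)) :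
        x.1 ≠ 0 := fun h => by
      have : j.val ≤ i.val := ((cond x hx).1 h).1
      omega
    refine ⟨chartTransition, fun x hx => ?_, fun x hx => incl_transition h1 (ne x hx)⟩
    have := ne x hx
    refine DifferentiableAt.differentiableWithinAt ?_
    unfold chartTransition
    fun_prop (disch := assumption)
  by_cases h2 : j.val + 1 = i.val
  · have ne (x : ℂ × ℂ) (hx : x ∈ GluedSurface.incl i ⁻¹' Set.range (GluedSurface.incl j)) :
        x.2 ≠ 0 := fun h => by
      have : i.val ≤ j.val := ((cond x hx).2 h).1
      omega
    refine ⟨fun x => (x.2⁻¹, x.1 * x.2 ^ 2), fun x hx => ?_, fun x hx => ?_⟩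
    · have := ne x hx
      refine DifferentiableAt.differentiableWithinAt ?_
      fun_prop (disch := assumption)
    · have hx2 := ne x hx
      rw [← incl_transition (j := i) h2 (inv_ne_zero hx2)]
      congr 1
      simp only [chartTransition]
      ext
      · simp only; field_simp
      · simp
  · have ne (x : ℂ × ℂ) (hx : x ∈ GluedSurface.incl i ⁻¹' Set.range (GluedSurface.incl j)) :
        x.1 ≠ 0 ∧ x.2 ≠ 0 := by
      have hij : i.val ≠ j.val := fun h => h0 (Fin.ext h)
      constructor
      · intro h
        obtain ⟨e1, e2⟩ := (cond x hx).1 h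
        have e1' : j.val ≤ i.val := e1
        omega
      · intro h
        obtain ⟨e1, e2⟩ := (cond x hx).2 h
        have e1' : i.val ≤ j.val := e1
        omega
    refine ⟨torusTransition i j, fun x hx => ?_,
      fun x hx => incl_torusTransition i j (ne x hx).1 (ne x hx).2⟩
    obtain ⟨h1, h2⟩ := ne x hx
    refine DifferentiableAt.differentiableWithinAt ?_
    have h12 : DifferentiableAt ℂ (fun x : ℂ × ℂ => x.1 * x.2) x := by fun_prop
    have e1 := h12.zpow (m := (j : ℤ) + 1 - i) (Or.inl (mul_ne_zero h1 h2))
    have e2 := h12.zpow (m := (i : ℤ) - j) (Or.inl (mul_ne_zero h1 h2))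
    unfold torusTransition
    exact (e1.mul (differentiableAt_snd.inv h2)).prodMk (e2.mul differentiableAt_snd)

/-- Two points lying in different charts but in no common chart are separated by their
positions. -/
theorem t2Space_gluedSurface (hc : StrictMono c) (hn : 1 ≤ n) : T2Space (GluedSurface n) := by
  have hproj : Continuous fun y : GluedSurface n => GHSpace.proj c (toGH hc y) := by
    refine continuous_of_incl fun i => ?_
    simp only [toGH_incl, proj_chartMap]
    exact continuous_position hc i
  refine ⟨fun a b hab => ?_⟩
  by_cases hp : GHSpace.proj c (toGH hc a) = GHSpace.proj c (toGH hc b)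
  · -- points over the same point of the base lie in a common chart
    have : ∃ i x y, GluedSurface.incl i x = a ∧ GluedSurface.incl i y = b := by
      have key (u : GluedSurface n) (i : Fin n) (k : Fin (n + 1)) (p : patch c k) (e : Circle)
          (h : toGH hc u = GHSpace.mk c k p e) (hi : InChart i k p) :
          GluedSurface.incl i (chartCoord c i k p e) = u := by
        apply toGH_injective hc
        rw [toGH_incl, h, chartMap_chartCoord hc p hi]
      have noCenter (j : Fin n) (k : Fin (n + 1)) (p : patch c k)
          (h : (p : ℝ × ℝ × ℝ) = center c j) : False := by
        rcases p.2 with h' | h'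
        · exact h' (by rw [h]; rfl)
        · rw [h] at h'
          rcases lt_or_ge j.val k.val with hlt | hge
          · exact lt_irrefl _ ((h' j).1 hlt)
          · exact lt_irrefl _ ((h' j).2 hge)
      rcases GHSpace.exists_rep (toGH hc a) with ⟨k, p, e, ha⟩ | ⟨j, ha⟩ <;>
      rcases GHSpace.exists_rep (toGH hc b) with ⟨l, q, f, hb⟩ | ⟨m, hb⟩ <;>
      rw [ha, hb] at hp
      · simp only [GHSpace.proj_mk] at hp
        obtain ⟨i, hi⟩ : ∃ i, InChart i k p := by
          obtain ⟨i, x, hx⟩ := exists_chartMap_eq hc hn (GHSpace.mk c k p e)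
          exact ⟨i, (chartMap_eq_mk hc hx).1⟩
        have hil : InChart i l q := by
          by_cases h0 : horiz p = 0
          · have : k = l := patch_axis_unique h0 p.2 (by rw [hp]; exact q.2)
            rw [← hp, ← this]; exact hi
          · exact Or.inl (by rwa [← hp])
        exact ⟨i, _, _, key a i k p e ha hi, key b i l q f hb hil⟩
      · exact (noCenter m k p hp).elim
      · exact (noCenter j l q hp.symm).elim
      · have hjm : c j = c m := congrArg (fun p : ℝ × ℝ × ℝ => p.2.2) hp
        obtain rfl := hc.injective hjm
        exact absurd (toGH_injective hc (ha.trans hb.symm)) hab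
    obtain ⟨i, x, y, rfl, rfl⟩ := this
    have hxy : x ≠ y := fun h => hab (by rw [h])
    obtain ⟨U, V, hU, hV, hxU, hyV, hd⟩ := t2_separation hxy
    have he := isOpenEmbedding_incl hc hn i
    exact ⟨_, _, he.isOpenMap U hU, he.isOpenMap V hV, ⟨x, hxU, rfl⟩, ⟨y, hyV, rfl⟩,
      (Set.disjoint_image_iff he.injective).2 hd⟩
  · exact separated_by_continuous hproj hp

theorem sum_pow_of_pow_eq_one {ζ : ℂ} (h : ζ ^ n = 1) :
    ∑ m ∈ Finset.range n, ζ ^ m = if ζ = 1 then (n : ℂ) else 0 := by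
  split_ifs with h1
  · simp [h1]
  · rw [geom_sum_eq h1, h, sub_self, zero_div]

/-- A monomial `s ^ k t ^ l` with `k ≡ l` modulo `n` is a monomial in the invariants. -/
theorem exists_pullback_monomial (i : Fin n) (k l : ℕ) (hkl : (k : ℤ) ≡ l [ZMOD n]) :
    ∃ P : MvPolynomial (Fin 2) ℂ, ∀ x p : ℂ × ℂ, chartInv i x = cyclicInv n p →
      MvPolynomial.eval ![x.1, x.2] P = p.1 ^ k * p.2 ^ l := by
  rcases le_total l k with h | h
  · obtain ⟨d, hd⟩ := (Nat.modEq_iff_dvd' h).1 (Int.natCast_modEq_iff.1 hkl.symm)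
    refine ⟨(MvPolynomial.X 0 * MvPolynomial.X 1) ^ l *
      (MvPolynomial.X 0 ^ i.val * MvPolynomial.X 1 ^ (i.val + 1)) ^ d, fun x p hx => ?_⟩
    have e1 := congrArg Prod.fst hx
    have e2 := congrArg (fun q : ℂ × ℂ × ℂ => q.2.1) hx
    simp only [chartInv, cyclicInv] at e1 e2
    have hk : k = l + n * d := by omega
    simp only [map_mul, map_pow, MvPolynomial.eval_X, Matrix.cons_val_zero, Matrix.cons_val_one,
      e1, e2, hk]
    ring
  · obtain ⟨d, hd⟩ := (Nat.modEq_iff_dvd' h).1 (Int.natCast_modEq_iff.1 hkl)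
    refine ⟨(MvPolynomial.X 0 * MvPolynomial.X 1) ^ k *
      (MvPolynomial.X 0 ^ (n - i.val) * MvPolynomial.X 1 ^ (n - i.val - 1)) ^ d,
      fun x p hx => ?_⟩
    have e1 := congrArg (fun q : ℂ × ℂ × ℂ => q.2.2) hx
    have e2 := congrArg (fun q : ℂ × ℂ × ℂ => q.2.1) hx
    simp only [chartInv, cyclicInv] at e1 e2
    have hk : l = k + n * d := by omega
    simp only [map_mul, map_pow, MvPolynomial.eval_X, Matrix.cons_val_zero, Matrix.cons_val_one,
      e1, e2, hk]
    ring

/-- Averaging over the group, an invariant polynomial is a sum of invariant monomials. -/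
theorem exists_pullback_polynomial (f : MvPolynomial (Fin 2) ℂ)
    (hf : ∀ p q, cyclicRel n p q →
      MvPolynomial.eval ![p.1, p.2] f = MvPolynomial.eval ![q.1, q.2] f) (i : Fin n) :
    ∃ P : MvPolynomial (Fin 2) ℂ, ∀ x p : ℂ × ℂ, chartInv i x = cyclicInv n p →
      MvPolynomial.eval ![x.1, x.2] P = MvPolynomial.eval ![p.1, p.2] f := by
  have hn0 : n ≠ 0 := by have := i.isLt; omega
  have hnC : (n : ℂ) ≠ 0 := by exact_mod_cast hn0
  set ξ : ℂ := Complex.exp (2 * Real.pi * Complex.I / n)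
  have hξ : IsPrimitiveRoot ξ n := Complex.isPrimitiveRoot_exp n hn0
  have hξ0 : ξ ≠ 0 := hξ.ne_zero hn0
  have hmono (d : Fin 2 →₀ ℕ) : ∃ P : MvPolynomial (Fin 2) ℂ, ∀ x p : ℂ × ℂ,
      chartInv i x = cyclicInv n p → MvPolynomial.eval ![x.1, x.2] P =
        if ξ ^ ((d 0 : ℤ) - d 1) = 1 then p.1 ^ d 0 * p.2 ^ d 1 else 0 := by
    by_cases h : ξ ^ ((d 0 : ℤ) - d 1) = 1
    · simp only [h, if_true]
      refine exists_pullback_monomial i _ _ ?_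
      rw [hξ.zpow_eq_one_iff_dvd] at h
      exact (Int.modEq_iff_dvd.2 h).symm
    · simp only [h, if_false]
      exact ⟨0, fun x p _ => by simp⟩
  choose P hP using hmono
  refine ⟨∑ d ∈ f.support, MvPolynomial.C (f.coeff d) * P d, fun x p hx => ?_⟩
  have havg (m : ℕ) : MvPolynomial.eval ![p.1, p.2] f =
      ∑ d ∈ f.support, f.coeff d * (p.1 ^ d 0 * p.2 ^ d 1 * (ξ ^ ((d 0 : ℤ) - d 1)) ^ m) := by
    have hrel : cyclicRel n p (ξ ^ m * p.1, (ξ ^ m)⁻¹ * p.2) :=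
      ⟨ξ ^ m, by rw [← pow_mul, mul_comm, pow_mul, hξ.pow_eq_one, one_pow], rfl⟩
    rw [hf _ _ hrel, MvPolynomial.eval_eq']
    refine Finset.sum_congr rfl fun d _ => ?_
    simp only [Fin.prod_univ_two, Matrix.cons_val_zero, Matrix.cons_val_one]
    rw [zpow_sub₀ hξ0, zpow_natCast, zpow_natCast, div_pow, mul_pow, mul_pow, inv_pow,
      ← pow_mul, ← pow_mul, ← pow_mul, ← pow_mul, mul_comm (d 0) m, mul_comm (d 1) m]
    field_simp
  have hsum : (n : ℂ) * MvPolynomial.eval ![p.1, p.2] f = (n : ℂ) * ∑ d ∈ f.support,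
      f.coeff d * (if ξ ^ ((d 0 : ℤ) - d 1) = 1 then p.1 ^ d 0 * p.2 ^ d 1 else 0) := by
    calc (n : ℂ) * MvPolynomial.eval ![p.1, p.2] f
        = ∑ m ∈ Finset.range n, MvPolynomial.eval ![p.1, p.2] f := by simp
      _ = ∑ m ∈ Finset.range n, ∑ d ∈ f.support,
          f.coeff d * (p.1 ^ d 0 * p.2 ^ d 1 * (ξ ^ ((d 0 : ℤ) - d 1)) ^ m) :=
        Finset.sum_congr rfl fun m _ => havg m
      _ = _ := by
        rw [Finset.sum_comm, Finset.mul_sum]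
        refine Finset.sum_congr rfl fun d _ => ?_
        rw [← Finset.mul_sum, ← Finset.mul_sum, sum_pow_of_pow_eq_one (n := n)]
        · split_ifs <;> ring
        · rw [← zpow_natCast, ← zpow_mul, mul_comm, zpow_mul, zpow_natCast, hξ.pow_eq_one,
            one_zpow]
  rw [mul_left_cancel₀ hnC hsum, map_sum]
  refine Finset.sum_congr rfl fun d _ => ?_
  rw [map_mul, MvPolynomial.eval_C, hP d x p hx]

theorem incl_first_eq (hn : 1 ≤ n) {y : GluedSurface n} (h : (surfaceInv n y).1 ≠ 0) :
    y = GluedSurface.incl ⟨0, hn⟩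
      ((surfaceInv n y).2.1 / (surfaceInv n y).1, (surfaceInv n y).1) := by
  obtain ⟨x, rfl⟩ : ∃ x, GluedSurface.incl ⟨0, hn⟩ x = y := by
    obtain ⟨i, x, rfl⟩ := exists_incl_eq y
    simp only [surfaceInv_incl, chartInv] at h
    by_cases hi : i.val = 0
    · obtain rfl : i = ⟨0, hn⟩ := Fin.ext hi
      exact ⟨x, rfl⟩
    · have h1 : x.1 ≠ 0 := fun h0 => h (by rw [h0, zero_pow hi, zero_mul])
      have h2 : x.2 ≠ 0 := fun h0 => h (by rw [h0, zero_pow (by omega), mul_zero])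
      exact ⟨_, incl_torusTransition i ⟨0, hn⟩ h1 h2⟩
  simp only [surfaceInv_incl, chartInv] at h ⊢
  congr 1
  have hx : x.2 ≠ 0 := by simpa using h
  ext
  · simp [hx]
  · simp

theorem incl_last_eq {l : Fin n} (hl : l.val + 1 = n) {y : GluedSurface n}
    (h : (surfaceInv n y).2.2 ≠ 0) :
    y = GluedSurface.incl l
      ((surfaceInv n y).2.2, (surfaceInv n y).2.1 / (surfaceInv n y).2.2) := by
  obtain ⟨x, rfl⟩ : ∃ x, GluedSurface.incl l x = y := by
    obtain ⟨i, x, rfl⟩ := exists_incl_eq y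
    simp only [surfaceInv_incl, chartInv] at h
    by_cases hi : i = l
    · exact ⟨x, by rw [hi]⟩
    · have hi' : i.val ≠ l.val := fun e => hi (Fin.ext e)
      have h1 : x.1 ≠ 0 := fun h0 => h (by rw [h0, zero_pow (by omega), zero_mul])
      have h2 : x.2 ≠ 0 := fun h0 => h (by rw [h0, zero_pow (by omega), mul_zero])
      exact ⟨_, incl_torusTransition i l h1 h2⟩
  have e : n - l.val = 1 := by omega
  simp only [surfaceInv_incl, chartInv, e] at h ⊢
  congr 1
  have hx : x.1 ≠ 0 := by simpa using h
  ext
  · simp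
  · simp [hx]

theorem existsUnique_surfaceInv (hn : 1 ≤ n) {p : ℂ × ℂ} (hp : p ∈ regularLocus n) :
    ∃! y, surfaceInv n y = cyclicInv n p := by
  have hn0 : n ≠ 0 := by omega
  by_cases hs : p.1 = 0
  · by_cases ht : p.2 = 0
    · have h1 : n = 1 := hp.resolve_left fun h => h (Prod.ext hs ht)
      subst h1
      refine ⟨GluedSurface.incl 0 0, ?_, fun y hy => ?_⟩
      · simp [surfaceInv_incl, chartInv, cyclicInv, hs, ht]
      · obtain ⟨i, x, rfl⟩ := exists_incl_eq y
        obtain rfl : i = 0 := Subsingleton.elim _ _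
        simp only [surfaceInv_incl, chartInv, cyclicInv, hs, ht, Prod.mk.injEq] at hy
        congr 1
        ext
        · simpa using hy.2.2
        · simpa using hy.1
    · have hw : p.2 ^ n ≠ 0 := pow_ne_zero _ ht
      obtain ⟨l, hl⟩ : ∃ l : Fin n, l.val + 1 = n :=
        ⟨⟨n - 1, Nat.sub_one_lt hn0⟩, Nat.sub_add_cancel hn⟩
      refine ⟨GluedSurface.incl l (p.2 ^ n, p.1 * p.2 / p.2 ^ n), ?_, fun y hy => ?_⟩
      · have e : n - l.val = 1 := by omega
        simp [surfaceInv_incl, chartInv, cyclicInv, e, hs, hn0]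
      · rw [incl_last_eq hl (y := y) (by rw [hy]; exact hw), hy]
        rfl
  · have hz : p.1 ^ n ≠ 0 := pow_ne_zero _ hs
    refine ⟨GluedSurface.incl ⟨0, hn⟩ (p.1 * p.2 / p.1 ^ n, p.1 ^ n), ?_, fun y hy => ?_⟩
    · have hm := chartInv_mul (n := n) ⟨0, hn⟩ (p.1 * p.2 / p.1 ^ n, p.1 ^ n)
      have e1 : (chartInv (n := n) ⟨0, hn⟩ (p.1 * p.2 / p.1 ^ n, p.1 ^ n)).1 = p.1 ^ n := by
        simp [chartInv]
      have e2 : (chartInv (n := n) ⟨0, hn⟩ (p.1 * p.2 / p.1 ^ n, p.1 ^ n)).2.1 =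
          p.1 * p.2 := by
        simp only [chartInv]; field_simp
      rw [e1, e2, mul_pow] at hm
      exact Prod.ext e1 (Prod.ext e2 (mul_left_cancel₀ hz hm))
    · rw [incl_first_eq hn (y := y) (by rw [hy]; exact hz), hy]
      rfl

/-- The coordinates `(α_i, β_i)` as functions of `(s, t)`. -/
noncomputable def resolutionInverse (n i : ℕ) (p : ℂ × ℂ) : ℂ × ℂ :=
  (p.2 ^ (i + 1) / p.1 ^ (n - (i + 1)), p.1 ^ (n - i) / p.2 ^ i)

/-- If the chart of index `i` meets the fibre over the class of `(s, t)`, then the denominators of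
`α_i = t ^ (i + 1) / s ^ (n - i - 1)` and `β_i = s ^ (n - i) / t ^ i` do not vanish. -/
theorem regularLocus_conditions {i : Fin n} {p x : ℂ × ℂ} (hp : p ∈ regularLocus n)
    (h : chartInv i x = cyclicInv n p) :
    (p.1 ≠ 0 ∨ i.val + 1 = n) ∧ (p.2 ≠ 0 ∨ i.val = 0) := by
  have hi := i.isLt
  have hn0 : n ≠ 0 := by omega
  have e1 : x.1 ^ i.val * x.2 ^ (i.val + 1) = p.1 ^ n := congrArg Prod.fst h
  have e3 : x.1 ^ (n - i.val) * x.2 ^ (n - i.val - 1) = p.2 ^ n :=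
    congrArg (fun q : ℂ × ℂ × ℂ => q.2.2) h
  constructor
  · by_contra! hcon
    obtain ⟨hs, hi'⟩ := hcon
    have ht : p.2 ≠ 0 := fun ht => by
      rcases hp with h' | h'
      · exact h' (Prod.ext hs ht)
      · omega
    have h3 : p.2 ^ n ≠ 0 := pow_ne_zero _ ht
    rw [← e3] at h3
    have h1 : x.1 ≠ 0 := fun h0 => h3 (by rw [h0, zero_pow (by omega), zero_mul])
    have h2 : x.2 ≠ 0 := fun h0 => h3 (by rw [h0, zero_pow (by omega), mul_zero])
    rw [hs, zero_pow hn0] at e1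
    exact mul_ne_zero (pow_ne_zero _ h1) (pow_ne_zero _ h2) e1
  · by_contra! hcon
    obtain ⟨ht, hi'⟩ := hcon
    have hs : p.1 ≠ 0 := fun hs => by
      rcases hp with h' | h'
      · exact h' (Prod.ext hs ht)
      · omega
    have h3 : p.1 ^ n ≠ 0 := pow_ne_zero _ hs
    rw [← e1] at h3
    have h1 : x.1 ≠ 0 := fun h0 => h3 (by rw [h0, zero_pow (by omega), zero_mul])
    have h2 : x.2 ≠ 0 := fun h0 => h3 (by rw [h0, zero_pow (by omega), mul_zero])
    rw [ht, zero_pow hn0] at e3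
    exact mul_ne_zero (pow_ne_zero _ h1) (pow_ne_zero _ h2) e3

theorem chartInv_resolutionInverse {i : Fin n} {p : ℂ × ℂ} (hs : p.1 ≠ 0 ∨ i.val + 1 = n)
    (ht : p.2 ≠ 0 ∨ i.val = 0) : chartInv i (resolutionInverse n i p) = cyclicInv n p := by
  have hi := i.isLt
  obtain ⟨s, t⟩ := p
  obtain ⟨d, hd⟩ : ∃ d, n = i.val + 1 + d := ⟨n - (i.val + 1), by omega⟩
  have e1 : n - (i.val + 1) = d := by omega
  have e2 : n - i.val = d + 1 := by omega
  have hs' : s ≠ 0 ∨ d = 0 := hs.imp_right fun h => by omega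
  simp only [chartInv, cyclicInv, resolutionInverse, e1, e2, Nat.add_sub_cancel]
  simp only at hs ht
  clear e1 e2 hs
  generalize i.val = m at *
  subst hd
  rcases hs' with h1 | rfl <;> rcases ht with h2 | rfl <;> ext <;>
    simp only [div_pow, ← pow_mul] <;> field_simp <;> ring

/-- The determinant of a complex linear map of the plane. -/
theorem det_eq_of_plane (L : (ℂ × ℂ) →L[ℂ] (ℂ × ℂ)) :
    L.det = (L (1, 0)).1 * (L (0, 1)).2 - (L (0, 1)).1 * (L (1, 0)).2 := by
  rw [ContinuousLinearMap.det, ← LinearMap.det_toMatrix (Module.Basis.finTwoProd ℂ),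
    Matrix.det_fin_two]
  simp [LinearMap.toMatrix_apply]

theorem hasDerivAt_pow_div_const (k : ℕ) (a s : ℂ) :
    HasDerivAt (fun z : ℂ => z ^ k / a) (k * s ^ (k - 1) / a) s := by
  simpa using (hasDerivAt_pow k s).div_const a

theorem hasDerivAt_const_div_pow (k : ℕ) (a : ℂ) {s : ℂ} (h : s ^ k ≠ 0) :
    HasDerivAt (fun z : ℂ => a / z ^ k) (a * (-(k * s ^ (k - 1)) / (s ^ k) ^ 2)) s := by
  simpa [div_eq_mul_inv] using ((hasDerivAt_pow k s).inv h).const_mul a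

theorem resolutionInverse_differentiableAt {i : Fin n} {p : ℂ × ℂ}
    (hs : p.1 ≠ 0 ∨ i.val + 1 = n) (ht : p.2 ≠ 0 ∨ i.val = 0) :
    DifferentiableAt ℂ (resolutionInverse n i) p := by
  have h1 : p.1 ^ (n - (i.val + 1)) ≠ 0 := by
    rcases hs with h | h
    · exact pow_ne_zero _ h
    · simp [h]
  have h2 : p.2 ^ i.val ≠ 0 := by
    rcases ht with h | h
    · exact pow_ne_zero _ h
    · simp [h]
  unfold resolutionInverse
  fun_prop (disch := assumption)

/-- This is `dα_i ∧ dβ_i = -n ds ∧ dt`: the form `ds ∧ dt` has constant coefficient in each chart. -/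
theorem det_fderiv_resolutionInverse {i : Fin n} {p : ℂ × ℂ}
    (hs : p.1 ≠ 0 ∨ i.val + 1 = n) (ht : p.2 ≠ 0 ∨ i.val = 0) :
    (fderiv ℂ (resolutionInverse n i) p).det = -(n : ℂ) := by
  have hi := i.isLt
  have hF := (resolutionInverse_differentiableAt hs ht).hasFDerivAt
  obtain ⟨s, t⟩ := p
  have hlineS : HasDerivAt (fun z : ℂ => (z, t)) (1, 0) s :=
    (hasDerivAt_id s).prodMk (hasDerivAt_const s t)
  have hlineT : HasDerivAt (fun z : ℂ => (s, z)) (0, 1) t :=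
    (hasDerivAt_const t s).prodMk (hasDerivAt_id t)
  obtain ⟨d, hd⟩ : ∃ d, n = i.val + 1 + d := ⟨n - (i.val + 1), by omega⟩
  have e1 : n - (i.val + 1) = d := by omega
  have e2 : n - i.val = d + 1 := by omega
  have hs' : s ≠ 0 ∨ d = 0 := hs.imp_right fun h => by omega
  simp only at ht
  have h1 : s ^ d ≠ 0 := by
    rcases hs' with h | h
    · exact pow_ne_zero _ h
    · simp [h]
  have h2 : t ^ i.val ≠ 0 := by
    rcases ht with h | h
    · exact pow_ne_zero _ h
    · simp [h]
  have dS := (hF.comp_hasDerivAt s hlineS).unique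
    ((hasDerivAt_const_div_pow d (t ^ (i.val + 1)) h1).prodMk
      (hasDerivAt_pow_div_const (d + 1) (t ^ i.val) s) |>.congr_of_eventuallyEq
      (Filter.Eventually.of_forall fun z => by simp [resolutionInverse, e1, e2]))
  have dT := (hF.comp_hasDerivAt t hlineT).unique
    ((hasDerivAt_pow_div_const (i.val + 1) (s ^ d) t).prodMk
      (hasDerivAt_const_div_pow i.val (s ^ (d + 1)) h2) |>.congr_of_eventuallyEq
      (Filter.Eventually.of_forall fun z => by simp [resolutionInverse, e1, e2]))
  rw [det_eq_of_plane, dS, dT]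
  clear dS dT hF hlineS hlineT e1 e2 hs
  generalize i.val = m at *
  subst hd
  simp only [Nat.add_sub_cancel]
  push_cast
  rcases hs' with h | rfl <;> rcases ht with h' | rfl
  · cases d <;> cases m <;> simp <;> field_simp <;> ring
  · cases d <;> simp <;> (field_simp; ring)
  · cases m <;> simp <;> (field_simp; ring)
  · simp

theorem chartTorusAct_chartInv (i : Fin n) (a b : ℂˣ) (x : ℂ × ℂ) :
    chartInv i (chartTorusAct i (a ^ n : ℂˣ) (a * b : ℂˣ) x) =
      ((a : ℂ) ^ n * (chartInv i x).1, (a : ℂ) * b * (chartInv i x).2.1,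
        (b : ℂ) ^ n * (chartInv i x).2.2) := by
  have hi := i.isLt
  have ha := a.ne_zero
  have hb := b.ne_zero
  obtain ⟨d, hd⟩ : ∃ d, n = i.val + 1 + d := ⟨n - (i.val + 1), by omega⟩
  have e2 : n - i.val = d + 1 := by omega
  simp only [chartInv, chartTorusAct, e2, Nat.add_sub_cancel]
  clear e2
  generalize i.val = m at *
  subst hd
  push_cast
  ext
  · simp only [mul_pow, inv_pow, ← pow_mul]; field_simp; ring
  · simp only [mul_pow]; field_simp; ring
  · simp only [mul_pow, inv_pow, ← pow_mul]; field_simp; ring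

/-- The torus orbit of the points with nonzero coordinates. -/
theorem orbit_eq (hn : 1 ≤ n) :
    MulAction.orbit (ℂˣ × ℂˣ) (GluedSurface.incl (⟨0, hn⟩ : Fin n) (1, 1)) =
      GluedSurface.incl ⟨0, hn⟩ '' {x | x.1 ≠ 0 ∧ x.2 ≠ 0} := by
  ext y
  constructor
  · rintro ⟨l, rfl⟩
    exact ⟨_, by simp [chartTorusAct], (smul_incl l _ _).symm⟩
  · rintro ⟨x, ⟨h1, h2⟩, rfl⟩
    refine ⟨(Units.mk0 x.2 h2, Units.mk0 (x.1 * x.2) (mul_ne_zero h1 h2)), ?_⟩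
    change GluedSurface.incl _ _ = _
    congr 1
    ext <;> simp [chartTorusAct]
    field_simp

theorem dense_off_axes : Dense {x : ℂ × ℂ | x.1 ≠ 0 ∧ x.2 ≠ 0} :=
  (dense_compl_singleton (0 : ℂ)).prod (dense_compl_singleton (0 : ℂ))

theorem exists_toric_point (hc : StrictMono c) (hn : 1 ≤ n) :
    ∃ y : GluedSurface n, IsOpen (MulAction.orbit (ℂˣ × ℂˣ) y) ∧
      Dense (MulAction.orbit (ℂˣ × ℂˣ) y) ∧ MulAction.stabilizer (ℂˣ × ℂˣ) y = ⊥ := by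
  have he := isOpenEmbedding_incl hc hn ⟨0, hn⟩
  refine ⟨GluedSurface.incl ⟨0, hn⟩ (1, 1), ?_, ?_, ?_⟩
  · rw [orbit_eq hn]
    exact he.isOpenMap _ ((isOpen_ne_fun continuous_fst continuous_const).inter
      (isOpen_ne_fun continuous_snd continuous_const))
  · rw [orbit_eq hn]
    intro y
    obtain ⟨i, x, rfl⟩ := exists_incl_eq y
    refine map_mem_closure (continuous_incl i) (dense_off_axes x) fun z hz => ?_
    refine ⟨torusTransition i 0 z, ?_, incl_torusTransition i ⟨0, hn⟩ hz.1 hz.2⟩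
    have h := mul_ne_zero hz.1 hz.2
    exact ⟨mul_ne_zero (zpow_ne_zero _ h) (inv_ne_zero hz.2), mul_ne_zero (zpow_ne_zero _ h) hz.2⟩
  · rw [Subgroup.eq_bot_iff_forall]
    rintro ⟨l₁, l₂⟩ hl
    rw [MulAction.mem_stabilizer_iff, smul_incl] at hl
    have h := he.injective hl
    simp only [chartTorusAct, pow_zero, inv_one, mul_one, zero_add, pow_one, Prod.mk.injEq] at h
    obtain ⟨h1, h2⟩ := h
    have h1' : l₁ = 1 := Units.ext h2
    subst h1'
    have h2' : l₂ = 1 := Units.ext (by simpa using h1)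
    subst h2'
    rfl

theorem isToricCrepantResolution (hc : StrictMono c) (hn : 1 ≤ n) :
    IsToricCrepantResolution n (resolution hn) where
  hausdorff := t2Space_gluedSurface hc hn
  openEmbedding := isOpenEmbedding_incl hc hn
  cover := exists_incl_eq
  transition := exists_transition hc
  regular f hf i := by
    obtain ⟨P, hP⟩ := exists_pullback_polynomial f hf i
    exact ⟨P, fun x p h => hP x p ((resolution_eq_iff hn _ p).1 h)⟩
  proper := isProperMap_resolution hn
  bijective p hp := by
    simp only [resolution_eq_iff]
    exact existsUnique_surfaceInv hn hp
  crepant := by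
    have hnC : (n : ℂ) ≠ 0 := by exact_mod_cast (by omega : n ≠ 0)
    -- `ds ∧ dt` is `-1 / n` times the form `dα_i ∧ dβ_i`
    refine ⟨fun _ _ => -(n : ℂ)⁻¹, fun _ => differentiable_const _, fun _ _ => by simpa using hnC,
      fun i => ⟨resolutionInverse n i, ?_, ?_⟩⟩
    · rintro p ⟨hp, x, hx⟩
      obtain ⟨h1, h2⟩ := regularLocus_conditions hp ((resolution_eq_iff hn _ p).1 hx)
      exact (resolutionInverse_differentiableAt h1 h2).differentiableWithinAt
    · rintro p hp ⟨x, hx⟩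
      obtain ⟨h1, h2⟩ := regularLocus_conditions hp ((resolution_eq_iff hn _ p).1 hx)
      refine ⟨(resolution_eq_iff hn _ p).2 (chartInv_resolutionInverse h1 h2), ?_⟩
      rw [det_fderiv_resolutionInverse h1 h2]
      field_simp
  equivariant a b y p h := by
    rw [resolution_eq_iff] at h ⊢
    obtain ⟨i, x, rfl⟩ := exists_incl_eq y
    rw [surfaceInv_incl] at h
    rw [smul_incl, surfaceInv_incl]
    refine (chartTorusAct_chartInv i a b x).trans ?_
    rw [h]
    simp only [cyclicInv, mul_pow]
    ext <;> simp only
    ring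
  toric := exists_toric_point hc hn

end Resolution

/-! ### Logarithmic derivatives of the height -/

section LogForms

/-- The real-linear form `dz₁ / z₁ = i dα / α + (i + 1) dβ / β` in the chart of index `i`. -/
noncomputable def logForm₁ (i : ℕ) (x : ℂ × ℂ) : (ℂ × ℂ) →L[ℝ] ℂ :=
  (((i : ℂ) / x.1) • ContinuousLinearMap.fst ℂ ℂ ℂ +
    (((i : ℂ) + 1) / x.2) • ContinuousLinearMap.snd ℂ ℂ ℂ).restrictScalars ℝ

/-- The real-linear form `dz₂ / z₂ = dα / α + dβ / β`. -/
noncomputable def logForm₂ (x : ℂ × ℂ) : (ℂ × ℂ) →L[ℝ] ℂ :=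
  ((1 / x.1) • ContinuousLinearMap.fst ℂ ℂ ℂ +
    (1 / x.2) • ContinuousLinearMap.snd ℂ ℂ ℂ).restrictScalars ℝ

theorem logForm₁_apply (i : ℕ) (x v : ℂ × ℂ) :
    logForm₁ i x v = i / x.1 * v.1 + (i + 1) / x.2 * v.2 := rfl

theorem logForm₂_apply (x v : ℂ × ℂ) : logForm₂ x v = 1 / x.1 * v.1 + 1 / x.2 * v.2 := rfl

theorem logForm₁_I (i : ℕ) (x v : ℂ × ℂ) :
    logForm₁ i x (Complex.I • v) = Complex.I * logForm₁ i x v := by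
  simp only [logForm₁_apply, Prod.smul_fst, Prod.smul_snd, smul_eq_mul]; ring

theorem logForm₂_I (x v : ℂ × ℂ) :
    logForm₂ x (Complex.I • v) = Complex.I * logForm₂ x v := by
  simp only [logForm₂_apply, Prod.smul_fst, Prod.smul_snd, smul_eq_mul]; ring

theorem hasFDerivAt_log_normSq {z : ℂ} (hz : z ≠ 0) :
    HasFDerivAt (fun w : ℂ => Real.log (Complex.normSq w))
      ((2 : ℝ) • Complex.reCLM.comp
        (((1 / z) • ContinuousLinearMap.id ℂ ℂ).restrictScalars ℝ)) z := by
  have h0 : Complex.normSq z ≠ 0 := (Complex.normSq_pos.2 hz).ne'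
  have h : HasFDerivAt (fun w : ℂ => w.re * w.re + w.im * w.im) _ z :=
    (Complex.reCLM.hasFDerivAt.mul Complex.reCLM.hasFDerivAt).add
      (Complex.imCLM.hasFDerivAt.mul Complex.imCLM.hasFDerivAt)
  have h' := h.log (by rwa [← Complex.normSq_apply])
  refine (h'.congr_fderiv ?_).congr_of_eventuallyEq
    (Filter.Eventually.of_forall fun w => by simp [Complex.normSq_apply])
  ext v
  rw [Complex.normSq_apply] at h0
  simp [Complex.normSq_apply]
  field_simp
  ring

end LogForms

section HeightDeriv

variable {n : ℕ} {c : Fin n → ℝ}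

/-- The derivative of `½ ∑ (r_j + z - c_j)` with respect to `z`. -/
noncomputable def ghSlope (c : Fin n → ℝ) (p : ℝ × ℝ × ℝ) : ℝ :=
  1 / 2 * ∑ j, (rad c j p + (p.2.2 - c j)) / rad c j p

theorem rad_position (i j : Fin n) (x : ℂ × ℂ) :
    rad c j (position c i x) = Real.sqrt (modSq x + (height c i x - c j) ^ 2) := by
  rw [rad_eq, horizSq_position]; rfl

theorem ghPotential_position (i : Fin n) (x : ℂ × ℂ) :
    ghPotential c (position c i x) =
      1 / 2 * ∑ j, 1 / Real.sqrt (modSq x + (height c i x - c j) ^ 2) := by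
  simp only [ghPotential, rad_position]

theorem ghSlope_position (i : Fin n) (x : ℂ × ℂ) :
    ghSlope c (position c i x) =
      1 / 2 * ∑ j, rPlus (modSq x) (height c i x - c j) /
        Real.sqrt (modSq x + (height c i x - c j) ^ 2) := by
  simp only [ghSlope, rad_position]; rfl

theorem isOpen_off_axes : IsOpen {x : ℂ × ℂ | x.1 ≠ 0 ∧ x.2 ≠ 0} :=
  (isOpen_ne_fun continuous_fst continuous_const).inter
    (isOpen_ne_fun continuous_snd continuous_const)

theorem hasFDerivAt_log_normSq_fst {x : ℂ × ℂ} (h : x.1 ≠ 0) :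
    HasFDerivAt (fun y : ℂ × ℂ => Real.log (Complex.normSq y.1))
      ((2 : ℝ) • Complex.reCLM.comp
        (((1 / x.1) • ContinuousLinearMap.fst ℂ ℂ ℂ).restrictScalars ℝ)) x :=
  (hasFDerivAt_log_normSq h).comp x hasFDerivAt_fst

theorem hasFDerivAt_log_normSq_snd {x : ℂ × ℂ} (h : x.2 ≠ 0) :
    HasFDerivAt (fun y : ℂ × ℂ => Real.log (Complex.normSq y.2))
      ((2 : ℝ) • Complex.reCLM.comp
        (((1 / x.2) • ContinuousLinearMap.snd ℂ ℂ ℂ).restrictScalars ℝ)) x :=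
  (hasFDerivAt_log_normSq h).comp x hasFDerivAt_snd

theorem hasFDerivAt_modSq {x : ℂ × ℂ} (h₁ : x.1 ≠ 0) (h₂ : x.2 ≠ 0) :
    HasFDerivAt modSq ((2 * modSq x) • Complex.reCLM.comp (logForm₂ x)) x := by
  have h := ((hasFDerivAt_log_normSq_fst h₁).add (hasFDerivAt_log_normSq_snd h₂)).exp
  have hA := Complex.normSq_pos.2 h₁
  have hB := Complex.normSq_pos.2 h₂
  refine (h.congr_fderiv ?_).congr_of_eventuallyEq ?_
  · refine ContinuousLinearMap.ext fun v => ?_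
    simp only [Pi.add_apply, Real.exp_add, Real.exp_log hA, Real.exp_log hB]
    simp [logForm₂_apply, modSq]
    ring
  · filter_upwards [isOpen_off_axes.mem_nhds ⟨h₁, h₂⟩] with y hy
    simp only [Pi.add_apply, Real.exp_add, Real.exp_log (Complex.normSq_pos.2 hy.1),
      Real.exp_log (Complex.normSq_pos.2 hy.2)]
    rfl

variable (i : Fin n)

theorem differentiableAt_height (hc : StrictMono c) (x : ℂ × ℂ) :
    DifferentiableAt ℝ (height c i) x :=
  (contDiff_height i hc).differentiable (by simp) x

/-- Off the axes, `∏ (r_j - (z - c_j)) = |z₁|²`. -/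
theorem hiProd_zero_height (hc : StrictMono c) {x : ℂ × ℂ} (h₁ : x.1 ≠ 0) (h₂ : x.2 ≠ 0) :
    hiProd c 0 (modSq x) (height c i x) =
      Complex.normSq x.1 ^ i.val * Complex.normSq x.2 ^ (i.val + 1) := by
  have hR := modSq_pos h₁ h₂
  have e := (isHeight_height c i x).2
  have e' := loProd_mul_hiProd_zero c i.isLt.le hR.le (height c i x)
  have hp : 0 < hiProd c i (modSq x) (height c i x) :=
    (hiProd_pos_iff c _ hR.le _).2 fun _ _ => Or.inl hR
  have hl := loProd_height_pos i hc x
  change Complex.normSq x.2 * loProd c i (modSq x) (height c i x) =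
    hiProd c i (modSq x) (height c i x) at e
  refine mul_left_cancel₀ hl.ne' ?_
  rw [e', ← e]
  unfold modSq
  ring

theorem sum_log_rMinus (hc : StrictMono c) {x : ℂ × ℂ} (h₁ : x.1 ≠ 0) (h₂ : x.2 ≠ 0) :
    ∑ j, Real.log (rMinus (modSq x) (height c i x - c j)) =
      i.val * Real.log (Complex.normSq x.1) + (i.val + 1) * Real.log (Complex.normSq x.2) := by
  have hR := modSq_pos h₁ h₂
  have hA := Complex.normSq_pos.2 h₁
  have hB := Complex.normSq_pos.2 h₂
  have e := congrArg Real.log (hiProd_zero_height i hc h₁ h₂)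
  rw [Real.log_mul (pow_ne_zero _ hA.ne') (pow_ne_zero _ hB.ne'), Real.log_pow, Real.log_pow] at e
  push_cast at e
  rw [← e]
  unfold hiProd
  simp only [Nat.not_lt_zero, if_false]
  rw [Real.log_prod]
  exact fun j _ => ((rMinus_pos_iff hR.le _).2 (Or.inl hR)).ne'

theorem sqrt_pos_off_axes {x : ℂ × ℂ} (h₁ : x.1 ≠ 0) (h₂ : x.2 ≠ 0) (s : ℝ) :
    0 < Real.sqrt (modSq x + s ^ 2) :=
  Real.sqrt_pos.2 (by have := modSq_pos h₁ h₂; positivity)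

/-- The derivative of `log (r_j - (z - c_j))` off the axes. -/
theorem fderiv_log_rMinus (hc : StrictMono c) {x : ℂ × ℂ} (h₁ : x.1 ≠ 0) (h₂ : x.2 ≠ 0)
    (j : Fin n) :
    ∃ L : (ℂ × ℂ) →L[ℝ] ℝ,
      HasFDerivAt (fun y => Real.log (rMinus (modSq y) (height c i y - c j))) L x ∧
      ∀ v, L v = rPlus (modSq x) (height c i x - c j) /
          Real.sqrt (modSq x + (height c i x - c j) ^ 2) * (logForm₂ x v).re -
        1 / Real.sqrt (modSq x + (height c i x - c j) ^ 2) * fderiv ℝ (height c i) x v := by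
  have hR := modSq_pos h₁ h₂
  have hm : 0 < rMinus (modSq x) (height c i x - c j) := (rMinus_pos_iff hR.le _).2 (Or.inl hR)
  have hz := (differentiableAt_height i hc x).hasFDerivAt.sub_const (c j)
  refine ⟨_, (hasFDerivAt_modSq h₁ h₂).log_rMinus hz hR.le hm, fun v => ?_⟩
  have hs := sqrt_pos_off_axes h₁ h₂ (height c i x - c j)
  have e := rMinus_mul_rPlus hR.le (height c i x - c j)
  simp only [sub_apply, smul_apply, smul_eq_mul, ContinuousLinearMap.comp_apply,
    Complex.reCLM_apply]
  generalize rMinus (modSq x) (height c i x - c j) = m at *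
  generalize rPlus (modSq x) (height c i x - c j) = p at *
  generalize Real.sqrt (modSq x + (height c i x - c j) ^ 2) = r at *
  rw [← e]
  field_simp

/-- The derivative of the height: `V dz = S Re (dz₂ / z₂) - Re (dz₁ / z₁)`. -/
theorem potential_mul_fderiv_height (hc : StrictMono c) {x : ℂ × ℂ} (h₁ : x.1 ≠ 0)
    (h₂ : x.2 ≠ 0) (v : ℂ × ℂ) :
    ghPotential c (position c i x) * fderiv ℝ (height c i) x v =
      ghSlope c (position c i x) * (logForm₂ x v).re - (logForm₁ i x v).re := by
  choose L hL hLv using fderiv_log_rMinus i hc h₁ h₂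
  have d1 := HasFDerivAt.fun_sum (u := Finset.univ) fun j _ => hL j
  have d2 := ((hasFDerivAt_log_normSq_fst h₁).const_mul (i.val : ℝ)).fun_add
    ((hasFDerivAt_log_normSq_snd h₂).const_mul ((i.val : ℝ) + 1))
  have d3 := d2.congr_of_eventuallyEq (f₁ := fun y => ∑ j,
      Real.log (rMinus (modSq y) (height c i y - c j))) (by
    filter_upwards [isOpen_off_axes.mem_nhds ⟨h₁, h₂⟩] with y hy
    exact sum_log_rMinus i hc hy.1 hy.2)
  have e := congrArg (fun M => M v) (d1.unique d3)
  simp only [sum_apply, hLv, add_apply, smul_apply, smul_eq_mul,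
    ContinuousLinearMap.comp_apply, Complex.reCLM_apply,
    Finset.sum_sub_distrib, ← Finset.sum_mul] at e
  have e2 : (logForm₁ i x v).re =
      i.val * ((((1 / x.1) • ContinuousLinearMap.fst ℂ ℂ ℂ).restrictScalars ℝ) v).re +
      (i.val + 1) *
        ((((1 / x.2) • ContinuousLinearMap.snd ℂ ℂ ℂ).restrictScalars ℝ) v).re := by
    have : logForm₁ i x v = ((i.val : ℝ) : ℂ) * (1 / x.1 * v.1) +
        ((i.val + 1 : ℝ) : ℂ) * (1 / x.2 * v.2) := by
      rw [logForm₁_apply]; push_cast; ring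
    rw [this, Complex.add_re, Complex.re_ofReal_mul, Complex.re_ofReal_mul]
    rfl
  rw [e2, ghPotential_position, ghSlope_position]
  linear_combination (-1 / 2 : ℝ) * e

end HeightDeriv

/-! ### Hermitian forms on `ℂ²` -/

section HermForm

/-- The real part of the Hermitian form on `ℂ²` with diagonal coefficients `p`, `q` and
off-diagonal coefficient `s + i t`. -/
noncomputable def hermForm (p q s t : ℝ) : (ℂ × ℂ) →L[ℝ] (ℂ × ℂ) →L[ℝ] ℝ :=
  let x₁ : (ℂ × ℂ) →L[ℝ] ℝ := Complex.reCLM.comp (ContinuousLinearMap.fst ℝ ℂ ℂ)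
  let y₁ : (ℂ × ℂ) →L[ℝ] ℝ := Complex.imCLM.comp (ContinuousLinearMap.fst ℝ ℂ ℂ)
  let x₂ : (ℂ × ℂ) →L[ℝ] ℝ := Complex.reCLM.comp (ContinuousLinearMap.snd ℝ ℂ ℂ)
  let y₂ : (ℂ × ℂ) →L[ℝ] ℝ := Complex.imCLM.comp (ContinuousLinearMap.snd ℝ ℂ ℂ)
  p • (x₁.smulRight x₁ + y₁.smulRight y₁) + q • (x₂.smulRight x₂ + y₂.smulRight y₂) +
    s • (x₁.smulRight x₂ + y₁.smulRight y₂ + x₂.smulRight x₁ + y₂.smulRight y₁) +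
    t • (x₁.smulRight y₂ - y₁.smulRight x₂ + y₂.smulRight x₁ - x₂.smulRight y₁)

theorem hermForm_apply (p q s t : ℝ) (v w : ℂ × ℂ) :
    hermForm p q s t v w =
      p * (v.1.re * w.1.re + v.1.im * w.1.im) + q * (v.2.re * w.2.re + v.2.im * w.2.im) +
      s * (v.1.re * w.2.re + v.1.im * w.2.im + v.2.re * w.1.re + v.2.im * w.1.im) +
      t * (v.1.re * w.2.im - v.1.im * w.2.re + v.2.im * w.1.re - v.2.re * w.1.im) := by
  simp [hermForm]
  ring

theorem hermForm_symm (p q s t : ℝ) (v w : ℂ × ℂ) :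
    hermForm p q s t v w = hermForm p q s t w v := by
  simp only [hermForm_apply]; ring

theorem hermForm_I (p q s t : ℝ) (v w : ℂ × ℂ) :
    hermForm p q s t (Complex.I • v) (Complex.I • w) = hermForm p q s t v w := by
  simp only [hermForm_apply, Prod.smul_fst, Prod.smul_snd, smul_eq_mul, Complex.mul_re,
    Complex.mul_im, Complex.I_re, Complex.I_im]
  ring

/-- A Hermitian form with positive first coefficient and determinant `1` is positive definite. -/
theorem hermForm_pos {p q s t : ℝ} (hp : 0 < p) (hdet : p * q - s ^ 2 - t ^ 2 = 1)
    {v : ℂ × ℂ} (hv : v ≠ 0) : 0 < hermForm p q s t v v := by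
  have e : p * hermForm p q s t v v =
      (p * v.1.re + s * v.2.re + t * v.2.im) ^ 2 + (p * v.1.im + s * v.2.im - t * v.2.re) ^ 2 +
        (v.2.re ^ 2 + v.2.im ^ 2) := by
    rw [hermForm_apply]
    linear_combination (v.2.re ^ 2 + v.2.im ^ 2) * hdet
  refine pos_of_mul_pos_right ?_ hp.le
  rw [e]
  by_cases h2 : v.2 = 0
  · have h1 : v.1 ≠ 0 := fun h1 => hv (Prod.ext h1 h2)
    have := mul_pos (pow_pos hp 2) (Complex.normSq_pos.2 h1)
    rw [Complex.normSq_apply] at this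
    rw [h2]
    simp only [Complex.zero_re, Complex.zero_im]
    nlinarith
  · have := Complex.normSq_pos.2 h2
    rw [Complex.normSq_apply] at this
    nlinarith [sq_nonneg (p * v.1.re + s * v.2.re + t * v.2.im),
      sq_nonneg (p * v.1.im + s * v.2.im - t * v.2.re)]

theorem contDiff_hermForm {E : Type*} [NormedAddCommGroup E] [NormedSpace ℝ E]
    {p q s t : E → ℝ} {m : WithTop ℕ∞} (hp : ContDiff ℝ m p) (hq : ContDiff ℝ m q)
    (hs : ContDiff ℝ m s) (ht : ContDiff ℝ m t) :
    ContDiff ℝ m fun x => hermForm (p x) (q x) (s x) (t x) := by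
  refine contDiff_clm_apply_iff.2 fun v => contDiff_clm_apply_iff.2 fun w => ?_
  simp only [hermForm_apply]
  fun_prop

end HermForm

/-! ### The metric in a chart -/

section Metric

variable {n : ℕ} (c : Fin n → ℝ) (i : Fin n)

/-- The part of `V` that is smooth near `p_i`. -/
noncomputable def otherPotential (x : ℂ × ℂ) : ℝ :=
  1 / 2 * ∑ j, if j = i then 0 else 1 / Real.sqrt (modSq x + (height c i x - c j) ^ 2)

/-- The quantity `½ ∑_{j > i} 1 / (r_j (r_j - (z - c_j))) - ½ ∑_{j < i} 1 / (r_j (r_j + z - c_j))`,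
which is smooth near `p_i`. -/
noncomputable def otherSlope (x : ℂ × ℂ) : ℝ :=
  1 / 2 * ∑ j, if j < i then
      -(1 / (Real.sqrt (modSq x + (height c i x - c j) ^ 2) *
        rPlus (modSq x) (height c i x - c j)))
    else if i < j then
      1 / (Real.sqrt (modSq x + (height c i x - c j) ^ 2) *
        rMinus (modSq x) (height c i x - c j))
    else 0

/-- The function `r_i - (z - c_i)` of the chart coordinates. -/
noncomputable def chartMinus (x : ℂ × ℂ) : ℝ := scale c i x * Complex.normSq x.2

/-- The function `r_i + (z - c_i)` of the chart coordinates. -/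
noncomputable def chartPlus (x : ℂ × ℂ) : ℝ := Complex.normSq x.1 / scale c i x

/-- The diagonal coefficient of the metric, up to the factor `scale`, in terms of
`a = r_i - (z - c_i)`, `b = r_i + z - c_i`, the slope `K` and the potential `W` of the other
centers. -/
noncomputable def diagCoef (a b K W : ℝ) : ℝ :=
  1 + b * ((2 * a * K + (a + b) * a ^ 2 * K ^ 2 - W) / (1 + (a + b) * W)) + a * W

/-- The off-diagonal coefficient of the metric, up to the factor `conj α * β`. -/
noncomputable def offCoef (a b K W : ℝ) : ℝ :=
  (2 * W + (a + b) * W ^ 2 - (a - b) * K + (a + b) * a * b * K ^ 2) / (1 + (a + b) * W)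

theorem diagCoef_mul {a b K W : ℝ} (h : a + b ≠ 0) (hD : 1 + (a + b) * W ≠ 0) :
    (1 / (a + b) + W)⁻¹ * (b / (a + b) + a * b * K) ^ 2 + (1 / (a + b) + W) * (a * b) =
      b * diagCoef a b K W := by
  have e : (1 / (a + b) + W) = (1 + (a + b) * W) / (a + b) := by field_simp
  rw [e, inv_div, diagCoef]
  field_simp
  ring

theorem diagCoef_mul' {a b K W : ℝ} (h : a + b ≠ 0) (hD : 1 + (a + b) * W ≠ 0) :
    (1 / (a + b) + W)⁻¹ * (1 - (b / (a + b) + a * b * K)) ^ 2 + (1 / (a + b) + W) * (a * b) =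
      a * diagCoef b a (-K) W := by
  have hD' : 1 + (b + a) * W ≠ 0 := by rwa [add_comm b]
  have h' : b + a ≠ 0 := by rwa [add_comm b]
  have e : (1 / (a + b) + W) = (1 + (a + b) * W) / (a + b) := by field_simp
  rw [e, inv_div, diagCoef, add_comm b a]
  field_simp
  ring

theorem offCoef_mul {a b K W : ℝ} (h : a + b ≠ 0) (hD : 1 + (a + b) * W ≠ 0) :
    -((1 / (a + b) + W)⁻¹ * ((b / (a + b) + a * b * K) * (1 - (b / (a + b) + a * b * K)))) +
        (1 / (a + b) + W) * (a * b) = a * b * offCoef a b K W := by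
  have e : (1 / (a + b) + W) = (1 + (a + b) * W) / (a + b) := by field_simp
  rw [e, inv_div, offCoef]
  field_simp
  ring

theorem diagCoef_pos {a b K W : ℝ} (ha : 0 ≤ a) (hb : 0 ≤ b) (hW : 0 ≤ W) :
    0 < diagCoef a b K W := by
  have hD : 0 < 1 + (a + b) * W := by positivity
  have e : diagCoef a b K W = ((1 + a * b * K) ^ 2 + a ^ 3 * b * K ^ 2 + a * W +
      a * W * (1 + (a + b) * W)) / (1 + (a + b) * W) := by
    rw [diagCoef]; field_simp; ring
  rw [e]
  refine div_pos ?_ hD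
  rcases eq_or_ne (1 + a * b * K) 0 with h | h
  · have ha' : 0 < a := lt_of_le_of_ne ha fun h0 => by rw [← h0] at h; simp at h
    have hb' : 0 < b := lt_of_le_of_ne hb fun h0 => by rw [← h0] at h; simp at h
    have hK : K ≠ 0 := fun h0 => by rw [h0] at h; simp at h
    positivity
  · positivity

/-- The determinant of the Hermitian matrix with entries `diagCoef` and `offCoef` is `1`. -/
theorem coef_det {a b K W : ℝ} (hD : 1 + (a + b) * W ≠ 0) :
    diagCoef a b K W * diagCoef b a (-K) W - a * b * offCoef a b K W ^ 2 = 1 := by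
  have hD' : 1 + (b + a) * W ≠ 0 := by rwa [add_comm b]
  rw [diagCoef, diagCoef, offCoef, add_comm b a]
  field_simp
  ring

/-- The coefficient of `|dα|²` of the metric in the chart of index `i`. -/
noncomputable def metricP (x : ℂ × ℂ) : ℝ :=
  diagCoef (chartMinus c i x) (chartPlus c i x) (otherSlope c i x) (otherPotential c i x) /
    scale c i x

/-- The coefficient of `|dβ|²` of the metric in the chart of index `i`. It has the same form as that of
`|dα|²`, because the reflection `z ↦ -z` exchanges the roles of `α` and `β`. -/
noncomputable def metricQ (x : ℂ × ℂ) : ℝ :=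
  diagCoef (chartPlus c i x) (chartMinus c i x) (-otherSlope c i x) (otherPotential c i x) *
    scale c i x

/-- The off-diagonal coefficient of the metric, up to the factor `conj α * β`. -/
noncomputable def metricM (x : ℂ × ℂ) : ℝ :=
  offCoef (chartMinus c i x) (chartPlus c i x) (otherSlope c i x) (otherPotential c i x)

/-- The real part of the off-diagonal coefficient `M conj α β`. -/
noncomputable def metricS (x : ℂ × ℂ) : ℝ :=
  metricM c i x * (x.1.re * x.2.re + x.1.im * x.2.im)

/-- The imaginary part of the off-diagonal coefficient `M conj α β`. -/
noncomputable def metricT (x : ℂ × ℂ) : ℝ :=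
  metricM c i x * (x.1.re * x.2.im - x.1.im * x.2.re)

/-- The Gibbons–Hawking metric in the coordinates `(α_i, β_i)`. -/
noncomputable def chartMetric : ChartTensor n := fun i x =>
  hermForm (metricP c i x) (metricQ c i x) (metricS c i x) (metricT c i x)

variable {c}

theorem chartMinus_nonneg (hc : StrictMono c) (x : ℂ × ℂ) : 0 ≤ chartMinus c i x :=
  mul_nonneg (scale_pos i hc x).le (Complex.normSq_nonneg _)

theorem chartPlus_nonneg (hc : StrictMono c) (x : ℂ × ℂ) : 0 ≤ chartPlus c i x :=
  div_nonneg (Complex.normSq_nonneg _) (scale_pos i hc x).le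

theorem chartMinus_mul_chartPlus (hc : StrictMono c) (x : ℂ × ℂ) :
    chartMinus c i x * chartPlus c i x = modSq x := by
  have := (scale_pos i hc x).ne'
  unfold chartMinus chartPlus modSq
  field_simp

theorem otherPotential_nonneg (x : ℂ × ℂ) : 0 ≤ otherPotential c i x := by
  unfold otherPotential
  refine mul_nonneg (by norm_num) (Finset.sum_nonneg fun j _ => ?_)
  split_ifs <;> positivity

theorem one_add_mul_otherPotential_pos (hc : StrictMono c) (x : ℂ × ℂ) :
    0 < 1 + (chartMinus c i x + chartPlus c i x) * otherPotential c i x := by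
  have h1 := chartMinus_nonneg i hc x
  have h2 := chartPlus_nonneg i hc x
  have h3 := otherPotential_nonneg (c := c) i x
  positivity

theorem metricP_pos (hc : StrictMono c) (x : ℂ × ℂ) : 0 < metricP c i x :=
  div_pos (diagCoef_pos (chartMinus_nonneg i hc x) (chartPlus_nonneg i hc x)
    (otherPotential_nonneg i x)) (scale_pos i hc x)

/-- The volume form of the metric is the standard one of the chart; this is what makes the metric
Ricci-flat. -/
theorem metric_det (hc : StrictMono c) (x : ℂ × ℂ) :
    metricP c i x * metricQ c i x - metricS c i x ^ 2 - metricT c i x ^ 2 = 1 := by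
  have h := coef_det (K := otherSlope c i x) (one_add_mul_otherPotential_pos i hc x).ne'
  rw [chartMinus_mul_chartPlus i hc x, modSq, Complex.normSq_apply, Complex.normSq_apply] at h
  have ht := (scale_pos i hc x).ne'
  unfold metricP metricQ metricS metricT metricM
  rw [← h]
  field_simp
  ring

theorem contDiff_otherPotential (hc : StrictMono c) : ContDiff ℝ ∞ (otherPotential c i) := by
  refine contDiff_const.mul (ContDiff.sum fun j _ => ?_)
  by_cases hj : j = i
  · simp only [hj, if_true]; exact contDiff_const
  · simp only [hj, if_false]
    have h : ContDiff ℝ ∞ fun x => Real.sqrt (modSq x + (height c i x - c j) ^ 2) :=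
      contDiff_iff_contDiffAt.2 fun x => ContDiffAt.sqrt_add_sq contDiff_modSq.contDiffAt
        ((contDiff_height i hc).sub contDiff_const).contDiffAt (radicand_height_pos i hc hj x)
    exact contDiff_const.div h fun x => (Real.sqrt_pos.2 (radicand_height_pos i hc hj x)).ne'

theorem contDiff_otherSlope (hc : StrictMono c) : ContDiff ℝ ∞ (otherSlope c i) := by
  refine contDiff_const.mul (ContDiff.sum fun j _ => ?_)
  have hz : ContDiff ℝ ∞ fun x => height c i x - c j := (contDiff_height i hc).sub contDiff_const
  rcases lt_trichotomy j i with hj | hj | hj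
  · simp only [hj, if_true]
    have hr := fun x => radicand_height_pos i hc hj.ne x
    have h1 : ContDiff ℝ ∞ fun x => Real.sqrt (modSq x + (height c i x - c j) ^ 2) :=
      contDiff_iff_contDiffAt.2 fun x => ContDiffAt.sqrt_add_sq contDiff_modSq.contDiffAt
        hz.contDiffAt (hr x)
    have h2 : ContDiff ℝ ∞ fun x => rPlus (modSq x) (height c i x - c j) :=
      contDiff_iff_contDiffAt.2 fun x => ContDiffAt.rPlus contDiff_modSq.contDiffAt
        hz.contDiffAt (hr x)
    exact (contDiff_const.div (h1.mul h2) fun x =>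
      (mul_pos (Real.sqrt_pos.2 (hr x)) (rPlus_height_pos i hc hj x)).ne').neg
  · simp only [hj, lt_irrefl, if_false]; exact contDiff_const
  · simp only [hj, hj.not_gt, if_true, if_false]
    have hr := fun x => radicand_height_pos i hc hj.ne' x
    have h1 : ContDiff ℝ ∞ fun x => Real.sqrt (modSq x + (height c i x - c j) ^ 2) :=
      contDiff_iff_contDiffAt.2 fun x => ContDiffAt.sqrt_add_sq contDiff_modSq.contDiffAt
        hz.contDiffAt (hr x)
    have h2 : ContDiff ℝ ∞ fun x => rMinus (modSq x) (height c i x - c j) :=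
      contDiff_iff_contDiffAt.2 fun x => ContDiffAt.rMinus contDiff_modSq.contDiffAt
        hz.contDiffAt (hr x)
    exact contDiff_const.div (h1.mul h2) fun x =>
      (mul_pos (Real.sqrt_pos.2 (hr x)) (rMinus_height_pos i hc hj x)).ne'

theorem contDiff_chartMinus (hc : StrictMono c) : ContDiff ℝ ∞ (chartMinus c i) :=
  (contDiff_scale i hc).mul (contDiff_normSq.comp contDiff_snd)

theorem contDiff_chartPlus (hc : StrictMono c) : ContDiff ℝ ∞ (chartPlus c i) :=
  (contDiff_normSq.comp contDiff_fst).div (contDiff_scale i hc) fun x => (scale_pos i hc x).ne'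

theorem ContDiff.diagCoef {E : Type*} [NormedAddCommGroup E] [NormedSpace ℝ E] {m : WithTop ℕ∞}
    {a b K W : E → ℝ} (ha : ContDiff ℝ m a) (hb : ContDiff ℝ m b) (hK : ContDiff ℝ m K)
    (hW : ContDiff ℝ m W) (hD : ∀ x, 1 + (a x + b x) * W x ≠ 0) :
    ContDiff ℝ m fun x => diagCoef (a x) (b x) (K x) (W x) := by
  unfold _root_.diagCoef
  fun_prop (disch := assumption)

theorem contDiff_metricP (hc : StrictMono c) : ContDiff ℝ ∞ (metricP c i) :=
  ((contDiff_chartMinus i hc).diagCoef (contDiff_chartPlus i hc) (contDiff_otherSlope i hc)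
    (contDiff_otherPotential i hc) fun x => (one_add_mul_otherPotential_pos i hc x).ne').div
    (contDiff_scale i hc) fun x => (scale_pos i hc x).ne'

theorem contDiff_metricQ (hc : StrictMono c) : ContDiff ℝ ∞ (metricQ c i) :=
  ((contDiff_chartPlus i hc).diagCoef (contDiff_chartMinus i hc) (contDiff_otherSlope i hc).neg
    (contDiff_otherPotential i hc) fun x => by
      rw [add_comm (chartPlus c i x)]
      exact (one_add_mul_otherPotential_pos i hc x).ne').mul (contDiff_scale i hc)

theorem contDiff_metricM (hc : StrictMono c) : ContDiff ℝ ∞ (metricM c i) := by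
  have h1 := contDiff_chartMinus i hc
  have h2 := contDiff_chartPlus i hc
  have h3 := contDiff_otherSlope i hc
  have h4 := contDiff_otherPotential i hc
  have h5 := fun x => (one_add_mul_otherPotential_pos i hc x).ne'
  unfold metricM offCoef
  fun_prop (disch := assumption)

theorem contDiff_re : ContDiff ℝ ∞ Complex.re := Complex.reCLM.contDiff

theorem contDiff_im : ContDiff ℝ ∞ Complex.im := Complex.imCLM.contDiff

theorem contDiff_metricS (hc : StrictMono c) : ContDiff ℝ ∞ (metricS c i) := by
  have h1 := contDiff_re.comp (contDiff_fst (𝕜 := ℝ) (E := ℂ) (F := ℂ))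
  have h2 := contDiff_re.comp (contDiff_snd (𝕜 := ℝ) (E := ℂ) (F := ℂ))
  have h3 := contDiff_im.comp (contDiff_fst (𝕜 := ℝ) (E := ℂ) (F := ℂ))
  have h4 := contDiff_im.comp (contDiff_snd (𝕜 := ℝ) (E := ℂ) (F := ℂ))
  exact (contDiff_metricM i hc).mul ((h1.mul h2).add (h3.mul h4))

theorem contDiff_metricT (hc : StrictMono c) : ContDiff ℝ ∞ (metricT c i) := by
  have h1 := contDiff_re.comp (contDiff_fst (𝕜 := ℝ) (E := ℂ) (F := ℂ))
  have h2 := contDiff_re.comp (contDiff_snd (𝕜 := ℝ) (E := ℂ) (F := ℂ))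
  have h3 := contDiff_im.comp (contDiff_fst (𝕜 := ℝ) (E := ℂ) (F := ℂ))
  have h4 := contDiff_im.comp (contDiff_snd (𝕜 := ℝ) (E := ℂ) (F := ℂ))
  exact (contDiff_metricM i hc).mul ((h1.mul h4).sub (h3.mul h2))

theorem contDiff_chartMetric (hc : StrictMono c) : ContDiff ℝ ∞ (chartMetric c i) :=
  contDiff_hermForm (contDiff_metricP i hc) (contDiff_metricQ i hc) (contDiff_metricS i hc)
    (contDiff_metricT i hc)

end Metric

/-! ### The metric off the axes -/

section OffAxes

variable {n : ℕ} {c : Fin n → ℝ} (i : Fin n)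

theorem chartMinus_add_chartPlus (hc : StrictMono c) (x : ℂ × ℂ) :
    chartMinus c i x + chartPlus c i x =
      2 * Real.sqrt (modSq x + (height c i x - c i) ^ 2) := by
  rw [sqrt_height_self i hc]; unfold chartMinus chartPlus; ring

theorem ghPotential_eq (hc : StrictMono c) (x : ℂ × ℂ) :
    ghPotential c (position c i x) =
      1 / (chartMinus c i x + chartPlus c i x) + otherPotential c i x := by
  rw [ghPotential_position, chartMinus_add_chartPlus i hc, otherPotential,
    ← Finset.add_sum_erase _ _ (Finset.mem_univ i),
    ← Finset.add_sum_erase (a := i) Finset.univ (fun j => ite (j = i) _ _) (Finset.mem_univ i)]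
  simp only [if_true, zero_add]
  rw [Finset.sum_congr rfl (g := fun j => 1 / Real.sqrt (modSq x + (height c i x - c j) ^ 2))
    fun j hj => if_neg (Finset.ne_of_mem_erase hj)]
  rw [mul_add, one_div_mul_one_div]

theorem ghSlope_eq (hc : StrictMono c) {x : ℂ × ℂ} (h₁ : x.1 ≠ 0) (h₂ : x.2 ≠ 0) :
    ghSlope c (position c i x) = i.val + (chartPlus c i x / (chartMinus c i x + chartPlus c i x) +
      chartMinus c i x * chartPlus c i x * otherSlope c i x) := by
  have hR := modSq_pos h₁ h₂
  have hcount : (i.val : ℝ) = ∑ j : Fin n, if j < i then 1 else 0 := by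
    rw [Finset.sum_boole, show Finset.univ.filter (· < i) = Finset.Iio i by ext; simp,
      Fin.card_Iio]
  have hself : chartPlus c i x / (chartMinus c i x + chartPlus c i x) =
      ∑ j : Fin n, if j = i then
        1 / 2 * (rPlus (modSq x) (height c i x - c i) /
          Real.sqrt (modSq x + (height c i x - c i) ^ 2)) else 0 := by
    rw [Finset.sum_ite_eq' Finset.univ i, if_pos (Finset.mem_univ i),
      chartMinus_add_chartPlus i hc, rPlus_height_self i hc, chartPlus]
    have := sqrt_pos_off_axes h₁ h₂ (height c i x - c i)
    field_simp
  rw [hself, hcount, chartMinus_mul_chartPlus i hc, otherSlope, ghSlope_position, Finset.mul_sum,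
    Finset.mul_sum, Finset.mul_sum, ← Finset.sum_add_distrib, ← Finset.sum_add_distrib]
  refine Finset.sum_congr rfl fun j _ => ?_
  have hr := sqrt_pos_off_axes h₁ h₂ (height c i x - c j)
  have e := rMinus_mul_rPlus hR.le (height c i x - c j)
  have hm : 0 < rMinus (modSq x) (height c i x - c j) := (rMinus_pos_iff hR.le _).2 (Or.inl hR)
  have hp : 0 < rPlus (modSq x) (height c i x - c j) := (rPlus_pos_iff hR.le _).2 (Or.inl hR)
  have es : rMinus (modSq x) (height c i x - c j) + rPlus (modSq x) (height c i x - c j) =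
      2 * Real.sqrt (modSq x + (height c i x - c j) ^ 2) := by unfold rMinus rPlus; ring
  rcases lt_trichotomy j i with hj | rfl | hj
  · simp only [hj, hj.ne, if_true, if_false]
    generalize rMinus (modSq x) (height c i x - c j) = m at *
    generalize rPlus (modSq x) (height c i x - c j) = p at *
    generalize Real.sqrt (modSq x + (height c i x - c j) ^ 2) = r at *
    rw [← e]
    field_simp
    linarith
  · simp
  · simp only [hj, hj.not_gt, hj.ne', if_true, if_false]
    generalize rMinus (modSq x) (height c i x - c j) = m at *
    generalize rPlus (modSq x) (height c i x - c j) = p at *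
    generalize Real.sqrt (modSq x + (height c i x - c j) ^ 2) = r at *
    rw [← e]
    field_simp
    ring

theorem chart_add_pos (hc : StrictMono c) {x : ℂ × ℂ} (h₁ : x.1 ≠ 0) (h₂ : x.2 ≠ 0) :
    0 < chartMinus c i x + chartPlus c i x := by
  rw [chartMinus_add_chartPlus i hc]
  have := sqrt_pos_off_axes h₁ h₂ (height c i x - c i)
  positivity

theorem ghPotential_pos (hc : StrictMono c) {x : ℂ × ℂ} (h₁ : x.1 ≠ 0) (h₂ : x.2 ≠ 0) :
    0 < ghPotential c (position c i x) := by
  rw [ghPotential_eq i hc]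
  have := chart_add_pos i hc h₁ h₂
  have := otherPotential_nonneg (c := c) i x
  positivity

/-- The form `dz₁ / z₁ - S dz₂ / z₂`, which is `-V dz + i (dφ + A)`. -/
noncomputable def etaForm (S : ℝ) (l₁ l₂ : ℂ) : ℂ := l₁ - S * l₂

/-- The Gibbons–Hawking metric in terms of the values of `dz₁ / z₁` and `dz₂ / z₂`. -/
noncomputable def logMetric (c : Fin n → ℝ) (p : ℝ × ℝ × ℝ) (l₁ l₂ m₁ m₂ : ℂ) : ℝ :=
  (ghPotential c p)⁻¹ *
      (etaForm (ghSlope c p) l₁ l₂ * (starRingEnd ℂ) (etaForm (ghSlope c p) m₁ m₂)).re +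
    ghPotential c p * horizSq p * (l₂ * (starRingEnd ℂ) m₂).re

/-- Off the axes the smooth tensor `chartMetric` is the Gibbons–Hawking metric. -/
theorem chartMetric_eq_logMetric (hc : StrictMono c) {x : ℂ × ℂ} (h₁ : x.1 ≠ 0) (h₂ : x.2 ≠ 0)
    (v w : ℂ × ℂ) :
    chartMetric c i x v w = logMetric c (position c i x) (logForm₁ i x v) (logForm₂ x v)
      (logForm₁ i x w) (logForm₂ x w) := by
  have hD := (one_add_mul_otherPotential_pos i hc x).ne'
  have hab := (chart_add_pos i hc h₁ h₂).ne'
  have ht := (scale_pos i hc x).ne'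
  have e1 := diagCoef_mul (K := otherSlope c i x) hab hD
  have e2 := diagCoef_mul' (K := otherSlope c i x) hab hD
  have e3 := offCoef_mul (K := otherSlope c i x) hab hD
  rw [← ghPotential_eq i hc] at e1 e2 e3
  have hS := ghSlope_eq i hc h₁ h₂
  have hmod := chartMinus_mul_chartPlus i hc x
  obtain ⟨u₁, hu₁⟩ : ∃ u, u = v.1 / x.1 := ⟨_, rfl⟩
  obtain ⟨u₂, hu₂⟩ : ∃ u, u = v.2 / x.2 := ⟨_, rfl⟩
  obtain ⟨w₁, hw₁⟩ : ∃ u, u = w.1 / x.1 := ⟨_, rfl⟩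
  obtain ⟨w₂, hw₂⟩ : ∃ u, u = w.2 / x.2 := ⟨_, rfl⟩
  have hv1 : v.1 = x.1 * u₁ := by rw [hu₁]; field_simp
  have hv2 : v.2 = x.2 * u₂ := by rw [hu₂]; field_simp
  have hww1 : w.1 = x.1 * w₁ := by rw [hw₁]; field_simp
  have hww2 : w.2 = x.2 * w₂ := by rw [hw₂]; field_simp
  have l1 : logForm₁ i x v = i.val * u₁ + (i.val + 1) * u₂ := by
    rw [logForm₁_apply, hu₁, hu₂]; ring
  have l2 : logForm₂ x v = u₁ + u₂ := by rw [logForm₂_apply, hu₁, hu₂]; ring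
  have m1 : logForm₁ i x w = i.val * w₁ + (i.val + 1) * w₂ := by
    rw [logForm₁_apply, hw₁, hw₂]; ring
  have m2 : logForm₂ x w = w₁ + w₂ := by rw [logForm₂_apply, hw₁, hw₂]; ring
  set P := chartPlus c i x / (chartMinus c i x + chartPlus c i x) +
      chartMinus c i x * chartPlus c i x * otherSlope c i x with hP
  set V := ghPotential c (position c i x) with hV
  have hη : ∀ a b : ℂ, etaForm (ghSlope c (position c i x)) (i.val * a + (i.val + 1) * b) (a + b) =
      -(P : ℂ) * a + (1 - P : ℝ) * b := by
    intro a b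
    rw [etaForm, hS]; push_cast; ring
  rw [logMetric, l1, l2, m1, m2, hη, hη, horizSq_position]
  have hA : Complex.normSq x.1 = chartPlus c i x * scale c i x := by
    unfold chartPlus; field_simp
  have hB : Complex.normSq x.2 = chartMinus c i x / scale c i x := by
    unfold chartMinus; field_simp
  have q1 : metricP c i x * Complex.normSq x.1 = V⁻¹ * P ^ 2 + V * modSq x := by
    rw [hA, metricP, ← hmod, e1]; field_simp
  have q2 : metricQ c i x * Complex.normSq x.2 = V⁻¹ * (1 - P) ^ 2 + V * modSq x := by
    rw [hB, metricQ, ← hmod, e2]; field_simp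
  have q3 : metricM c i x * modSq x = -(V⁻¹ * (P * (1 - P))) + V * modSq x := by
    rw [← hmod, e3, metricM]; ring
  rw [chartMetric, hermForm_apply, hv1, hv2, hww1, hww2, metricS, metricT]
  rw [modSq] at q1 q2 q3 ⊢
  rw [Complex.normSq_apply, Complex.normSq_apply] at q1 q2 q3 ⊢
  simp only [Complex.mul_re, Complex.mul_im, Complex.add_re, Complex.add_im, Complex.neg_re,
    Complex.neg_im, Complex.conj_re, Complex.conj_im, Complex.ofReal_re, Complex.ofReal_im]
  linear_combination (u₁.re * w₁.re + u₁.im * w₁.im) * q1 + (u₂.re * w₂.re + u₂.im * w₂.im) * q2 +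
    (u₁.re * w₂.re + u₁.im * w₂.im + u₂.re * w₁.re + u₂.im * w₁.im) * q3

end OffAxes

/-! ### Kähler metrics of constant volume density are Ricci-flat -/

section Ricci

@[fun_prop]
theorem ContDiff.partialD {f : ℂ × ℂ → ℝ} (hf : ContDiff ℝ ∞ f) (a : Fin 4) :
    ContDiff ℝ ∞ (partialD a f) :=
  (hf.fderiv_right (m := ∞) (by simp)).clm_apply contDiff_const

theorem partialD_comm {f : ℂ × ℂ → ℝ} (hf : ContDiff ℝ ∞ f) (a b : Fin 4) (x : ℂ × ℂ) :
    partialD a (partialD b f) x = partialD b (partialD a f) x := by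
  have hd : DifferentiableAt ℝ (fderiv ℝ f) x :=
    (hf.fderiv_right (m := ∞) (by simp)).differentiable (by simp) x
  have h := hf.contDiffAt.isSymmSndFDerivAt (x := x) (by simp; exact WithTop.coe_le_coe.2 (OrderTop.le_top (2 : ℕ∞)))
  have e : ∀ a b : Fin 4, partialD a (partialD b f) x =
      fderiv ℝ (fderiv ℝ f) x (realBasis a) (realBasis b) := by
    intro a b
    have : partialD b f = fun y => fderiv ℝ f y (realBasis b) := rfl
    rw [partialD, this, fderiv_clm_apply hd (by fun_prop)]
    simp
  rw [e, e, h.eq]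

theorem partialD_neg (a : Fin 4) (f : ℂ × ℂ → ℝ) (x : ℂ × ℂ) :
    partialD a (fun y => -f y) x = -partialD a f x := by
  simp [partialD]

theorem partialD_zero (a : Fin 4) (x : ℂ × ℂ) : partialD a (fun _ => (0 : ℝ)) x = 0 := by
  simp [partialD]

theorem partialD_add (a : Fin 4) {f g : ℂ × ℂ → ℝ} (hf : ContDiff ℝ ∞ f) (hg : ContDiff ℝ ∞ g)
    (x : ℂ × ℂ) : partialD a (fun y => f y + g y) x = partialD a f x + partialD a g x := by
  rw [partialD, fderiv_fun_add (hf.differentiable (by simp) x) (hg.differentiable (by simp) x)]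
  rfl

theorem partialD_sub (a : Fin 4) {f g : ℂ × ℂ → ℝ} (hf : ContDiff ℝ ∞ f) (hg : ContDiff ℝ ∞ g)
    (x : ℂ × ℂ) : partialD a (fun y => f y - g y) x = partialD a f x - partialD a g x := by
  rw [partialD, fderiv_fun_sub (hf.differentiable (by simp) x) (hg.differentiable (by simp) x)]
  rfl

theorem partialD_mul (a : Fin 4) {f g : ℂ × ℂ → ℝ} (hf : ContDiff ℝ ∞ f) (hg : ContDiff ℝ ∞ g)
    (x : ℂ × ℂ) : partialD a (fun y => f y * g y) x =
      partialD a f x * g x + f x * partialD a g x := by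
  rw [partialD, fderiv_fun_mul (hf.differentiable (by simp) x) (hg.differentiable (by simp) x)]
  simp only [add_apply, smul_apply, smul_eq_mul, partialD]
  ring

variable {p q s t : ℂ × ℂ → ℝ}

theorem metricMatrix_hermForm (y : ℂ × ℂ) :
    metricMatrix (fun x => hermForm (p x) (q x) (s x) (t x)) y =
      !![p y, 0, s y, t y; 0, p y, -t y, s y; s y, -t y, q y, 0; t y, s y, 0, q y] := by
  ext a b
  fin_cases a <;> fin_cases b <;>
    simp [metricMatrix, realBasis, hermForm_apply]

theorem metricMatrix_hermForm_inv (y : ℂ × ℂ)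
    (hdet : p y * q y - s y ^ 2 - t y ^ 2 = 1) :
    (metricMatrix (fun x => hermForm (p x) (q x) (s x) (t x)) y)⁻¹ =
      !![q y, 0, -s y, -t y; 0, q y, t y, -s y; -s y, t y, p y, 0; -t y, -s y, 0, p y] := by
  refine Matrix.inv_eq_right_inv ?_
  rw [metricMatrix_hermForm]
  ext a b
  fin_cases a <;> fin_cases b <;>
    simp [Matrix.mul_apply, Fin.sum_univ_four] <;> linarith

/-- The conditions on the coefficients that express that the Kähler form is closed. -/
structure KahlerCoef (p q s t : ℂ × ℂ → ℝ) : Prop where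
  p₂ : ∀ x, partialD 2 p x = partialD 0 s x - partialD 1 t x
  p₃ : ∀ x, partialD 3 p x = partialD 1 s x + partialD 0 t x
  q₀ : ∀ x, partialD 0 q x = partialD 2 s x + partialD 3 t x
  q₁ : ∀ x, partialD 1 q x = partialD 3 s x - partialD 2 t x

/-- The table of the Christoffel symbols of a Kähler metric of constant volume density, in terms of
the complex components `Γ^0_{00} = f₁ + i g₁`, `Γ^1_{00} = f₂ + i g₂`, `Γ^0_{01} = f₃ + i g₃`,
`Γ^0_{11} = f₄ + i g₄`; the other two are determined by the vanishing of the trace. -/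
noncomputable def chrTable (f g : Fin 4 → ℝ) : Fin 4 → Fin 4 → Fin 4 → ℝ :=
  ![![![f 0, -g 0, f 2, -g 2], ![-g 0, -f 0, -g 2, -f 2],
      ![f 2, -g 2, f 3, -g 3], ![-g 2, -f 2, -g 3, -f 3]],
    ![![g 0, f 0, g 2, f 2], ![f 0, -g 0, f 2, -g 2],
      ![g 2, f 2, g 3, f 3], ![f 2, -g 2, f 3, -g 3]],
    ![![f 1, -g 1, -f 0, g 0], ![-g 1, -f 1, g 0, f 0],
      ![-f 0, g 0, -f 2, g 2], ![g 0, f 0, g 2, f 2]],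
    ![![g 1, f 1, -g 0, -f 0], ![f 1, -g 1, -f 0, g 0],
      ![-g 0, -f 0, -g 2, -f 2], ![-f 0, g 0, -f 2, g 2]]]

/-- Real parts of the complex Christoffel symbols. -/
noncomputable def chrRe (p q s t : ℂ × ℂ → ℝ) (m : Fin 4) (x : ℂ × ℂ) : ℝ :=
  1 / 2 * ![q x * partialD 0 p x - s x * (partialD 0 s x + partialD 1 t x) -
        t x * (partialD 0 t x - partialD 1 s x),
      p x * (partialD 0 s x + partialD 1 t x) - s x * partialD 0 p x - t x * partialD 1 p x,
      q x * (partialD 0 s x - partialD 1 t x) - s x * (partialD 2 s x + partialD 3 t x) -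
        t x * (partialD 2 t x - partialD 3 s x),
      q x * (partialD 2 s x - partialD 3 t x) - s x * partialD 2 q x + t x * partialD 3 q x] m

/-- Imaginary parts of the complex Christoffel symbols. -/
noncomputable def chrIm (p q s t : ℂ × ℂ → ℝ) (m : Fin 4) (x : ℂ × ℂ) : ℝ :=
  1 / 2 * ![-(q x * partialD 1 p x) - s x * (partialD 0 t x - partialD 1 s x) +
        t x * (partialD 0 s x + partialD 1 t x),
      p x * (partialD 0 t x - partialD 1 s x) + s x * partialD 1 p x - t x * partialD 0 p x,
      -(q x * (partialD 1 s x + partialD 0 t x)) - s x * (partialD 2 t x - partialD 3 s x) +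
        t x * (partialD 2 s x + partialD 3 t x),
      -(q x * (partialD 3 s x + partialD 2 t x)) + s x * partialD 3 q x + t x * partialD 2 q x] m

/-- The derivatives of the constant determinant vanish. -/
theorem partialD_det (hp : ContDiff ℝ ∞ p) (hq : ContDiff ℝ ∞ q) (hs : ContDiff ℝ ∞ s)
    (ht : ContDiff ℝ ∞ t) (hdet : ∀ x, p x * q x - s x ^ 2 - t x ^ 2 = 1) (a : Fin 4)
    (x : ℂ × ℂ) :
    partialD a p x * q x + p x * partialD a q x - 2 * s x * partialD a s x -
      2 * t x * partialD a t x = 0 := by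
  have h : partialD a (fun y => p y * q y - s y * s y - t y * t y) x = 0 := by
    have : (fun y => p y * q y - s y * s y - t y * t y) = fun _ => 1 := by
      funext y; rw [← hdet y]; ring
    rw [this]; simp [partialD]
  rw [partialD_sub a ((hp.mul hq).sub (hs.mul hs)) (ht.mul ht),
    partialD_sub a (hp.mul hq) (hs.mul hs), partialD_mul a hp hq, partialD_mul a hs hs,
    partialD_mul a ht ht] at h
  linear_combination h

theorem partialD_partialD_det (hp : ContDiff ℝ ∞ p) (hq : ContDiff ℝ ∞ q) (hs : ContDiff ℝ ∞ s)
    (ht : ContDiff ℝ ∞ t) (hdet : ∀ x, p x * q x - s x ^ 2 - t x ^ 2 = 1) (a b : Fin 4)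
    (x : ℂ × ℂ) :
    partialD b (partialD a p) x * q x + partialD a p x * partialD b q x +
      (partialD b p x * partialD a q x + p x * partialD b (partialD a q) x) -
      2 * (partialD b s x * partialD a s x + s x * partialD b (partialD a s) x) -
      2 * (partialD b t x * partialD a t x + t x * partialD b (partialD a t) x) = 0 := by
  have h : partialD b (fun y => partialD a p y * q y + p y * partialD a q y -
      (s y * partialD a s y + s y * partialD a s y) -
      (t y * partialD a t y + t y * partialD a t y)) x = 0 := by
    have : (fun y => partialD a p y * q y + p y * partialD a q y -
      (s y * partialD a s y + s y * partialD a s y) -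
      (t y * partialD a t y + t y * partialD a t y)) = fun _ => 0 := by
      funext y; linear_combination partialD_det hp hq hs ht hdet a y
    rw [this, partialD_zero]
  have hp' := hp.partialD a
  have hq' := hq.partialD a
  have hs' := hs.mul (hs.partialD a)
  have ht' := ht.mul (ht.partialD a)
  rw [partialD_sub b (((hp'.mul hq).add (hp.mul hq')).sub (hs'.add hs')) (ht'.add ht'),
    partialD_sub b ((hp'.mul hq).add (hp.mul hq')) (hs'.add hs'),
    partialD_add b (hp'.mul hq) (hp.mul hq'), partialD_add b hs' hs', partialD_add b ht' ht',
    partialD_mul b hp' hq, partialD_mul b hp hq', partialD_mul b hs (hs.partialD a),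
    partialD_mul b ht (ht.partialD a)] at h
  linear_combination h

set_option maxHeartbeats 1000000 in
/-- In complex coordinates the only nonzero Christoffel symbols of a Kähler metric, up to conjugation,
are the entries of `∂_a H` times the inverse of the Hermitian matrix `H` of the metric. For determinant `1` their traces vanish, which gives the entries that `chrTable`
expresses through the others. -/
theorem christoffel_hermForm (hp : ContDiff ℝ ∞ p) (hq : ContDiff ℝ ∞ q) (hs : ContDiff ℝ ∞ s)
    (ht : ContDiff ℝ ∞ t) (hdet : ∀ x, p x * q x - s x ^ 2 - t x ^ 2 = 1)
    (hK : KahlerCoef p q s t) (k a b : Fin 4) (y : ℂ × ℂ) :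
    christoffel (fun x => hermForm (p x) (q x) (s x) (t x)) k a b y =
      chrTable (fun m => chrRe p q s t m y) (fun m => chrIm p q s t m y) k a b := by
  have d0 := partialD_det hp hq hs ht hdet 0 y
  have d1 := partialD_det hp hq hs ht hdet 1 y
  have d2 := partialD_det hp hq hs ht hdet 2 y
  have d3 := partialD_det hp hq hs ht hdet 3 y
  rw [hK.q₀] at d0
  rw [hK.q₁] at d1
  rw [hK.p₂] at d2
  rw [hK.p₃] at d3
  rw [christoffel, metricMatrix_hermForm_inv y (hdet y)]
  simp only [metricMatrix_hermForm]
  fin_cases k <;> fin_cases a <;> fin_cases b <;>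
    simp [Fin.sum_univ_four, partialD_neg, partialD_zero, chrTable, chrRe, chrIm, hK.p₂, hK.p₃,
      hK.q₀, hK.q₁] <;>
    first
    | ring1
    | linear_combination (1 / 2 : ℝ) * d0
    | linear_combination (-1 / 2 : ℝ) * d0
    | linear_combination d0
    | linear_combination -d0
    | linear_combination (1 / 2 : ℝ) * d1
    | linear_combination (-1 / 2 : ℝ) * d1
    | linear_combination d1
    | linear_combination -d1
    | linear_combination (1 / 2 : ℝ) * d2
    | linear_combination (-1 / 2 : ℝ) * d2
    | linear_combination d2
    | linear_combination -d2
    | linear_combination (1 / 2 : ℝ) * d3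
    | linear_combination (-1 / 2 : ℝ) * d3
    | linear_combination d3

theorem partialD_const_mul (a : Fin 4) (r : ℝ) {f : ℂ × ℂ → ℝ} (hf : ContDiff ℝ ∞ f)
    (x : ℂ × ℂ) : partialD a (fun y => r * f y) x = r * partialD a f x := by
  rw [partialD, fderiv_const_mul (hf.differentiable (by simp) x)]
  rfl

/-- The contracted curvature identities behind the vanishing of the Ricci tensor.  With `δ = 1` the
determinant of the metric, they express the components of the Ricci tensor through `∂_a ∂_b δ`,
`∂_a δ ∂_b δ` and `δ - 1`. -/
theorem chr_identities (hp : ContDiff ℝ ∞ p) (hq : ContDiff ℝ ∞ q) (hs : ContDiff ℝ ∞ s)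
    (ht : ContDiff ℝ ∞ t) (hdet : ∀ x, p x * q x - s x ^ 2 - t x ^ 2 = 1)
    (hK : KahlerCoef p q s t) (x : ℂ × ℂ) :
    partialD 0 (chrRe p q s t 0) x + partialD 1 (chrIm p q s t 0) x + partialD 2 (chrRe p q s t 1) x + partialD 3 (chrIm p q s t 1) x -
      4 * ((chrRe p q s t 0 x * chrRe p q s t 0 x - chrIm p q s t 0 x * chrIm p q s t 0 x) + (chrRe p q s t 1 x * chrRe p q s t 2 x - chrIm p q s t 1 x * chrIm p q s t 2 x)) = 0 ∧
    -partialD 0 (chrIm p q s t 0) x + partialD 1 (chrRe p q s t 0) x - partialD 2 (chrIm p q s t 1) x + partialD 3 (chrRe p q s t 1) x +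
      4 * ((chrRe p q s t 0 x * chrIm p q s t 0 x + chrIm p q s t 0 x * chrRe p q s t 0 x) + (chrRe p q s t 1 x * chrIm p q s t 2 x + chrIm p q s t 1 x * chrRe p q s t 2 x)) = 0 ∧
    partialD 0 (chrRe p q s t 2) x + partialD 1 (chrIm p q s t 2) x - partialD 2 (chrRe p q s t 0) x - partialD 3 (chrIm p q s t 0) x -
      2 * ((chrRe p q s t 0 x * chrRe p q s t 2 x - chrIm p q s t 0 x * chrIm p q s t 2 x) + (chrRe p q s t 1 x * chrRe p q s t 3 x - chrIm p q s t 1 x * chrIm p q s t 3 x)) = 0 ∧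
    -partialD 0 (chrIm p q s t 2) x + partialD 1 (chrRe p q s t 2) x + partialD 2 (chrIm p q s t 0) x - partialD 3 (chrRe p q s t 0) x +
      2 * ((chrRe p q s t 0 x * chrIm p q s t 2 x + chrIm p q s t 0 x * chrRe p q s t 2 x) + (chrRe p q s t 1 x * chrIm p q s t 3 x + chrIm p q s t 1 x * chrRe p q s t 3 x)) = 0 ∧
    partialD 0 (chrRe p q s t 3) x + partialD 1 (chrIm p q s t 3) x - partialD 2 (chrRe p q s t 2) x - partialD 3 (chrIm p q s t 2) x -
      4 * ((chrRe p q s t 2 x * chrRe p q s t 2 x - chrIm p q s t 2 x * chrIm p q s t 2 x) - (chrRe p q s t 0 x * chrRe p q s t 3 x - chrIm p q s t 0 x * chrIm p q s t 3 x)) = 0 ∧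
    -partialD 0 (chrIm p q s t 3) x + partialD 1 (chrRe p q s t 3) x + partialD 2 (chrIm p q s t 2) x - partialD 3 (chrRe p q s t 2) x +
      4 * ((chrRe p q s t 2 x * chrIm p q s t 2 x + chrIm p q s t 2 x * chrRe p q s t 2 x) - (chrRe p q s t 0 x * chrIm p q s t 3 x + chrIm p q s t 0 x * chrRe p q s t 3 x)) = 0 := by
  have e0 : chrRe p q s t 0 = fun x => 1 / 2 *
      (q x * partialD 0 p x - s x * (partialD 0 s x + partialD 1 t x) -
        t x * (partialD 0 t x - partialD 1 s x)) := rfl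
  have e1 : chrRe p q s t 1 = fun x => 1 / 2 *
      (p x * (partialD 0 s x + partialD 1 t x) - s x * partialD 0 p x - t x * partialD 1 p x) := rfl
  have e2 : chrRe p q s t 2 = fun x => 1 / 2 *
      (q x * (partialD 0 s x - partialD 1 t x) - s x * (partialD 2 s x + partialD 3 t x) -
        t x * (partialD 2 t x - partialD 3 s x)) := rfl
  have e3 : chrRe p q s t 3 = fun x => 1 / 2 *
      (q x * (partialD 2 s x - partialD 3 t x) - s x * partialD 2 q x + t x * partialD 3 q x) := rfl
  have f0 : chrIm p q s t 0 = fun x => 1 / 2 *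
      (-(q x * partialD 1 p x) - s x * (partialD 0 t x - partialD 1 s x) +
        t x * (partialD 0 s x + partialD 1 t x)) := rfl
  have f1 : chrIm p q s t 1 = fun x => 1 / 2 *
      (p x * (partialD 0 t x - partialD 1 s x) + s x * partialD 1 p x - t x * partialD 0 p x) := rfl
  have f2 : chrIm p q s t 2 = fun x => 1 / 2 *
      (-(q x * (partialD 1 s x + partialD 0 t x)) - s x * (partialD 2 t x - partialD 3 s x) +
        t x * (partialD 2 s x + partialD 3 t x)) := rfl
  have f3 : chrIm p q s t 3 = fun x => 1 / 2 *
      (-(q x * (partialD 3 s x + partialD 2 t x)) + s x * partialD 3 q x + t x * partialD 2 q x) :=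
    rfl
  have dd := fun a b => partialD_partialD_det hp hq hs ht hdet a b x
  have d00 := dd 0 0
  have d01 := dd 0 1
  have d11 := dd 1 1
  have t0 := partialD_det hp hq hs ht hdet 0 x
  have t1 := partialD_det hp hq hs ht hdet 1 x
  have t2 := partialD_det hp hq hs ht hdet 2 x
  have t3 := partialD_det hp hq hs ht hdet 3 x
  have p2 : partialD 2 p = fun x => partialD 0 s x - partialD 1 t x := funext hK.p₂
  have p3 : partialD 3 p = fun x => partialD 1 s x + partialD 0 t x := funext hK.p₃
  have q0 : partialD 0 q = fun x => partialD 2 s x + partialD 3 t x := funext hK.q₀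
  have q1 : partialD 1 q = fun x => partialD 3 s x - partialD 2 t x := funext hK.q₁
  have cp := fun a b => partialD_comm hp a b x
  have cq := fun a b => partialD_comm hq a b x
  have cs := fun a b => partialD_comm hs a b x
  have ct := fun a b => partialD_comm ht a b x
  -- the identity `∂₂ ∂₃ p = ∂₃ ∂₂ p`, in which the first derivatives have been replaced by those of
  -- `s` and `t`
  have hr := cp 2 3
  simp (disch := fun_prop) only [p2, p3, partialD_add, partialD_sub, cs 3 0, cs 2 1, ct 2 0,
    ct 3 1] at hr
  simp (disch := fun_prop) only [e0, e1, e2, e3, f0, f1, f2, f3, partialD_const_mul, partialD_add,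
    partialD_sub, partialD_mul, partialD_neg, cp 2 0, cp 2 1, cp 3 0, cp 3 1, cp 1 0, cq 0 2,
    cq 1 2, cq 0 3, cq 1 3, p2, p3, q0, q1, cs 1 0, cs 2 0, cs 3 0, cs 2 1, cs 3 1,
    cs 3 2, ct 1 0, ct 2 0, ct 3 0, ct 2 1, ct 3 1, ct 3 2]
    at d00 d01 d11 t0 t1 t2 t3 ⊢
  -- the terms quadratic in first derivatives have constant coefficients in `∂_a ∂_b δ`, but ones
  -- quadratic in `p`, `q`, `s`, `t` in the products of Christoffel symbols; `hdet` and the first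
  -- derivatives `t0`, …, `t3` of `δ` account for the difference
  refine ⟨?_, ?_, ?_, ?_, ?_, ?_⟩
  · linear_combination 1 / 2 * d00 - 1 / 2 * d11 + 1 / 2 * (partialD 0 p x * (partialD 2 s x + partialD 3 t x) + (partialD 2 s x + partialD 3 t x) * partialD 0 p x -
      2 * partialD 0 s x * partialD 0 s x - 2 * partialD 0 t x * partialD 0 t x) * hdet x -
      1 / 2 * (partialD 1 p x * (partialD 3 s x - partialD 2 t x) + (partialD 3 s x - partialD 2 t x) * partialD 1 p x -
      2 * partialD 1 s x * partialD 1 s x - 2 * partialD 1 t x * partialD 1 t x) * hdet x -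
      (q x * partialD 0 p x - s x * (partialD 0 s x + partialD 1 t x) -
        t x * (partialD 0 t x - partialD 1 s x)) * t0 -
      (-(q x * partialD 1 p x) - s x * (partialD 0 t x - partialD 1 s x) +
        t x * (partialD 0 s x + partialD 1 t x)) * t1
  · linear_combination d01 + (partialD 0 p x * (partialD 3 s x - partialD 2 t x) + (partialD 2 s x + partialD 3 t x) * partialD 1 p x -
      2 * partialD 0 s x * partialD 1 s x - 2 * partialD 0 t x * partialD 1 t x) * hdet x +
      (-(q x * partialD 1 p x) - s x * (partialD 0 t x - partialD 1 s x) +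
        t x * (partialD 0 s x + partialD 1 t x)) * t0 -
      (q x * partialD 0 p x - s x * (partialD 0 s x + partialD 1 t x) -
        t x * (partialD 0 t x - partialD 1 s x)) * t1 - 1 / 2 * p x * hr
  · linear_combination 1 / 2 * (partialD 0 p x * partialD 2 q x + (partialD 2 s x + partialD 3 t x) * (partialD 0 s x - partialD 1 t x) -
      2 * partialD 0 s x * partialD 2 s x - 2 * partialD 0 t x * partialD 2 t x) * hdet x -
      1 / 2 * (partialD 1 p x * partialD 3 q x + (partialD 3 s x - partialD 2 t x) * (partialD 1 s x + partialD 0 t x) -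
      2 * partialD 1 s x * partialD 3 s x - 2 * partialD 1 t x * partialD 3 t x) * hdet x -
      1 / 2 * (q x * partialD 0 p x - s x * (partialD 0 s x + partialD 1 t x) -
        t x * (partialD 0 t x - partialD 1 s x)) * t2 -
      1 / 2 * (-(q x * partialD 1 p x) - s x * (partialD 0 t x - partialD 1 s x) +
        t x * (partialD 0 s x + partialD 1 t x)) * t3
  · linear_combination 1 / 2 * (partialD 0 p x * partialD 3 q x + (partialD 2 s x + partialD 3 t x) * (partialD 1 s x + partialD 0 t x) -
      2 * partialD 0 s x * partialD 3 s x - 2 * partialD 0 t x * partialD 3 t x) * hdet x +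
      1 / 2 * (partialD 1 p x * partialD 2 q x + (partialD 3 s x - partialD 2 t x) * (partialD 0 s x - partialD 1 t x) -
      2 * partialD 1 s x * partialD 2 s x - 2 * partialD 1 t x * partialD 2 t x) * hdet x +
      1 / 2 * (-(q x * partialD 1 p x) - s x * (partialD 0 t x - partialD 1 s x) +
        t x * (partialD 0 s x + partialD 1 t x)) * t2 -
      1 / 2 * (q x * partialD 0 p x - s x * (partialD 0 s x + partialD 1 t x) -
        t x * (partialD 0 t x - partialD 1 s x)) * t3
  · linear_combination 1 / 2 * ((partialD 0 s x - partialD 1 t x) * partialD 2 q x + partialD 2 q x * (partialD 0 s x - partialD 1 t x) -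
      2 * partialD 2 s x * partialD 2 s x - 2 * partialD 2 t x * partialD 2 t x) * hdet x -
      1 / 2 * ((partialD 1 s x + partialD 0 t x) * partialD 3 q x + partialD 3 q x * (partialD 1 s x + partialD 0 t x) -
      2 * partialD 3 s x * partialD 3 s x - 2 * partialD 3 t x * partialD 3 t x) * hdet x +
      (q x * (partialD 2 s x - partialD 3 t x) - s x * partialD 2 q x + t x * partialD 3 q x) * t0 +
      (-(q x * (partialD 3 s x + partialD 2 t x)) + s x * partialD 3 q x + t x * partialD 2 q x) * t1 -
      (q x * (partialD 0 s x - partialD 1 t x) - s x * (partialD 2 s x + partialD 3 t x) -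
        t x * (partialD 2 t x - partialD 3 s x)) * t2 -
      (-(q x * (partialD 1 s x + partialD 0 t x)) - s x * (partialD 2 t x - partialD 3 s x) +
        t x * (partialD 2 s x + partialD 3 t x)) * t3
  · linear_combination ((partialD 0 s x - partialD 1 t x) * partialD 3 q x + partialD 2 q x * (partialD 1 s x + partialD 0 t x) -
      2 * partialD 2 s x * partialD 3 s x - 2 * partialD 2 t x * partialD 3 t x) * hdet x -
      (-(q x * (partialD 3 s x + partialD 2 t x)) + s x * partialD 3 q x + t x * partialD 2 q x) * t0 +
      (q x * (partialD 2 s x - partialD 3 t x) - s x * partialD 2 q x + t x * partialD 3 q x) * t1 +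
      (-(q x * (partialD 1 s x + partialD 0 t x)) - s x * (partialD 2 t x - partialD 3 s x) +
        t x * (partialD 2 s x + partialD 3 t x)) * t2 -
      (q x * (partialD 0 s x - partialD 1 t x) - s x * (partialD 2 s x + partialD 3 t x) -
        t x * (partialD 2 t x - partialD 3 s x)) * t3

/-- In complex coordinates the Ricci tensor of a Kähler metric is `-∂_a ∂bar_b log det g`, which vanishes
for constant determinant. -/
theorem ricci_hermForm (hp : ContDiff ℝ ∞ p) (hq : ContDiff ℝ ∞ q) (hs : ContDiff ℝ ∞ s)
    (ht : ContDiff ℝ ∞ t) (hdet : ∀ x, p x * q x - s x ^ 2 - t x ^ 2 = 1)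
    (hK : KahlerCoef p q s t) (a b : Fin 4) (x : ℂ × ℂ) :
    ricci (fun x => hermForm (p x) (q x) (s x) (t x)) a b x = 0 := by
  have hΓ : ∀ k a b, christoffel (fun x => hermForm (p x) (q x) (s x) (t x)) k a b =
      fun y => chrTable (fun m => chrRe p q s t m y) (fun m => chrIm p q s t m y) k a b :=
    fun k a b => funext (christoffel_hermForm hp hq hs ht hdet hK k a b)
  obtain ⟨h1, h2, h3, h4, h5, h6⟩ := chr_identities hp hq hs ht hdet hK x
  simp only [ricci, hΓ]
  have heta : ∀ (a m : Fin 4), partialD a (fun y => chrRe p q s t m y) x =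
      partialD a (chrRe p q s t m) x := fun _ _ => rfl
  have heta' : ∀ (a m : Fin 4), partialD a (fun y => chrIm p q s t m y) x =
      partialD a (chrIm p q s t m) x := fun _ _ => rfl
  fin_cases a <;> fin_cases b <;>
    simp only [Fin.sum_univ_four, chrTable, partialD_neg, heta, heta', Fin.zero_eta, Fin.mk_one,
      Fin.reduceFinMk, Matrix.cons_val]
  · linear_combination h1
  · linear_combination h2
  · linear_combination h3
  · linear_combination h4
  · linear_combination h2
  · linear_combination -h1
  · linear_combination h4
  · linear_combination -h3
  · linear_combination h3
  · linear_combination h4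
  · linear_combination h5
  · linear_combination h6
  · linear_combination h4
  · linear_combination -h3
  · linear_combination h6
  · linear_combination -h5

end Ricci

/-! ### The moment map and the Kähler form in a chart -/

section Moment

variable {n : ℕ} {c : Fin n → ℝ} (i : Fin n)

/-- The second component of the moment map in the chart of index `i`; the first one is `-height`. -/
noncomputable def moment₂ (c : Fin n → ℝ) (i : Fin n) (x : ℂ × ℂ) : ℝ :=
  1 / 2 * ∑ j, rPlus (modSq x) (height c i x - c j)

theorem mu_position (x : ℂ × ℂ) : mu c (position c i x) = (-height c i x, moment₂ c i x) := by
  refine Prod.ext rfl ?_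
  simp only [mu, moment₂, rad_add_eq, horizSq_position]
  rfl

theorem contDiff_moment₂ (hc : StrictMono c) : ContDiff ℝ ∞ (moment₂ c i) := by
  refine contDiff_const.mul (ContDiff.sum fun j _ => ?_)
  by_cases hj : j = i
  · subst hj
    simp only [rPlus_height_self _ hc]
    exact contDiff_chartPlus j hc
  · exact contDiff_iff_contDiffAt.2 fun x => ContDiffAt.rPlus contDiff_modSq.contDiffAt
      ((contDiff_height i hc).sub contDiff_const).contDiffAt (radicand_height_pos i hc hj x)

theorem fderiv_moment₂ (hc : StrictMono c) {x : ℂ × ℂ} (h₁ : x.1 ≠ 0) (h₂ : x.2 ≠ 0)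
    (v : ℂ × ℂ) :
    fderiv ℝ (moment₂ c i) x v =
      ghPotential c (position c i x) * modSq x * (logForm₂ x v).re +
        ghSlope c (position c i x) * fderiv ℝ (height c i) x v := by
  have hR := modSq_pos h₁ h₂
  have hj : ∀ j : Fin n, ∃ L : (ℂ × ℂ) →L[ℝ] ℝ,
      HasFDerivAt (fun y => rPlus (modSq y) (height c i y - c j)) L x ∧
      L v = 1 / Real.sqrt (modSq x + (height c i x - c j) ^ 2) * (modSq x * (logForm₂ x v).re) +
        rPlus (modSq x) (height c i x - c j) / Real.sqrt (modSq x + (height c i x - c j) ^ 2) *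
          fderiv ℝ (height c i) x v := by
    intro j
    have hz := (differentiableAt_height i hc x).hasFDerivAt.sub_const (c j)
    have hs := sqrt_pos_off_axes h₁ h₂ (height c i x - c j)
    refine ⟨_, ((hasFDerivAt_modSq h₁ h₂).sqrt_add_sq hz (by positivity)).fun_add hz, ?_⟩
    simp only [add_apply, smul_apply, smul_eq_mul, ContinuousLinearMap.comp_apply,
      Complex.reCLM_apply, rPlus]
    field_simp
    ring
  choose L hL hLv using hj
  have d := (HasFDerivAt.fun_sum (u := Finset.univ) fun j _ => hL j).const_mul (1 / 2 : ℝ)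
  have e : fderiv ℝ (moment₂ c i) x = _ := d.fderiv
  rw [e, ghPotential_position, ghSlope_position]
  simp only [smul_apply, sum_apply, hLv, smul_eq_mul, Finset.sum_add_distrib, ← Finset.sum_mul]
  ring

theorem fderiv_height (hc : StrictMono c) {x : ℂ × ℂ} (h₁ : x.1 ≠ 0) (h₂ : x.2 ≠ 0)
    (v : ℂ × ℂ) :
    fderiv ℝ (height c i) x v = (ghPotential c (position c i x))⁻¹ *
      (ghSlope c (position c i x) * (logForm₂ x v).re - (logForm₁ i x v).re) := by
  rw [← potential_mul_fderiv_height i hc h₁ h₂ v,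
    inv_mul_cancel_left₀ (ghPotential_pos i hc h₁ h₂).ne']

/-- The form `df ∧ θ`. -/
noncomputable def wedge (f : ℂ × ℂ → ℝ) (θ : ℂ × ℂ → ℂ × ℂ → ℝ) (x v w : ℂ × ℂ) : ℝ :=
  fderiv ℝ f x v * θ x w - fderiv ℝ f x w * θ x v

/-- Off the axes the Kähler form is `dμ₁ ∧ Im (dz₁ / z₁) + dμ₂ ∧ Im (dz₂ / z₂)`, i.e. the moments
and the arguments of `z₁` and `z₂` are action-angle coordinates. -/
theorem fundamentalForm_eq_wedge (hc : StrictMono c) {x : ℂ × ℂ} (h₁ : x.1 ≠ 0) (h₂ : x.2 ≠ 0)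
    (v w : ℂ × ℂ) :
    fundamentalForm (chartMetric c i) x v w =
      wedge (fun y => -height c i y) (fun y u => (logForm₁ i y u).im) x v w +
        wedge (moment₂ c i) (fun y u => (logForm₂ y u).im) x v w := by
  have hV := (ghPotential_pos i hc h₁ h₂).ne'
  rw [fundamentalForm, chartMetric_eq_logMetric i hc h₁ h₂, logForm₁_I, logForm₂_I, wedge, wedge,
    fderiv_fun_neg]
  simp only [neg_apply]
  rw [fderiv_moment₂ i hc h₁ h₂, fderiv_moment₂ i hc h₁ h₂, fderiv_height i hc h₁ h₂,
    fderiv_height i hc h₁ h₂, logMetric, horizSq_position]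
  simp only [etaForm, Complex.mul_re, Complex.mul_im, Complex.sub_re, Complex.sub_im,
    Complex.conj_re, Complex.conj_im, Complex.I_re, Complex.I_im, Complex.ofReal_re,
    Complex.ofReal_im]
  ring

theorem hasFDerivAt_logForm (a b : ℂ) {x : ℂ × ℂ} (h₁ : x.1 ≠ 0) (h₂ : x.2 ≠ 0) (w : ℂ × ℂ) :
    HasFDerivAt (fun y : ℂ × ℂ => a / y.1 * w.1 + b / y.2 * w.2)
      ((-(a / x.1 ^ 2 * w.1) • ContinuousLinearMap.fst ℂ ℂ ℂ +
        -(b / x.2 ^ 2 * w.2) • ContinuousLinearMap.snd ℂ ℂ ℂ).restrictScalars ℝ) x := by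
  have e1 : HasFDerivAt (fun y : ℂ × ℂ => a / y.1 * w.1)
      (-(a / x.1 ^ 2 * w.1) • ContinuousLinearMap.fst ℂ ℂ ℂ) x := by
    have h : HasDerivAt (fun z : ℂ => a / z * w.1) (-(a / x.1 ^ 2 * w.1)) x.1 :=
      (((hasDerivAt_inv h₁).const_mul a).mul_const w.1).congr_deriv (by field_simp)
    exact HasDerivAt.comp_hasFDerivAt (f := fun y : ℂ × ℂ => y.1) x h hasFDerivAt_fst
  have e2 : HasFDerivAt (fun y : ℂ × ℂ => b / y.2 * w.2)
      (-(b / x.2 ^ 2 * w.2) • ContinuousLinearMap.snd ℂ ℂ ℂ) x := by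
    have h : HasDerivAt (fun z : ℂ => b / z * w.2) (-(b / x.2 ^ 2 * w.2)) x.2 :=
      (((hasDerivAt_inv h₂).const_mul b).mul_const w.2).congr_deriv (by field_simp)
    exact HasDerivAt.comp_hasFDerivAt (f := fun y : ℂ × ℂ => y.2) x h hasFDerivAt_snd
  exact (e1.fun_add e2).restrictScalars ℝ

/-- If `θ` is closed, so is `df ∧ θ`. -/
theorem closed_wedge {f : ℂ × ℂ → ℝ} (hf : ContDiff ℝ ∞ f) {θ : ℂ × ℂ → ℂ × ℂ → ℝ}
    {θ' : ℂ × ℂ → (ℂ × ℂ) →L[ℝ] ℝ} {x : ℂ × ℂ}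
    (hθ : ∀ w, HasFDerivAt (fun y => θ y w) (θ' w) x) (hs : ∀ u w, θ' w u = θ' u w) :
    ∃ D : ℂ × ℂ → ℂ × ℂ → (ℂ × ℂ) →L[ℝ] ℝ,
      (∀ v w, HasFDerivAt (fun y => wedge f θ y v w) (D v w) x) ∧
      ∀ u v w, D v w u - D u w v + D u v w = 0 := by
  have hd : HasFDerivAt (fderiv ℝ f) (fderiv ℝ (fderiv ℝ f) x) x :=
    ((hf.fderiv_right (m := ∞) (by simp)).differentiable (by simp) x).hasFDerivAt
  have hsym := hf.contDiffAt.isSymmSndFDerivAt (x := x)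
    (by simp; exact WithTop.coe_le_coe.2 (OrderTop.le_top (2 : ℕ∞)))
  have h1 : ∀ v, HasFDerivAt (fun y => fderiv ℝ f y v)
      ((ContinuousLinearMap.apply ℝ ℝ v).comp (fderiv ℝ (fderiv ℝ f) x)) x :=
    fun v => (ContinuousLinearMap.apply ℝ ℝ v).hasFDerivAt.comp x hd
  refine ⟨_, fun v w => ((h1 v).mul (hθ w)).sub ((h1 w).mul (hθ v)), fun u v w => ?_⟩
  simp only [add_apply, sub_apply, smul_apply, smul_eq_mul, ContinuousLinearMap.comp_apply,
    ContinuousLinearMap.apply_apply]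
  rw [hsym.eq u v, hsym.eq u w, hsym.eq v w, hs u v, hs u w, hs v w]
  ring

/-- Two functions that are continuous at `x` and agree off the axes near `x` agree at `x`. -/
theorem eq_of_eq_off_axes {E : Type*} [TopologicalSpace E] [T2Space E] {f g : ℂ × ℂ → E}
    {x : ℂ × ℂ} (hf : ContinuousAt f x) (hg : ContinuousAt g x)
    (h : ∀ᶠ y in nhds x, y.1 ≠ 0 → y.2 ≠ 0 → f y = g y) : f x = g x :=
  tendsto_nhds_unique_of_frequently_eq hf hg
    (((mem_closure_iff_frequently.1 (dense_off_axes x)).and_eventually h).mono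
      fun _ hy => hy.2 hy.1.1 hy.1.2)

theorem contDiff_fundamentalForm (hc : StrictMono c) (v w : ℂ × ℂ) :
    ContDiff ℝ ∞ fun y => fundamentalForm (chartMetric c i) y v w :=
  ((contDiff_chartMetric i hc).clm_apply contDiff_const).clm_apply contDiff_const

/-- The Kähler form is closed. -/
theorem chartMetric_closed (hc : StrictMono c) (x u v w : ℂ × ℂ) :
    fderiv ℝ (fun y => fundamentalForm (chartMetric c i) y v w) x u -
      fderiv ℝ (fun y => fundamentalForm (chartMetric c i) y u w) x v +
      fderiv ℝ (fun y => fundamentalForm (chartMetric c i) y u v) x w = 0 := by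
  have hcont : ∀ u v w, Continuous fun x =>
      fderiv ℝ (fun y => fundamentalForm (chartMetric c i) y v w) x u := fun u v w =>
    ((contDiff_fundamentalForm i hc v w).continuous_fderiv (by simp)).clm_apply continuous_const
  refine eq_of_eq_off_axes (g := fun _ => (0 : ℝ))
    (f := fun x => fderiv ℝ (fun y => fundamentalForm (chartMetric c i) y v w) x u -
      fderiv ℝ (fun y => fundamentalForm (chartMetric c i) y u w) x v +
      fderiv ℝ (fun y => fundamentalForm (chartMetric c i) y u v) x w)
    (((hcont _ _ _).sub (hcont _ _ _)).add (hcont _ _ _)).continuousAt continuousAt_const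
    (Filter.Eventually.of_forall fun y h₁ h₂ => ?_)
  obtain ⟨D₁, hD₁, hc₁⟩ := closed_wedge (contDiff_height i hc).neg
    (θ := fun y u => (logForm₁ i y u).im) (x := y)
    (fun w => Complex.imCLM.hasFDerivAt.comp y (hasFDerivAt_logForm i.val (i.val + 1) h₁ h₂ w)) fun u w => by
      simp only [ContinuousLinearMap.comp_apply, ContinuousLinearMap.coe_restrictScalars',
        add_apply, smul_apply, ContinuousLinearMap.coe_fst', ContinuousLinearMap.coe_snd',
        smul_eq_mul]
      congr 1; ring
  obtain ⟨D₂, hD₂, hc₂⟩ := closed_wedge (contDiff_moment₂ i hc)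
    (θ := fun y u => (logForm₂ y u).im) (x := y)
    (fun w => Complex.imCLM.hasFDerivAt.comp y (hasFDerivAt_logForm 1 1 h₁ h₂ w)) fun u w => by
      simp only [ContinuousLinearMap.comp_apply, ContinuousLinearMap.coe_restrictScalars',
        add_apply, smul_apply, ContinuousLinearMap.coe_fst', ContinuousLinearMap.coe_snd',
        smul_eq_mul]
      congr 1; ring
  have e : ∀ v w, fderiv ℝ (fun y => fundamentalForm (chartMetric c i) y v w) y =
      D₁ v w + D₂ v w := fun v w => by
    refine (((hD₁ v w).fun_add (hD₂ v w)).congr_of_eventuallyEq ?_).fderiv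
    filter_upwards [isOpen_off_axes.mem_nhds ⟨h₁, h₂⟩] with z hz
    exact fundamentalForm_eq_wedge i hc hz.1 hz.2 v w
  simp only [e, add_apply]
  linear_combination hc₁ u v w + hc₂ u v w

theorem kahlerCoef_chartMetric (hc : StrictMono c) :
    KahlerCoef (metricP c i) (metricQ c i) (metricS c i) (metricT c i) := by
  have hω : ∀ v w : ℂ × ℂ, (fun y => fundamentalForm (chartMetric c i) y v w) = fun y =>
      hermForm (metricP c i y) (metricQ c i y) (metricS c i y) (metricT c i y)
        (Complex.I • v) w := fun _ _ => rfl
  have h : ∀ a b d : Fin 4, _ := fun a b d x =>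
    chartMetric_closed i hc x (realBasis a) (realBasis b) (realBasis d)
  simp only [hω, hermForm_apply] at h
  constructor <;> intro x
  · have := h 0 1 2 x
    simp [realBasis] at this
    simp only [partialD, realBasis]
    simp
    linarith
  · have := h 0 1 3 x
    simp [realBasis] at this
    simp only [partialD, realBasis]
    simp
    linarith
  · have := h 0 2 3 x
    simp [realBasis] at this
    simp only [partialD, realBasis]
    simp
    linarith
  · have := h 1 2 3 x
    simp [realBasis] at this
    simp only [partialD, realBasis]
    simp
    linarith

theorem isRicciFlat_chartMetric (hc : StrictMono c) : IsRicciFlat n (chartMetric c) :=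
  fun i a b x => ricci_hermForm (contDiff_metricP i hc) (contDiff_metricQ i hc)
    (contDiff_metricS i hc) (contDiff_metricT i hc) (metric_det i hc)
    (kahlerCoef_chartMetric i hc) a b x

end Moment

/-! ### The Kähler structure on the glued surface -/

section Kahler

variable {n : ℕ} {c : Fin n → ℝ} (i : Fin n)

theorem continuousAt_bilin {F : Type*} [TopologicalSpace F] {x : F}
    {g : F → (ℂ × ℂ) →L[ℝ] (ℂ × ℂ) →L[ℝ] ℝ} {v w : F → ℂ × ℂ} (hg : ContinuousAt g x)
    (hv : ContinuousAt v x) (hw : ContinuousAt w x) : ContinuousAt (fun y => g y (v y) (w y)) x :=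
  (hg.clm_apply hv).clm_apply hw

theorem contDiffAt_chartTransition {x : ℂ × ℂ} (h : x.1 ≠ 0) :
    ContDiffAt ℂ ∞ chartTransition x := by
  unfold chartTransition
  fun_prop (disch := assumption)

theorem fderiv_chartTransition {x : ℂ × ℂ} (h : x.1 ≠ 0) (v : ℂ × ℂ) :
    fderiv ℝ chartTransition x v =
      (2 * x.1 * x.2 * v.1 + x.1 ^ 2 * v.2, -(v.1 / x.1 ^ 2)) := by
  have h1 : HasFDerivAt (fun y : ℂ × ℂ => y.1 ^ 2 * y.2) _ x :=
    ((hasFDerivAt_fst (𝕜 := ℂ) (E := ℂ) (F := ℂ) (p := x)).pow 2).mul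
      (hasFDerivAt_snd (𝕜 := ℂ) (E := ℂ) (F := ℂ) (p := x))
  have h2 : HasFDerivAt (fun y : ℂ × ℂ => y.1⁻¹) _ x :=
    HasDerivAt.comp_hasFDerivAt (f := fun y : ℂ × ℂ => y.1) x (hasDerivAt_inv h)
      (hasFDerivAt_fst (𝕜 := ℂ) (E := ℂ) (F := ℂ) (p := x))
  have h3 : HasFDerivAt chartTransition _ x := (h1.prodMk h2).restrictScalars ℝ
  rw [h3.fderiv]
  ext
  · simp; ring
  · simp; ring

/-- The metrics in consecutive charts agree: off the axes both are expressed through `dz₁ / z₁` and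
`dz₂ / z₂`. -/
theorem chartMetric_transition (hc : StrictMono c) {i j : Fin n} (hij : i.val + 1 = j.val)
    {x : ℂ × ℂ} (hx : x.1 ≠ 0) (v w : ℂ × ℂ) :
    chartMetric c j (chartTransition x) (fderiv ℝ chartTransition x v)
      (fderiv ℝ chartTransition x w) = chartMetric c i x v w := by
  have hsm : ContDiffAt ℝ ∞ chartTransition x := (contDiffAt_chartTransition hx).restrict_scalars ℝ
  have hd : ContinuousAt (fderiv ℝ chartTransition) x :=
    (hsm.fderiv_right (m := ∞) (by simp)).continuousAt
  refine eq_of_eq_off_axes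
    (f := fun x => chartMetric c j (chartTransition x) (fderiv ℝ chartTransition x v)
      (fderiv ℝ chartTransition x w)) (g := fun x => chartMetric c i x v w)
    (continuousAt_bilin ((contDiff_chartMetric j hc).continuous.continuousAt.comp hsm.continuousAt)
      (hd.clm_apply continuousAt_const) (hd.clm_apply continuousAt_const))
    (continuousAt_bilin (contDiff_chartMetric i hc).continuous.continuousAt continuousAt_const
      continuousAt_const) (Filter.Eventually.of_forall fun y h₁ h₂ => ?_)
  have e₁ : ∀ u, logForm₁ j (chartTransition y) (fderiv ℝ chartTransition y u) =
      logForm₁ i y u := by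
    intro u
    rw [fderiv_chartTransition h₁, logForm₁_apply, logForm₁_apply, ← hij]
    simp only [chartTransition]
    push_cast
    field_simp
    ring
  have e₂ : ∀ u, logForm₂ (chartTransition y) (fderiv ℝ chartTransition y u) =
      logForm₂ y u := by
    intro u
    rw [fderiv_chartTransition h₁, logForm₂_apply, logForm₂_apply]
    simp only [chartTransition]
    field_simp
    ring
  rw [chartMetric_eq_logMetric j hc, chartMetric_eq_logMetric i hc h₁ h₂, e₁, e₁, e₂, e₂,
    position_transition hc hij h₁]
  · exact mul_ne_zero (pow_ne_zero _ h₁) h₂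
  · exact inv_ne_zero h₁

theorem isKahlerMetric_chartMetric (hc : StrictMono c) : IsKahlerMetric n (chartMetric c) where
  smooth := fun i => contDiff_chartMetric i hc
  compatible := fun _ _ hij _ hx v w => chartMetric_transition hc hij hx v w
  symm := fun _ _ v w => hermForm_symm _ _ _ _ v w
  pos := fun i x _ hv => hermForm_pos (metricP_pos i hc x) (metric_det i hc x) hv
  hermitian := fun _ _ v w => hermForm_I _ _ _ _ v w
  closed := fun i x u v w => chartMetric_closed i hc x u v w

theorem hasDerivAt_circle_exp : HasDerivAt (fun t : ℝ => (Circle.exp t : ℂ)) Complex.I 0 := by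
  have h : HasDerivAt (fun t : ℝ => Complex.exp (t * Complex.I))
      (Complex.exp ((0 : ℝ) * Complex.I) * (1 * Complex.I)) 0 :=
    ((Complex.ofRealCLM.hasDerivAt (x := 0)).mul_const Complex.I).cexp
  simpa [Circle.coe_exp] using h

theorem torusField₁_eq (i : ℕ) (x : ℂ × ℂ) :
    torusField₁ i x = (-Complex.I * x.1, Complex.I * x.2) := by
  have h := hasDerivAt_circle_exp
  have h1 : HasDerivAt (fun t : ℝ => (1 : ℂ) ^ (i + 1) * (Circle.exp t : ℂ)⁻¹ * x.1)
      (-Complex.I * x.1) 0 := by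
    have := ((h.inv (by simp)).const_mul ((1 : ℂ) ^ (i + 1))).mul_const x.1
    simpa using this
  have h2 : HasDerivAt (fun t : ℝ => (Circle.exp t : ℂ) * ((1 : ℂ) ^ i)⁻¹ * x.2)
      (Complex.I * x.2) 0 := by
    have := (h.mul_const (((1 : ℂ) ^ i)⁻¹)).mul_const x.2
    simpa using this
  exact (h1.prodMk h2).deriv

theorem torusField₂_eq (i : ℕ) (x : ℂ × ℂ) :
    torusField₂ i x = ((i + 1) * Complex.I * x.1, -(i * Complex.I) * x.2) := by
  have h := hasDerivAt_circle_exp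
  have h1 : HasDerivAt (fun t : ℝ => (Circle.exp t : ℂ) ^ (i + 1) * (1 : ℂ)⁻¹ * x.1)
      ((i + 1) * Complex.I * x.1) 0 := by
    have := ((h.pow (i + 1)).mul_const ((1 : ℂ)⁻¹)).mul_const x.1
    simpa using this
  have h2 : HasDerivAt (fun t : ℝ => 1 * ((Circle.exp t : ℂ) ^ i)⁻¹ * x.2)
      (-(i * Complex.I) * x.2) 0 := by
    have := (((h.pow i).inv (by simp)).const_mul (1 : ℂ)).mul_const x.2
    simpa using this
  exact (h1.prodMk h2).deriv

/-- The generators of the torus action take the values `(i, 0)` and `(0, i)` on `(dz₁ / z₁, dz₂ / z₂)`,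
and the moments are constant along them, so the contraction of `fundamentalForm_eq_wedge` with them
gives the differentials of the moments. -/
theorem moment_eq (hc : StrictMono c) (x v : ℂ × ℂ) :
    -fderiv ℝ (height c i) x v = -fundamentalForm (chartMetric c i) x (torusField₁ i x) v ∧
      fderiv ℝ (moment₂ c i) x v =
        -fundamentalForm (chartMetric c i) x (torusField₂ i x) v := by
  have hg := (contDiff_chartMetric i hc).continuous
  have hfc : ∀ X : ℂ × ℂ → ℂ × ℂ, Continuous X → Continuous fun x =>
      -fundamentalForm (chartMetric c i) x (X x) v := fun X hX =>
    ((hg.clm_apply (hX.const_smul Complex.I)).clm_apply continuous_const).neg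
  have hz := ((contDiff_height i hc).continuous_fderiv (by simp)).clm_apply
    (continuous_const (y := v))
  have hm := ((contDiff_moment₂ i hc).continuous_fderiv (by simp)).clm_apply
    (continuous_const (y := v))
  simp only [torusField₁_eq, torusField₂_eq]
  constructor
  · refine eq_of_eq_off_axes (f := fun x => -fderiv ℝ (height c i) x v)
      (g := fun x => -fundamentalForm (chartMetric c i) x (-Complex.I * x.1, Complex.I * x.2) v)
      hz.neg.continuousAt
      (hfc (fun x => (-Complex.I * x.1, Complex.I * x.2)) (by fun_prop)).continuousAt
      (Filter.Eventually.of_forall fun y h₁ h₂ => ?_)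
    have e₁ : logForm₁ i y (-Complex.I * y.1, Complex.I * y.2) = Complex.I := by
      rw [logForm₁_apply]; field_simp; ring
    have e₂ : logForm₂ y (-Complex.I * y.1, Complex.I * y.2) = 0 := by
      rw [logForm₂_apply]; field_simp; ring
    rw [fundamentalForm_eq_wedge i hc h₁ h₂, wedge, wedge, fderiv_fun_neg]
    simp only [neg_apply, e₁, e₂]
    have dz := fderiv_height i hc h₁ h₂ (-Complex.I * y.1, Complex.I * y.2)
    have dm := fderiv_moment₂ i hc h₁ h₂ (-Complex.I * y.1, Complex.I * y.2)
    rw [e₁, e₂] at dz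
    rw [e₂, dz] at dm
    rw [dz, dm]
    simp
  · refine eq_of_eq_off_axes (f := fun x => fderiv ℝ (moment₂ c i) x v)
      (g := fun x => -fundamentalForm (chartMetric c i) x
        ((i.val + 1) * Complex.I * x.1, -(i.val * Complex.I) * x.2) v)
      hm.continuousAt
      (hfc (fun x => ((i.val + 1) * Complex.I * x.1, -(i.val * Complex.I) * x.2))
        (by fun_prop)).continuousAt
      (Filter.Eventually.of_forall fun y h₁ h₂ => ?_)
    have e₁ : logForm₁ i y ((i.val + 1) * Complex.I * y.1, -(i.val * Complex.I) * y.2) = 0 := by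
      rw [logForm₁_apply]; field_simp; ring
    have e₂ : logForm₂ y ((i.val + 1) * Complex.I * y.1, -(i.val * Complex.I) * y.2) =
        Complex.I := by
      rw [logForm₂_apply]; field_simp; ring
    rw [fundamentalForm_eq_wedge i hc h₁ h₂, wedge, wedge, fderiv_fun_neg]
    simp only [neg_apply, e₁, e₂]
    have dz := fderiv_height i hc h₁ h₂ ((i.val + 1) * Complex.I * y.1, -(i.val * Complex.I) * y.2)
    have dm := fderiv_moment₂ i hc h₁ h₂ ((i.val + 1) * Complex.I * y.1, -(i.val * Complex.I) * y.2)
    rw [e₁, e₂] at dz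
    rw [e₂, dz] at dm
    rw [dz, dm]
    simp

theorem mu_proj (hc : StrictMono c) (hn : 1 ≤ n) (i : Fin n) (x : ℂ × ℂ) :
    mu c (GHSpace.proj c (ghHomeomorph hc hn (GluedSurface.incl i x))) =
      (-height c i x, moment₂ c i x) := by
  rw [ghHomeomorph_incl, proj_chartMap, mu_position]

theorem isMomentMap_mu (hc : StrictMono c) (hn : 1 ≤ n) :
    IsMomentMap n (chartMetric c) fun y => mu c (GHSpace.proj c (ghHomeomorph hc hn y)) := by
  intro i
  simp only [mu_proj hc hn]
  refine ⟨(contDiff_height i hc).neg.prodMk (contDiff_moment₂ i hc), fun x v => ?_⟩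
  have h := ((differentiableAt_height i hc x).hasFDerivAt.fun_neg).prodMk
    ((contDiff_moment₂ i hc).differentiable (by simp) x).hasFDerivAt
  rw [h.fderiv]
  exact Prod.ext (moment_eq i hc x v).1 (moment_eq i hc x v).2

end Kahler

/-! ### The Kähler potential -/

section Potential

variable {n : ℕ} {c : Fin n → ℝ} (i : Fin n)

/-- The Kähler potential in the chart of index `i`. -/
noncomputable def chartPotential (c : Fin n → ℝ) (i : Fin n) (x : ℂ × ℂ) : ℝ :=
  -(∑ j, c j * Real.log (rMinus (modSq x) (height c i x - c j))) + n * -height c i x +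
    2 * moment₂ c i x

theorem kahlerPotential_position (x : ℂ × ℂ) :
    kahlerPotential c n 2 (position c i x) = chartPotential c i x := by
  simp only [kahlerPotential, mu_position, rad_sub_eq, horizSq_position]
  rfl

theorem contDiffAt_chartPotential (hc : StrictMono c) {x : ℂ × ℂ}
    (hx : ∀ j, 0 < rMinus (modSq x) (height c i x - c j)) :
    ContDiffAt ℝ ∞ (chartPotential c i) x := by
  refine ((ContDiffAt.sum fun j _ => contDiffAt_const.mul (ContDiffAt.log ?_ (hx j).ne')).neg.add
    (contDiffAt_const.mul (contDiff_height i hc).contDiffAt.neg)).add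
    (contDiffAt_const.mul (contDiff_moment₂ i hc).contDiffAt)
  exact ContDiffAt.rMinus contDiff_modSq.contDiffAt
    ((contDiff_height i hc).sub contDiff_const).contDiffAt
    (sqrt_pos_of_rMinus_pos (modSq_nonneg x) (hx j))

/-- Off the axes, `dψ = 2 μ₁ Re (dz₁ / z₁) + 2 μ₂ Re (dz₂ / z₂)`: the potential is the Legendre
transform of a symplectic potential. -/
theorem hasFDerivAt_chartPotential (hc : StrictMono c) {x : ℂ × ℂ} (h₁ : x.1 ≠ 0)
    (h₂ : x.2 ≠ 0) :
    ∃ L : (ℂ × ℂ) →L[ℝ] ℝ, HasFDerivAt (chartPotential c i) L x ∧ ∀ v,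
      L v = (2 * (-height c i x * logForm₁ i x v + moment₂ c i x * logForm₂ x v)).re := by
  have hR := modSq_pos h₁ h₂
  choose L hL hLv using fderiv_log_rMinus i hc h₁ h₂
  have d1 := (HasFDerivAt.fun_sum (u := Finset.univ) fun j _ => (hL j).const_mul (c j)).fun_neg
  have d2 := (differentiableAt_height i hc x).hasFDerivAt.fun_neg.const_mul (n : ℝ)
  have d3 := ((contDiff_moment₂ i hc).differentiable (by simp) x).hasFDerivAt.const_mul (2 : ℝ)
  refine ⟨_, (d1.fun_add d2).fun_add d3, fun v => ?_⟩
  have hre : (2 * (-height c i x * logForm₁ i x v + moment₂ c i x * logForm₂ x v)).re =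
      2 * (-height c i x * (logForm₁ i x v).re + moment₂ c i x * (logForm₂ x v).re) := by
    simp
  have hl : (logForm₁ i x v).re = ghSlope c (position c i x) * (logForm₂ x v).re -
      ghPotential c (position c i x) * fderiv ℝ (height c i) x v := by
    rw [potential_mul_fderiv_height i hc h₁ h₂]; ring
  rw [hre, hl]
  simp only [add_apply, neg_apply, smul_apply, sum_apply, hLv, smul_eq_mul,
    fderiv_moment₂ i hc h₁ h₂]
  rw [ghPotential_position, ghSlope_position, moment₂]
  generalize (logForm₂ x v).re = a
  generalize fderiv ℝ (height c i) x v = b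
  have hn : (n : ℝ) = ∑ _j : Fin n, (1 : ℝ) := by simp
  rw [hn]
  have key : (∑ j : Fin n, (-(c j * (rPlus (modSq x) (height c i x - c j) /
          Real.sqrt (modSq x + (height c i x - c j) ^ 2) * a -
        1 / Real.sqrt (modSq x + (height c i x - c j) ^ 2) * b)) - 1 * b +
      1 / Real.sqrt (modSq x + (height c i x - c j) ^ 2) * (modSq x * a) +
      rPlus (modSq x) (height c i x - c j) /
          Real.sqrt (modSq x + (height c i x - c j) ^ 2) * b)) =
      ∑ j : Fin n, (rPlus (modSq x) (height c i x - c j) /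
          Real.sqrt (modSq x + (height c i x - c j) ^ 2) * (-height c i x * a) +
        1 / Real.sqrt (modSq x + (height c i x - c j) ^ 2) * (height c i x * b) +
        rPlus (modSq x) (height c i x - c j) * a) := by
    refine Finset.sum_congr rfl fun j _ => ?_
    have hs := sqrt_pos_off_axes h₁ h₂ (height c i x - c j)
    have e := rMinus_mul_rPlus hR.le (height c i x - c j)
    obtain ⟨r, hr⟩ : ∃ r, r = Real.sqrt (modSq x + (height c i x - c j) ^ 2) := ⟨_, rfl⟩
    have hp : rPlus (modSq x) (height c i x - c j) = r + (height c i x - c j) := by rw [hr]; rfl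
    have hm : rMinus (modSq x) (height c i x - c j) = r - (height c i x - c j) := by rw [hr]; rfl
    rw [hm, hp] at e
    rw [← hr] at hs ⊢
    rw [hp, ← e]
    field_simp
    ring
  simp only [Finset.sum_add_distrib, Finset.sum_sub_distrib, Finset.sum_neg_distrib,
    ← Finset.sum_mul] at key
  linear_combination key

theorem wirtinger_contDiffAt {f : ℂ × ℂ → ℂ} {x : ℂ × ℂ} (hf : ContDiffAt ℝ ∞ f x) (a : Fin 2) :
    ContDiffAt ℝ ∞ (wirtinger a f) x := by
  have h := hf.fderiv_right (m := ∞) (by simp)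
  exact ((h.clm_apply contDiffAt_const).sub
    (contDiffAt_const.mul (h.clm_apply contDiffAt_const))).div_const 2

theorem wirtingerBar_contDiffAt {f : ℂ × ℂ → ℂ} {x : ℂ × ℂ} (hf : ContDiffAt ℝ ∞ f x)
    (a : Fin 2) : ContDiffAt ℝ ∞ (wirtingerBar a f) x := by
  have h := hf.fderiv_right (m := ∞) (by simp)
  exact ((h.clm_apply contDiffAt_const).add
    (contDiffAt_const.mul (h.clm_apply contDiffAt_const))).div_const 2

theorem continuousAt_iDDbar {f : ℂ × ℂ → ℝ} {x : ℂ × ℂ} (hf : ContDiffAt ℝ ∞ f x)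
    (v w : ℂ × ℂ) : ContinuousAt (fun y => iDDbar f y v w) x := by
  have h : ContDiffAt ℝ ∞ (fun y => (f y : ℂ)) x := Complex.ofRealCLM.contDiff.contDiffAt.comp x hf
  refine continuousAt_const.mul (tendsto_finsetSum _ fun a _ => tendsto_finsetSum _ fun b _ => ?_)
  exact (wirtinger_contDiffAt (wirtingerBar_contDiffAt h b) a).continuousAt.mul continuousAt_const

/-- If `df = Re λ` with `λ` complex linear, then `∂bar_b f = conj (λ e_b) / 2`. -/
theorem wirtingerBar_of_re {f : ℂ × ℂ → ℝ} {x : ℂ × ℂ} {L : (ℂ × ℂ) →L[ℝ] ℝ}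
    (hf : HasFDerivAt f L x) {l : ℂ × ℂ → ℂ} (hL : ∀ v, L v = (l v).re)
    (hl : ∀ v, l (Complex.I • v) = Complex.I * l v) (b : Fin 2) :
    wirtingerBar b (fun y => (f y : ℂ)) x = (starRingEnd ℂ) (l (complexBasis b)) / 2 := by
  have h : HasFDerivAt (fun y => (f y : ℂ)) (Complex.ofRealCLM.comp L) x :=
    Complex.ofRealCLM.hasFDerivAt.comp x hf
  rw [wirtingerBar, h.fderiv]
  simp only [ContinuousLinearMap.comp_apply, Complex.ofRealCLM_apply, hL, hl]
  congr 1
  apply Complex.ext <;> simp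

theorem re_sub_I_mul_re (z : ℂ) :
    (z.re : ℂ) - Complex.I * ((Complex.I * z).re : ℂ) = z := by
  apply Complex.ext <;> simp

theorem ofReal_re_I_mul (z : ℂ) :
    ((Complex.I * z).re : ℂ) = Complex.I / 2 * (z - (starRingEnd ℂ) z) := by
  rw [Complex.sub_conj]
  apply Complex.ext <;> simp

/-- For holomorphic `g`, the product with `conj g` satisfies `∂_a (f conj g) = ∂_a f conj g`. -/
theorem wirtinger_mul_conj {f : ℂ × ℂ → ℝ} {g : ℂ × ℂ → ℂ} {x : ℂ × ℂ} {L : (ℂ × ℂ) →L[ℝ] ℝ}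
    {G : (ℂ × ℂ) →L[ℝ] ℂ} {l : ℂ × ℂ → ℂ} (hf : HasFDerivAt f L x) (hL : ∀ v, L v = (l v).re)
    (hl : ∀ v, l (Complex.I • v) = Complex.I * l v) (hg : HasFDerivAt g G x)
    (hG : ∀ v, G (Complex.I • v) = Complex.I * G v) (a : Fin 2) :
    DifferentiableAt ℝ (fun y => (f y : ℂ) * (starRingEnd ℂ) (g y)) x ∧
      wirtinger a (fun y => (f y : ℂ) * (starRingEnd ℂ) (g y)) x =
        l (complexBasis a) / 2 * (starRingEnd ℂ) (g x) := by
  have h1 : HasFDerivAt (fun y => (f y : ℂ)) (Complex.ofRealCLM.comp L) x :=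
    Complex.ofRealCLM.hasFDerivAt.comp x hf
  have h2 : HasFDerivAt (fun y => (starRingEnd ℂ) (g y))
      ((Complex.conjCLE : ℂ →L[ℝ] ℂ).comp G) x :=
    (Complex.conjCLE : ℂ →L[ℝ] ℂ).hasFDerivAt.comp x hg
  have h := h1.mul h2
  refine ⟨h.differentiableAt, ?_⟩
  have e := re_sub_I_mul_re (l (complexBasis a))
  rw [wirtinger, HasFDerivAt.fderiv (f := fun y => (f y : ℂ) * (starRingEnd ℂ) (g y)) h]
  simp only [add_apply, smul_apply, ContinuousLinearMap.comp_apply, Complex.ofRealCLM_apply, hL,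
    hl, hG, smul_eq_mul, ContinuousLinearEquiv.coe_coe, Complex.conjCLE_apply, map_mul,
    Complex.conj_I]
  linear_combination (starRingEnd ℂ) (g x) / 2 * e +
    f x * (starRingEnd ℂ) (G (complexBasis a)) / 2 * Complex.I_mul_I

/-- As `∂bar ψ = μ₁ conj (dz₁ / z₁) + μ₂ conj (dz₂ / z₂)`, the form `i ∂ ∂bar ψ` is expressed through
`∂μ₁` and `∂μ₂`, which in turn are combinations of `dz₁ / z₁` and `dz₂ / z₂`. -/
theorem iDDbar_chartPotential_off_axes (hc : StrictMono c) {x : ℂ × ℂ} (h₁ : x.1 ≠ 0)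
    (h₂ : x.2 ≠ 0) (v w : ℂ × ℂ) :
    (fundamentalForm (chartMetric c i) x v w : ℂ) = iDDbar (chartPotential c i) x v w := by
  set V := ghPotential c (position c i x) with hV
  set S := ghSlope c (position c i x) with hS
  have hbar : ∀ b, wirtingerBar b (fun y => (chartPotential c i y : ℂ)) =ᶠ[nhds x] fun y =>
      (-height c i y : ℝ) * (starRingEnd ℂ) (logForm₁ i y (complexBasis b)) +
        (moment₂ c i y : ℝ) * (starRingEnd ℂ) (logForm₂ y (complexBasis b)) := by
    intro b
    filter_upwards [isOpen_off_axes.mem_nhds ⟨h₁, h₂⟩] with y hy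
    obtain ⟨L, hL, hLv⟩ := hasFDerivAt_chartPotential i hc hy.1 hy.2
    rw [wirtingerBar_of_re hL hLv (fun v => by rw [logForm₁_I, logForm₂_I]; ring)]
    simp only [map_mul, map_add, Complex.conj_ofReal, map_ofNat, map_neg]
    push_cast
    ring
  have hM₁ : ∀ u, fderiv ℝ (fun y => -height c i y) x u =
      ((V : ℂ)⁻¹ * (logForm₁ i x u - S * logForm₂ x u)).re := by
    intro u
    rw [fderiv_fun_neg, neg_apply, fderiv_height i hc h₁ h₂, ← Complex.ofReal_inv,
      Complex.re_ofReal_mul, Complex.sub_re, Complex.re_ofReal_mul]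
    ring
  have hM₂ : ∀ u, fderiv ℝ (moment₂ c i) x u =
      (V * modSq x * logForm₂ x u -
        S * ((V : ℂ)⁻¹ * (logForm₁ i x u - S * logForm₂ x u))).re := by
    intro u
    rw [Complex.sub_re, Complex.re_ofReal_mul, ← hM₁, fderiv_moment₂ i hc h₁ h₂,
      ← Complex.ofReal_mul, Complex.re_ofReal_mul, fderiv_fun_neg, neg_apply]
    ring
  have hI : ∀ (a b : ℂ) (v : ℂ × ℂ),
      ((a • ContinuousLinearMap.fst ℂ ℂ ℂ + b • ContinuousLinearMap.snd ℂ ℂ ℂ).restrictScalars ℝ)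
        (Complex.I • v) = Complex.I * ((a • ContinuousLinearMap.fst ℂ ℂ ℂ +
          b • ContinuousLinearMap.snd ℂ ℂ ℂ).restrictScalars ℝ) v := fun a b v =>
    map_smul (a • ContinuousLinearMap.fst ℂ ℂ ℂ + b • ContinuousLinearMap.snd ℂ ℂ ℂ) _ v
  have hw : ∀ a b, wirtinger a (wirtingerBar b fun y => (chartPotential c i y : ℂ)) x =
      (V : ℂ)⁻¹ * (logForm₁ i x (complexBasis a) - S * logForm₂ x (complexBasis a)) / 2 *
        (starRingEnd ℂ) (logForm₁ i x (complexBasis b)) +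
      (V * modSq x * logForm₂ x (complexBasis a) -
        S * ((V : ℂ)⁻¹ * (logForm₁ i x (complexBasis a) -
          S * logForm₂ x (complexBasis a)))) / 2 *
        (starRingEnd ℂ) (logForm₂ x (complexBasis b)) := by
    intro a b
    obtain ⟨d₁, w₁⟩ := wirtinger_mul_conj (differentiableAt_height i hc x).fun_neg.hasFDerivAt hM₁
      (fun v => by rw [logForm₁_I, logForm₂_I]; ring)
      (hasFDerivAt_logForm i.val (i.val + 1) h₁ h₂ (complexBasis b)) (hI _ _) a
    obtain ⟨d₂, w₂⟩ := wirtinger_mul_conj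
      ((contDiff_moment₂ i hc).differentiable (by simp) x).hasFDerivAt hM₂
      (fun v => by rw [logForm₁_I, logForm₂_I]; ring)
      (hasFDerivAt_logForm 1 1 h₁ h₂ (complexBasis b)) (hI _ _) a
    have hadd := fderiv_fun_add d₁ d₂
    simp only [← logForm₁_apply, ← logForm₂_apply] at hadd w₁ w₂
    rw [← w₁, ← w₂]
    simp only [wirtinger]
    rw [(hbar b).fderiv_eq, hadd]
    simp only [add_apply]
    ring
  have hv : ∀ u : ℂ × ℂ, logForm₁ i x u = logForm₁ i x (complexBasis 0) * u.1 +
      logForm₁ i x (complexBasis 1) * u.2 := fun u => by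
    simp [logForm₁_apply, complexBasis]
  have hv' : ∀ u : ℂ × ℂ, logForm₂ x u = logForm₂ x (complexBasis 0) * u.1 +
      logForm₂ x (complexBasis 1) * u.2 := fun u => by
    simp [logForm₂_apply, complexBasis]
  have hZ : fundamentalForm (chartMetric c i) x v w = (Complex.I *
      ((V : ℂ)⁻¹ * (etaForm S (logForm₁ i x v) (logForm₂ x v) *
        (starRingEnd ℂ) (etaForm S (logForm₁ i x w) (logForm₂ x w))) +
      V * modSq x * (logForm₂ x v * (starRingEnd ℂ) (logForm₂ x w)))).re := by
    rw [fundamentalForm, chartMetric_eq_logMetric i hc h₁ h₂, logMetric, logForm₁_I, logForm₂_I,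
      horizSq_position, ← Complex.re_ofReal_mul, ← Complex.re_ofReal_mul, ← Complex.add_re]
    congr 1
    simp only [etaForm, ← hV, ← hS]
    push_cast
    ring
  rw [hZ, ofReal_re_I_mul, iDDbar]
  simp only [Fin.sum_univ_two, hw, coords, Matrix.cons_val_zero, Matrix.cons_val_one, etaForm]
  rw [hv v, hv w, hv' v, hv' w]
  simp only [map_add, map_mul, map_sub, map_inv₀, Complex.conj_ofReal, Complex.conj_conj]
  ring

/-- The metric has the stated Kähler potential wherever all `r_j - (z - c_j)` are positive. -/
theorem fundamentalForm_eq_iDDbar (hc : StrictMono c) {x : ℂ × ℂ}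
    (hx : ∀ j, 0 < rMinus (modSq x) (height c i x - c j)) (v w : ℂ × ℂ) :
    (fundamentalForm (chartMetric c i) x v w : ℂ) = iDDbar (chartPotential c i) x v w :=
  eq_of_eq_off_axes (f := fun x => (fundamentalForm (chartMetric c i) x v w : ℂ))
    (g := fun x => iDDbar (chartPotential c i) x v w)
    (Complex.continuous_ofReal.comp (contDiff_fundamentalForm i hc v w).continuous).continuousAt
    (continuousAt_iDDbar (contDiffAt_chartPotential i hc hx) v w)
    (Filter.Eventually.of_forall fun _ h₁ h₂ => iDDbar_chartPotential_off_axes i hc h₁ h₂ v w)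

theorem exists_kahlerPotential (hc : StrictMono c) (hn : 1 ≤ n) :
    ∃ C₁ C₂ : ℝ, ∀ (i : Fin n) (x : ℂ × ℂ),
      (∀ j, 0 < rad c j (GHSpace.proj c (ghHomeomorph hc hn (GluedSurface.incl i x))) -
        ((GHSpace.proj c (ghHomeomorph hc hn (GluedSurface.incl i x))).2.2 - c j)) →
      ContDiffAt ℝ ∞ (fun y => kahlerPotential c C₁ C₂
        (GHSpace.proj c (ghHomeomorph hc hn (GluedSurface.incl i y)))) x ∧
      ∀ v w, (fundamentalForm (chartMetric c i) x v w : ℂ) = iDDbar (fun y =>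
        kahlerPotential c C₁ C₂
          (GHSpace.proj c (ghHomeomorph hc hn (GluedSurface.incl i y)))) x v w := by
  refine ⟨n, 2, fun i x hx => ?_⟩
  simp only [ghHomeomorph_incl, proj_chartMap, kahlerPotential_position, rad_sub_eq,
    horizSq_position] at hx ⊢
  exact ⟨contDiffAt_chartPotential i hc hx, fundamentalForm_eq_iDDbar i hc hx⟩

end Potential

/-! ### The Gibbons–Hawking metric in the charts -/

section LogDeriv

variable {E : Type*} [NormedAddCommGroup E] [NormedSpace ℝ E] {f g : E → ℂ} {l m : E →L[ℝ] ℂ}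
  {x : E}

/-- At `x`, the complex-valued function `f` does not vanish and has the logarithmic derivative
`l`. -/
def HasLogDerivAt (f : E → ℂ) (l : E →L[ℝ] ℂ) (x : E) : Prop :=
  f x ≠ 0 ∧ HasFDerivAt f (f x • l) x

theorem HasFDerivAt.hasLogDerivAt (hf : HasFDerivAt f l x) (h : f x ≠ 0) :
    HasLogDerivAt f ((f x)⁻¹ • l) x :=
  ⟨h, by rwa [smul_smul, mul_inv_cancel₀ h, one_smul]⟩

theorem HasLogDerivAt.mul (hf : HasLogDerivAt f l x) (hg : HasLogDerivAt g m x) :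
    HasLogDerivAt (fun y => f y * g y) (l + m) x := by
  refine ⟨mul_ne_zero hf.1 hg.1, (hf.2.mul hg.2).congr_fderiv ?_⟩
  ext v
  simp only [add_apply, smul_apply, smul_eq_mul]
  ring

theorem HasLogDerivAt.zpow (hf : HasLogDerivAt f l x) (k : ℤ) :
    HasLogDerivAt (fun y => f y ^ k) ((k : ℂ) • l) x := by
  refine ⟨zpow_ne_zero k hf.1, ((((hasDerivAt_zpow k (f x) (Or.inl hf.1)).hasFDerivAt).restrictScalars
    ℝ).comp x hf.2).congr_fderiv ?_⟩
  ext v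
  simp only [smul_apply, smul_eq_mul, ContinuousLinearMap.comp_apply,
    ContinuousLinearMap.coe_restrictScalars', ContinuousLinearMap.toSpanSingleton_apply]
  rw [zpow_sub_one₀ hf.1]
  have := hf.1
  field_simp

theorem HasLogDerivAt.inv (hf : HasLogDerivAt f l x) :
    HasLogDerivAt (fun y => (f y)⁻¹) (-l) x := by
  have h := hf.zpow (-1)
  have e : ((-1 : ℤ) : ℂ) • l = -l := by
    ext v
    simp
  simpa only [zpow_neg_one, e] using h

end LogDeriv

section Patches

variable {n : ℕ} {c : Fin n → ℝ} {k : Fin (n + 1)}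

theorem rPlus_pos_of_mem_patch {p : ℝ × ℝ × ℝ} (hp : p ∈ patch c k) {j : Fin n}
    (hj : j.val < k.val) : 0 < rPlus (horizSq p) (p.2.2 - c j) := by
  rw [rPlus_pos_iff (horizSq_nonneg p), sub_pos]
  exact (loProd_pos_iff c _ (horizSq_nonneg p) _).1 ((mem_patch_iff k p).1 hp).1 j hj

theorem rMinus_pos_of_mem_patch {p : ℝ × ℝ × ℝ} (hp : p ∈ patch c k) {j : Fin n}
    (hj : ¬ j.val < k.val) : 0 < rMinus (horizSq p) (p.2.2 - c j) := by
  rw [rMinus_pos_iff (horizSq_nonneg p), sub_neg]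
  exact (hiProd_pos_iff c _ (horizSq_nonneg p) _).1 ((mem_patch_iff k p).1 hp).2 j (not_lt.1 hj)

theorem radicand_pos_of_mem_patch {p : ℝ × ℝ × ℝ} (hp : p ∈ patch c k) (j : Fin n) :
    0 < horizSq p + (p.2.2 - c j) ^ 2 := by
  by_cases hj : j.val < k.val
  · exact sqrt_pos_of_rPlus_pos (horizSq_nonneg p) (rPlus_pos_of_mem_patch hp hj)
  · exact sqrt_pos_of_rMinus_pos (horizSq_nonneg p) (rMinus_pos_of_mem_patch hp hj)

theorem rad_pos_of_mem_patch {p : ℝ × ℝ × ℝ} (hp : p ∈ patch c k) (j : Fin n) :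
    0 < rad c j p := by
  rw [rad_eq]; exact Real.sqrt_pos.2 (radicand_pos_of_mem_patch hp j)

theorem contDiff_horiz : ContDiff ℝ ∞ horiz := by
  have : horiz = fun p : ℝ × ℝ × ℝ => Complex.ofRealCLM p.1 + Complex.ofRealCLM p.2.1 * Complex.I := by
    funext p
    apply Complex.ext <;> simp [horiz]
  rw [this]
  exact (Complex.ofRealCLM.contDiff.comp contDiff_fst).add
    ((Complex.ofRealCLM.contDiff.comp (contDiff_fst.comp contDiff_snd)).mul contDiff_const)

theorem contDiff_horizSq : ContDiff ℝ ∞ horizSq := contDiff_normSq.comp contDiff_horiz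

theorem contDiffAt_loProd {p : ℝ × ℝ × ℝ} (hp : p ∈ patch c k) :
    ContDiffAt ℝ ∞ (fun p : ℝ × ℝ × ℝ => loProd c k (horizSq p) p.2.2) p := by
  unfold loProd
  refine contDiffAt_prod fun j _ => ?_
  by_cases hj : j.val < k.val
  · simp only [hj, if_true]
    exact contDiff_horizSq.contDiffAt.rPlus (contDiffAt_snd.snd.sub contDiffAt_const)
      (radicand_pos_of_mem_patch hp j)
  · simp only [hj, if_false]
    exact contDiffAt_const

theorem contDiffAt_hiProd {p : ℝ × ℝ × ℝ} (hp : p ∈ patch c k) :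
    ContDiffAt ℝ ∞ (fun p : ℝ × ℝ × ℝ => hiProd c k (horizSq p) p.2.2) p := by
  unfold hiProd
  refine contDiffAt_prod fun j _ => ?_
  by_cases hj : j.val < k.val
  · simp only [hj, if_true]
    exact contDiffAt_const
  · simp only [hj, if_false]
    exact contDiff_horizSq.contDiffAt.rMinus (contDiffAt_snd.snd.sub contDiffAt_const)
      (radicand_pos_of_mem_patch hp j)

/-- The modulus of the fibre coordinate over a patch is smooth. -/
theorem contDiffAt_patchModulus {p : ℝ × ℝ × ℝ} (hp : p ∈ patch c k) :
    ContDiffAt ℝ ∞ (fun p : ℝ × ℝ × ℝ =>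
      Real.sqrt (hiProd c k (horizSq p) p.2.2 / loProd c k (horizSq p) p.2.2)) p := by
  obtain ⟨h1, h2⟩ := (mem_patch_iff k p).1 hp
  exact ((contDiffAt_hiProd hp).div (contDiffAt_loProd hp) h1.ne').sqrt (div_pos h2 h1).ne'

/-- The fibre coordinate over a patch as a function of `(φ, x, y, z)`. -/
noncomputable def fibreCoord (c : Fin n → ℝ) (k : Fin (n + 1)) (q : ℝ × ℝ × ℝ × ℝ) : ℂ :=
  patchCoord c k q.2 (Circle.exp q.1)

/-- The coordinates `(α_i, β_i)` as functions of `(φ, x, y, z)`. -/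
noncomputable def ghCoord (c : Fin n → ℝ) (i : Fin n) (k : Fin (n + 1)) (q : ℝ × ℝ × ℝ × ℝ) :
    ℂ × ℂ :=
  chartCoord c i k q.2 (Circle.exp q.1)

theorem fibreCoord_eq (q : ℝ × ℝ × ℝ × ℝ) : fibreCoord c k q =
    ((Real.sqrt (hiProd c k (horizSq q.2) q.2.2.2 / loProd c k (horizSq q.2) q.2.2.2) : ℝ) : ℂ) *
      Complex.exp (q.1 * Complex.I) := by
  rw [fibreCoord, patchCoord, Circle.coe_exp]

theorem contDiffAt_fibreCoord {q : ℝ × ℝ × ℝ × ℝ} (hq : q.2 ∈ patch c k) :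
    ContDiffAt ℝ ∞ (fibreCoord c k) q := by
  rw [funext fibreCoord_eq]
  refine (Complex.ofRealCLM.contDiff.contDiffAt.comp q
    ((contDiffAt_patchModulus hq).comp q contDiffAt_snd)).mul ?_
  exact ((Complex.ofRealCLM.contDiff.comp contDiff_fst).mul contDiff_const).contDiffAt.cexp

theorem fibreCoord_ne_zero {q : ℝ × ℝ × ℝ × ℝ} (hq : q.2 ∈ patch c k) : fibreCoord c k q ≠ 0 :=
  patchCoord_ne_zero hq _

theorem contDiffAt_horiz_zpow {q : ℝ × ℝ × ℝ × ℝ} {m : ℤ} (h : horiz q.2 ≠ 0 ∨ 0 ≤ m) :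
    ContDiffAt ℝ ∞ (fun q : ℝ × ℝ × ℝ × ℝ => horiz q.2 ^ m) q := by
  have hh : ContDiffAt ℝ ∞ (fun q : ℝ × ℝ × ℝ × ℝ => horiz q.2) q :=
    (contDiff_horiz.comp contDiff_snd).contDiffAt
  obtain ⟨d, rfl | rfl⟩ := m.eq_nat_or_neg
  · simp only [zpow_natCast]
    exact hh.pow d
  · rcases h with h | h
    · simp only [zpow_neg, zpow_natCast]
      exact (hh.pow d).inv (pow_ne_zero d h)
    · obtain rfl : d = 0 := by omega
      simp only [Nat.cast_zero, neg_zero, zpow_zero]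
      exact contDiffAt_const

theorem contDiffAt_ghCoord {i : Fin n} {q : ℝ × ℝ × ℝ × ℝ} (hq : q.2 ∈ patch c k)
    (hi : InChart i k q.2) : ContDiffAt ℝ ∞ (ghCoord c i k) q :=
  ((contDiffAt_horiz_zpow hi.exponents.1).mul
    ((contDiffAt_fibreCoord hq).inv (fibreCoord_ne_zero hq))).prodMk
    ((contDiffAt_horiz_zpow hi.exponents.2).mul (contDiffAt_fibreCoord hq))

theorem isOpen_inChart_coord (i : Fin n) :
    IsOpen {q : ℝ × ℝ × ℝ × ℝ | q.2 ∈ patch c k ∧ InChart i k q.2} :=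
  ((isOpen_patch k).preimage continuous_snd).inter ((isOpen_inChart i k).preimage continuous_snd)

/-- Off the axis the connection form is `dφ + (k - S) dθ`. -/
theorem connectionForm_eq {p : ℝ × ℝ × ℝ} (hp : horiz p ≠ 0) (v : ℝ × ℝ × ℝ × ℝ) :
    connectionForm c k p v =
      v.1 + (k.val - ghSlope c p) * ((p.1 * v.2.2.1 - p.2.1 * v.2.1) / horizSq p) := by
  have hR := (horizSq_pos_iff p).2 hp
  have hk : (k.val : ℝ) = ∑ j : Fin n, if j.val < k.val then (1 : ℝ) else 0 := by
    rw [Finset.sum_boole, Fin.card_filter_val_lt, min_eq_right (by omega)]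
  rw [connectionForm, ghSlope, hk, Finset.mul_sum, ← Finset.sum_sub_distrib, Finset.sum_mul]
  congr 1
  refine Finset.sum_congr rfl fun j _ => ?_
  have e := rMinus_mul_rPlus hR.le (p.2.2 - c j)
  have h1 := (rMinus_pos_iff hR.le (p.2.2 - c j)).2 (Or.inl hR)
  have h2 := (rPlus_pos_iff hR.le (p.2.2 - c j)).2 (Or.inl hR)
  have h3 : 2 * rad c j p = rMinus (horizSq p) (p.2.2 - c j) + rPlus (horizSq p) (p.2.2 - c j) := by
    rw [← rad_sub_eq, ← rad_add_eq]; ring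
  have h4 : 0 < rad c j p := by linarith
  rw [rad_sub_eq, rad_add_eq]
  generalize rMinus (horizSq p) (p.2.2 - c j) = a at *
  generalize rPlus (horizSq p) (p.2.2 - c j) = b at *
  obtain rfl : a = 2 * rad c j p - b := by linarith
  rw [← e]
  split_ifs
  · field_simp
  · field_simp
    ring

/-- As `J ∂_z = -V ∂_φ` on horizontal lifts, `(dφ + A) ∘ J = -V dz`. -/
theorem connectionForm_ghJ {p : ℝ × ℝ × ℝ} (v : ℝ × ℝ × ℝ × ℝ) :
    connectionForm c k p (ghJ c k p v) = -(ghPotential c p * v.2.2.2) := by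
  have h : ∀ (a : ℝ) (u : ℝ × ℝ × ℝ), connectionForm c k p (a, u) = a + connectionForm c k p (0, u) :=
    fun a u => by simp [connectionForm]
  have e : ghJ c k p v = (-(ghPotential c p * v.2.2.2) + -connectionForm c k p
      (0, (-v.2.2.1, v.2.1, 1 / ghPotential c p * connectionForm c k p v)),
      (-v.2.2.1, v.2.1, 1 / ghPotential c p * connectionForm c k p v)) := by
    simp [ghJ, horizontalLift]
  rw [e, h]
  ring

end Patches

/-! ### The metric and the complex structure over the patches -/

section GibbonsHawking

variable {n : ℕ} {c : Fin n → ℝ} {i : Fin n} {k : Fin (n + 1)}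

theorem hasLogDerivAt_horiz {q : ℝ × ℝ × ℝ × ℝ} (h : horiz q.2 ≠ 0) :
    ∃ l : (ℝ × ℝ × ℝ × ℝ) →L[ℝ] ℂ, HasLogDerivAt (fun q => horiz q.2) l q ∧
      ∀ v, l v = horiz v.2 / horiz q.2 := by
  let L : (ℝ × ℝ × ℝ × ℝ) →ₗ[ℝ] ℂ :=
    { toFun := fun q => horiz q.2
      map_add' := fun a b => by apply Complex.ext <;> simp [horiz]
      map_smul' := fun t a => by apply Complex.ext <;> simp [horiz] }
  have hL : HasFDerivAt (fun q : ℝ × ℝ × ℝ × ℝ => horiz q.2) (LinearMap.toContinuousLinearMap L) q :=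
    (LinearMap.toContinuousLinearMap L).hasFDerivAt
  exact ⟨_, hL.hasLogDerivAt h, fun v => by
    rw [smul_apply, smul_eq_mul, div_eq_inv_mul]; rfl⟩

theorem hasLogDerivAt_fibreCoord {q : ℝ × ℝ × ℝ × ℝ} (hq : q.2 ∈ patch c k) :
    ∃ l : (ℝ × ℝ × ℝ × ℝ) →L[ℝ] ℂ, HasLogDerivAt (fibreCoord c k) l q ∧
      ∀ v, (l v).im = v.1 := by
  obtain ⟨h1, h2⟩ := (mem_patch_iff k q.2).1 hq
  have hρ := ((contDiffAt_patchModulus hq).comp q contDiffAt_snd).differentiableAt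
    (by simp) |>.hasFDerivAt
  have hρ0 : (0 : ℝ) < Real.sqrt (hiProd c k (horizSq q.2) q.2.2.2 /
      loProd c k (horizSq q.2) q.2.2.2) := Real.sqrt_pos.2 (div_pos h2 h1)
  have hl := HasFDerivAt.hasLogDerivAt (Complex.ofRealCLM.hasFDerivAt.comp q hρ)
    (Complex.ofReal_ne_zero.2 hρ0.ne')
  have he : HasLogDerivAt (fun q : ℝ × ℝ × ℝ × ℝ => Complex.exp (q.1 * Complex.I))
      (Complex.I • Complex.ofRealCLM.comp (ContinuousLinearMap.fst ℝ ℝ (ℝ × ℝ × ℝ))) q := by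
    refine ⟨Complex.exp_ne_zero _, ?_⟩
    have h : HasFDerivAt (fun q : ℝ × ℝ × ℝ × ℝ => (q.1 : ℂ))
        (Complex.ofRealCLM.comp (ContinuousLinearMap.fst ℝ ℝ (ℝ × ℝ × ℝ))) q :=
      (Complex.ofRealCLM.comp (ContinuousLinearMap.fst ℝ ℝ (ℝ × ℝ × ℝ))).hasFDerivAt
    exact (h.mul_const Complex.I).cexp
  have h := hl.mul he
  rw [funext (fibreCoord_eq (c := c) (k := k))]
  refine ⟨_, h, fun v => ?_⟩
  simp only [add_apply, smul_apply, ContinuousLinearMap.comp_apply, Complex.ofRealCLM_apply,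
    smul_eq_mul, ContinuousLinearMap.coe_fst', Function.comp_apply, ← Complex.ofReal_inv,
    ← Complex.ofReal_mul, Complex.add_im, Complex.ofReal_im, Complex.mul_im, Complex.I_re,
    Complex.I_im, Complex.ofReal_re]
  ring

/-- Off the axis, `dz₂ / z₂ = (dx + i dy) / (x + i y)`, while the imaginary part of
`dz₁ / z₁ - k dz₂ / z₂` is `dφ_k`. -/
theorem logForm_fderiv_ghCoord {q : ℝ × ℝ × ℝ × ℝ} (hq : q.2 ∈ patch c k) (h : horiz q.2 ≠ 0)
    (v : ℝ × ℝ × ℝ × ℝ) :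
    (ghCoord c i k q).1 ≠ 0 ∧ (ghCoord c i k q).2 ≠ 0 ∧
    logForm₂ (ghCoord c i k q) (fderiv ℝ (ghCoord c i k) q v) = horiz v.2 / horiz q.2 ∧
    (logForm₁ i (ghCoord c i k q) (fderiv ℝ (ghCoord c i k) q v)).im =
      v.1 + k.val * (horiz v.2 / horiz q.2).im := by
  obtain ⟨l, hl, hlv⟩ := hasLogDerivAt_horiz h
  obtain ⟨m, hm, hmv⟩ := hasLogDerivAt_fibreCoord hq
  have h1 := (hl.zpow ((i : ℤ) + 1 - k)).mul hm.inv
  have h2 := (hl.zpow ((k : ℤ) - i)).mul hm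
  have hF : fderiv ℝ (ghCoord c i k) q = _ := (h1.2.prodMk h2.2).fderiv
  have n1 : (ghCoord c i k q).1 ≠ 0 := h1.1
  have n2 : (ghCoord c i k q).2 ≠ 0 := h2.1
  have e1 : (fderiv ℝ (ghCoord c i k) q v).1 =
      (ghCoord c i k q).1 * (((i : ℂ) + 1 - k) * l v - m v) := by
    rw [hF]
    simp only [ContinuousLinearMap.prod_apply, smul_apply, add_apply, neg_apply, smul_eq_mul]
    push_cast
    rw [← sub_eq_add_neg]
    rfl
  have e2 : (fderiv ℝ (ghCoord c i k) q v).2 =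
      (ghCoord c i k q).2 * (((k : ℂ) - i) * l v + m v) := by
    rw [hF]
    simp only [ContinuousLinearMap.prod_apply, smul_apply, add_apply, neg_apply, smul_eq_mul]
    push_cast
    rfl
  refine ⟨n1, n2, ?_, ?_⟩
  · rw [logForm₂_apply, e1, e2, ← hlv]
    field_simp
    ring
  · have : logForm₁ i (ghCoord c i k q) (fderiv ℝ (ghCoord c i k) q v) =
        ((k.val : ℝ) : ℂ) * l v + m v := by
      rw [logForm₁_apply, e1, e2]
      field_simp
      push_cast
      ring
    rw [this, Complex.add_im, Complex.im_ofReal_mul, hmv, hlv]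
    ring

theorem eventually_position_ghCoord (hc : StrictMono c) {q : ℝ × ℝ × ℝ × ℝ} (hq : q.2 ∈ patch c k)
    (hi : InChart i k q.2) : ∀ᶠ y in nhds q, position c i (ghCoord c i k y) = y.2 := by
  filter_upwards [(isOpen_inChart_coord i).mem_nhds ⟨hq, hi⟩] with y hy
  exact position_chartCoord hc hy.1 hy.2 _

/-- In the coordinates of a patch, `dz₁ / z₁ - S dz₂ / z₂ = -V dz + i (dφ + A)`. -/
theorem etaForm_fderiv_ghCoord (hc : StrictMono c) {q : ℝ × ℝ × ℝ × ℝ} (hq : q.2 ∈ patch c k)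
    (h : horiz q.2 ≠ 0) (v : ℝ × ℝ × ℝ × ℝ) :
    etaForm (ghSlope c q.2) (logForm₁ i (ghCoord c i k q) (fderiv ℝ (ghCoord c i k) q v))
      (logForm₂ (ghCoord c i k q) (fderiv ℝ (ghCoord c i k) q v)) =
      ⟨-(ghPotential c q.2 * v.2.2.2), connectionForm c k q.2 v⟩ := by
  have hi : InChart i k q.2 := Or.inl h
  obtain ⟨n1, n2, h2, h1⟩ := logForm_fderiv_ghCoord (i := i) hq h v
  have hev := eventually_position_ghCoord (i := i) hc hq hi
  have hF := ((contDiffAt_ghCoord (i := i) hq hi).differentiableAt (by simp)).hasFDerivAt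
  have hz : HasFDerivAt (fun y => height c i (ghCoord c i k y)) _ q :=
    (differentiableAt_height i hc (ghCoord c i k q)).hasFDerivAt.comp q hF
  have hz' : HasFDerivAt (fun y : ℝ × ℝ × ℝ × ℝ => y.2.2.2) _ q :=
    ((ContinuousLinearMap.snd ℝ ℝ ℝ).comp ((ContinuousLinearMap.snd ℝ ℝ (ℝ × ℝ)).comp
      (ContinuousLinearMap.snd ℝ ℝ (ℝ × ℝ × ℝ)))).hasFDerivAt
  have e := congrArg (fun M => M v) (hz.unique (hz'.congr_of_eventuallyEq
    (hev.mono fun y hy => congrArg (fun p => p.2.2) hy)))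
  have e' := potential_mul_fderiv_height i hc n1 n2 (fderiv ℝ (ghCoord c i k) q v)
  rw [hev.self_of_nhds] at e'
  simp only [ContinuousLinearMap.comp_apply] at e
  rw [e] at e'
  apply Complex.ext
  · rw [etaForm, Complex.sub_re, Complex.re_ofReal_mul]
    change _ = -(ghPotential c q.2 * v.2.2.2)
    have : ghPotential c q.2 * v.2.2.2 = _ := e'
    rw [this]
    ring
  · rw [etaForm, Complex.sub_im, Complex.im_ofReal_mul, h1, h2, connectionForm_eq h]
    have : (horiz v.2 / horiz q.2).im =
        (q.2.1 * v.2.2.1 - q.2.2.1 * v.2.1) / horizSq q.2 := by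
      rw [Complex.div_im]
      simp only [horiz, horizSq]
      ring
    rw [this]
    ring

/-- Off the axis, the chart coordinates pull the metric of the chart back to the Gibbons–Hawking metric. -/
theorem chartMetric_ghCoord_off_axis (hc : StrictMono c) {q : ℝ × ℝ × ℝ × ℝ}
    (hq : q.2 ∈ patch c k) (h : horiz q.2 ≠ 0) (v w : ℝ × ℝ × ℝ × ℝ) :
    chartMetric c i (ghCoord c i k q) (fderiv ℝ (ghCoord c i k) q v)
      (fderiv ℝ (ghCoord c i k) q w) = ghMetric c k q.2 v w := by
  obtain ⟨n1, n2, h2, -⟩ := logForm_fderiv_ghCoord (i := i) hq h v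
  have h2' := (logForm_fderiv_ghCoord (i := i) hq h w).2.2.1
  have hpos := position_chartCoord hc hq (i := i) (Or.inl h) (Circle.exp q.1)
  have hV := ghPotential_pos i hc n1 n2
  rw [chartMetric_eq_logMetric i hc n1 n2]
  change position c i (ghCoord c i k q) = q.2 at hpos
  rw [hpos] at hV ⊢
  rw [logMetric, etaForm_fderiv_ghCoord hc hq h, etaForm_fderiv_ghCoord hc hq h, h2, h2', ghMetric]
  have e1 : (horiz v.2 / horiz q.2 * (starRingEnd ℂ) (horiz w.2 / horiz q.2)).re =
      (v.2.1 * w.2.1 + v.2.2.1 * w.2.2.1) / horizSq q.2 := by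
    have : horiz v.2 / horiz q.2 * (starRingEnd ℂ) (horiz w.2 / horiz q.2) =
        horiz v.2 * (starRingEnd ℂ) (horiz w.2) / ((horizSq q.2 : ℝ) : ℂ) := by
      rw [map_div₀, horizSq, Complex.normSq_eq_conj_mul_self]
      ring
    rw [this, Complex.div_ofReal_re]
    congr 1
    simp [horiz, Complex.mul_re]
  have hR := ((horizSq_pos_iff q.2).2 h).ne'
  rw [e1]
  simp only [Complex.mul_re, Complex.conj_re, Complex.conj_im]
  field_simp
  ring

/-- Off the axis, the chart coordinates are holomorphic for `J`, because `dz₁ / z₁ - S dz₂ / z₂` and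
`dz₂ / z₂` are of type `(1, 0)`. -/
theorem fderiv_ghCoord_ghJ_off_axis (hc : StrictMono c) {q : ℝ × ℝ × ℝ × ℝ}
    (hq : q.2 ∈ patch c k) (h : horiz q.2 ≠ 0) (v : ℝ × ℝ × ℝ × ℝ) :
    fderiv ℝ (ghCoord c i k) q (ghJ c k q.2 v) =
      Complex.I • fderiv ℝ (ghCoord c i k) q v := by
  obtain ⟨n1, n2, h2, -⟩ := logForm_fderiv_ghCoord (i := i) hq h v
  have h2' := (logForm_fderiv_ghCoord (i := i) hq h (ghJ c k q.2 v)).2.2.1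
  have hpos : position c i (ghCoord c i k q) = q.2 :=
    position_chartCoord hc hq (i := i) (Or.inl h) (Circle.exp q.1)
  have hV := ghPotential_pos i hc n1 n2
  rw [hpos] at hV
  have hη := etaForm_fderiv_ghCoord (i := i) hc hq h v
  have hη' := etaForm_fderiv_ghCoord (i := i) hc hq h (ghJ c k q.2 v)
  rw [connectionForm_ghJ] at hη'
  have hJ : (ghJ c k q.2 v).2 =
      (-v.2.2.1, v.2.1, 1 / ghPotential c q.2 * connectionForm c k q.2 v) := by
    simp [ghJ, horizontalLift]
  have l2 : logForm₂ (ghCoord c i k q) (fderiv ℝ (ghCoord c i k) q (ghJ c k q.2 v)) =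
      Complex.I * logForm₂ (ghCoord c i k q) (fderiv ℝ (ghCoord c i k) q v) := by
    rw [h2, h2', hJ, ← mul_div_assoc]
    congr 1
    apply Complex.ext <;> simp [horiz]
  have l1 : logForm₁ i (ghCoord c i k q) (fderiv ℝ (ghCoord c i k) q (ghJ c k q.2 v)) =
      Complex.I * logForm₁ i (ghCoord c i k q) (fderiv ℝ (ghCoord c i k) q v) := by
    have e : (⟨-(ghPotential c q.2 * (ghJ c k q.2 v).2.2.2), -(ghPotential c q.2 * v.2.2.2)⟩ : ℂ) =
        Complex.I * ⟨-(ghPotential c q.2 * v.2.2.2), connectionForm c k q.2 v⟩ := by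
      rw [hJ]
      apply Complex.ext
      · simp
        field_simp
      · simp
    rw [← hη, ← hη', etaForm, etaForm, l2] at e
    linear_combination e
  rw [← logForm₂_I] at l2
  rw [← logForm₁_I] at l1
  rw [logForm₂_apply, logForm₂_apply] at l2
  rw [logForm₁_apply, logForm₁_apply] at l1
  field_simp at l1 l2
  ext
  · refine mul_left_cancel₀ n2 ?_
    linear_combination ((i : ℂ) + 1) * l2 - l1
  · refine mul_left_cancel₀ n1 ?_
    linear_combination l1 - (i : ℂ) * l2

theorem continuous_rad (j : Fin n) : Continuous (rad c j) := by
  unfold rad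
  fun_prop

theorem continuousAt_ghPotential {q : ℝ × ℝ × ℝ × ℝ} (hq : q.2 ∈ patch c k) :
    ContinuousAt (fun y : ℝ × ℝ × ℝ × ℝ => ghPotential c y.2) q :=
  continuousAt_const.mul (tendsto_finsetSum _ fun j _ =>
    ContinuousAt.div continuousAt_const ((continuous_rad j).comp continuous_snd).continuousAt
      (rad_pos_of_mem_patch hq j).ne')

theorem continuousAt_connectionForm {q : ℝ × ℝ × ℝ × ℝ} (hq : q.2 ∈ patch c k)
    {v : ℝ × ℝ × ℝ × ℝ → ℝ × ℝ × ℝ × ℝ} (hv : ContinuousAt v q) :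
    ContinuousAt (fun y => connectionForm c k y.2 (v y)) q := by
  unfold connectionForm
  refine hv.fst.add (tendsto_finsetSum _ fun j _ => ?_)
  have hr : ContinuousAt (fun y : ℝ × ℝ × ℝ × ℝ => rad c j y.2) q :=
    ((continuous_rad j).comp continuous_snd).continuousAt
  have hs : ContinuousAt (fun y : ℝ × ℝ × ℝ × ℝ => y.2.2.2 - c j) q := by fun_prop
  have hx : ContinuousAt (fun y : ℝ × ℝ × ℝ × ℝ => y.2.1) q := by fun_prop
  have hy : ContinuousAt (fun y : ℝ × ℝ × ℝ × ℝ => y.2.2.1) q := by fun_prop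
  have hN := (hx.mul hv.snd.snd.fst).sub (hy.mul hv.snd.fst)
  have hr0 := rad_pos_of_mem_patch hq j
  split_ifs with hj
  · refine ContinuousAt.mul continuousAt_const (hN.div (hr.mul (hr.add hs)) ?_)
    have := rPlus_pos_of_mem_patch hq hj
    rw [← rad_add_eq] at this
    exact (mul_pos hr0 this).ne'
  · refine (ContinuousAt.mul continuousAt_const (hN.div (hr.mul (hr.sub hs)) ?_)).neg
    have := rMinus_pos_of_mem_patch hq hj
    rw [← rad_sub_eq] at this
    exact (mul_pos hr0 this).ne'

theorem ghPotential_ne_zero (i : Fin n) {q : ℝ × ℝ × ℝ × ℝ} (hq : q.2 ∈ patch c k) :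
    ghPotential c q.2 ≠ 0 :=
  (mul_pos (by norm_num) (Finset.sum_pos (fun j _ => one_div_pos.2 (rad_pos_of_mem_patch hq j))
    ⟨i, Finset.mem_univ i⟩)).ne'

theorem continuousAt_ghMetric (i : Fin n) {q : ℝ × ℝ × ℝ × ℝ} (hq : q.2 ∈ patch c k)
    (v w : ℝ × ℝ × ℝ × ℝ) : ContinuousAt (fun y : ℝ × ℝ × ℝ × ℝ => ghMetric c k y.2 v w) q :=
  ((continuousAt_const.div (continuousAt_ghPotential hq) (ghPotential_ne_zero i hq)).mul
    ((continuousAt_connectionForm hq continuousAt_const).mul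
      (continuousAt_connectionForm hq continuousAt_const))).add
    ((continuousAt_ghPotential hq).mul continuousAt_const)

theorem continuousAt_ghJ (i : Fin n) {q : ℝ × ℝ × ℝ × ℝ} (hq : q.2 ∈ patch c k)
    (v : ℝ × ℝ × ℝ × ℝ) : ContinuousAt (fun y : ℝ × ℝ × ℝ × ℝ => ghJ c k y.2 v) q := by
  have hV := continuousAt_ghPotential hq
  have hA : ContinuousAt (fun y : ℝ × ℝ × ℝ × ℝ => connectionForm c k y.2 v) q :=
    continuousAt_connectionForm hq continuousAt_const
  have hu : ContinuousAt (fun y : ℝ × ℝ × ℝ × ℝ => ((-v.2.2.1, v.2.1,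
      1 / ghPotential c y.2 * connectionForm c k y.2 v) : ℝ × ℝ × ℝ)) q :=
    continuousAt_const.prodMk (continuousAt_const.prodMk
      ((continuousAt_const.div hV (ghPotential_ne_zero i hq)).mul hA))
  exact ((hV.mul continuousAt_const).neg.prodMk continuousAt_const).add
    ((continuousAt_connectionForm hq (continuousAt_const.prodMk hu)).neg.prodMk hu)

/-- Continuous functions of `(φ, x, y, z)` that agree off the axis agree on it. -/
theorem eq_of_eq_off_axis {E : Type*} [TopologicalSpace E] [T2Space E]
    {f g : ℝ × ℝ × ℝ × ℝ → E} {q : ℝ × ℝ × ℝ × ℝ} (hf : ContinuousAt f q) (hg : ContinuousAt g q)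
    (h : ∀ᶠ y in nhds q, horiz y.2 ≠ 0 → f y = g y) : f q = g q := by
  have hd : Dense {y : ℝ × ℝ × ℝ × ℝ | horiz y.2 ≠ 0} := by
    have : Dense ((Set.univ : Set ℝ) ×ˢ (({0}ᶜ : Set ℝ) ×ˢ (Set.univ : Set (ℝ × ℝ)))) :=
      dense_univ.prod ((dense_compl_singleton 0).prod dense_univ)
    refine this.mono fun y hy h0 => hy.2.1 ?_
    exact congrArg Complex.re h0
  exact tendsto_nhds_unique_of_frequently_eq hf hg
    (((mem_closure_iff_frequently.1 (hd q)).and_eventually h).mono fun _ hy => hy.2 hy.1)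

theorem isGibbonsHawking_chartMetric (hc : StrictMono c) (hn : 1 ≤ n) :
    IsGibbonsHawking c (ghHomeomorph hc hn) (chartMetric c) := by
  intro i k
  have hmem : ∀ (q : ℝ × ℝ × ℝ × ℝ) (hq : q.2 ∈ patch c k),
      GHSpace.mk c k ⟨q.2, hq⟩ (Circle.exp q.1) ∈
        Set.range (ghHomeomorph hc hn ∘ GluedSurface.incl i) → InChart i k q.2 := by
    rintro q hq ⟨x, hx⟩
    exact ((chartMap_eq_mk_iff hc).1 hx).1
  refine ⟨ghCoord c i k, ?_, fun q hq hr => ?_⟩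
  · rintro q ⟨hq, hr⟩
    exact (contDiffAt_ghCoord hq (hmem q hq hr)).contDiffWithinAt
  have hi := hmem q hq hr
  have hS := (isOpen_inChart_coord (k := k) (c := c) i).mem_nhds ⟨hq, hi⟩
  have hF := contDiffAt_ghCoord (i := i) hq hi
  have hD : ContinuousAt (fderiv ℝ (ghCoord c i k)) q :=
    (hF.fderiv_right (m := 0) (by simp)).continuousAt
  have hDv : ∀ v, ContinuousAt (fun y => fderiv ℝ (ghCoord c i k) y v) q := fun v =>
    hD.clm_apply continuousAt_const
  refine ⟨chartMap_chartCoord hc ⟨q.2, hq⟩ hi _, fun v w => ?_, fun v => ?_⟩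
  · refine eq_of_eq_off_axis
      (f := fun y => chartMetric c i (ghCoord c i k y) (fderiv ℝ (ghCoord c i k) y v)
        (fderiv ℝ (ghCoord c i k) y w)) (g := fun y => ghMetric c k y.2 v w)
      ?_ (continuousAt_ghMetric i hq v w) ?_
    · have hG : ContinuousAt (fun y => chartMetric c i (ghCoord c i k y)) q :=
        (contDiff_chartMetric i hc).continuous.continuousAt.comp hF.continuousAt
      exact (hG.clm_apply (hDv v)).clm_apply (hDv w)
    · filter_upwards [hS] with y hy h
      exact chartMetric_ghCoord_off_axis hc hy.1 h v w
  · refine eq_of_eq_off_axis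
      (f := fun y => fderiv ℝ (ghCoord c i k) y (ghJ c k y.2 v))
      (g := fun y => Complex.I • fderiv ℝ (ghCoord c i k) y v)
      (hD.clm_apply (continuousAt_ghJ i hq v)) (show ContinuousAt (fun y => _) q from (hDv v).const_smul Complex.I) ?_
    filter_upwards [hS] with y hy h
    exact fderiv_ghCoord_ghJ_off_axis hc hy.1 h v

end GibbonsHawking

/-! ### The moment polygon -/

section Polygon

variable {n : ℕ} {c : Fin n → ℝ}

/-- The index `k` is the number of centers below the height `z`. -/
theorem exists_count (hc : StrictMono c) (z : ℝ) :
    ∃ k : Fin (n + 1), ∀ j : Fin n, j.val < k.val ↔ c j < z := by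
  by_cases h : ∃ j, z ≤ c j
  · obtain ⟨i, hi, hmin⟩ := WellFounded.has_min (wellFounded_lt (α := Fin n)) {j | z ≤ c j} h
    refine ⟨i.castSucc, fun j => ⟨fun hj => ?_, fun hj => ?_⟩⟩
    · by_contra hz
      exact hmin j (not_lt.1 hz) hj
    · exact hc.lt_iff_lt.1 (hj.trans_le hi)
  · push Not at h
    exact ⟨Fin.last n, fun j => ⟨fun _ => h j, fun _ => j.isLt⟩⟩

/-- The value of the `k`-th facet function is `½ ∑_{j < k} (r_j - (z - c_j)) +
½ ∑_{j ≥ k} (r_j + z - c_j)`. -/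
theorem facet_mu (k : Fin (n + 1)) (p : ℝ × ℝ × ℝ) :
    facet c k (mu c p) = ∑ j : Fin n, 1 / 2 * if j.val < k.val then
      rMinus (horizSq p) (p.2.2 - c j) else rPlus (horizSq p) (p.2.2 - c j) := by
  rw [facet, mu, Finset.mul_sum, ← Finset.sum_add_distrib]
  refine Finset.sum_congr rfl fun j _ => ?_
  rw [← rad_sub_eq, ← rad_add_eq]
  split_ifs <;> ring

theorem mu_mem_polygon (p : ℝ × ℝ × ℝ) : mu c p ∈ polygon c := fun k => by
  rw [facet_mu]
  refine Finset.sum_nonneg fun j _ => mul_nonneg (by norm_num) ?_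
  split_ifs
  · exact rMinus_nonneg (horizSq_nonneg p) _
  · exact rPlus_nonneg (horizSq_nonneg p) _

theorem range_proj (hc : StrictMono c) : Set.range (GHSpace.proj c) = Set.univ := by
  refine Set.eq_univ_of_forall fun p => ?_
  by_cases h : horiz p ≠ 0
  · exact ⟨GHSpace.mk c 0 ⟨p, Or.inl h⟩ 1, rfl⟩
  push Not at h
  by_cases hz : ∃ j, p.2.2 = c j
  · obtain ⟨j, hj⟩ := hz
    exact ⟨GHSpace.pt c j, Prod.ext (congrArg Complex.re h).symm
      (Prod.ext (congrArg Complex.im h).symm hj.symm)⟩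
  · push Not at hz
    obtain ⟨k, hk⟩ := exists_count hc p.2.2
    exact ⟨GHSpace.mk c k ⟨p, Or.inr fun j => ⟨(hk j).1, fun hj =>
      lt_of_le_of_ne (not_lt.1 fun h => absurd ((hk j).2 h) (not_lt.2 hj)) (hz j)⟩⟩ 1, rfl⟩

theorem convex_polygon : Convex ℝ (polygon c) := by
  intro a ha b hb s t hs ht hst k
  have : facet c k (s • a + t • b) = s * facet c k a + t * facet c k b := by
    simp only [facet, Prod.snd_add, Prod.smul_snd, Prod.fst_add, Prod.smul_fst, smul_eq_mul,
      mul_add, Finset.mul_sum]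
    rw [add_add_add_comm, ← Finset.sum_add_distrib]
    congr 1
    refine Finset.sum_congr rfl fun j _ => ?_
    split_ifs
    · linear_combination (-c j) * hst
    · ring
  rw [this]
  exact add_nonneg (mul_nonneg hs (ha k)) (mul_nonneg ht (hb k))

theorem continuous_facet (k : Fin (n + 1)) : Continuous (facet c k) := by
  refine continuous_snd.add (continuous_finsetSum _ fun j _ => ?_)
  split_ifs
  · fun_prop
  · fun_prop

/-- A point with positive facet functions is interior; where a facet function vanishes, decreasing `μ₂`
leads out of the polygon. -/
theorem frontier_polygon : frontier (polygon c) = ⋃ k, edge c k := by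
  have hcl : IsClosed (polygon c) := by
    have : polygon c = ⋂ k, {m | 0 ≤ facet c k m} := by ext m; simp [polygon]
    rw [this]
    exact isClosed_iInter fun k => isClosed_le continuous_const (continuous_facet k)
  rw [hcl.frontier_eq]
  ext m
  simp only [Set.mem_sdiff, Set.mem_iUnion]
  constructor
  · rintro ⟨hm, hi⟩
    by_contra! hne
    refine hi (mem_interior.2 ⟨⋂ k, {m | 0 < facet c k m}, fun x hx k =>
      (Set.mem_iInter.1 hx k : 0 < facet c k x).le,
      isOpen_iInter_of_finite fun k => isOpen_lt continuous_const (continuous_facet k),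
      Set.mem_iInter.2 fun k => lt_of_le_of_ne (hm k) fun h => hne k ⟨hm, h.symm⟩⟩)
  · rintro ⟨k, hm, h0⟩
    refine ⟨hm, fun hi => ?_⟩
    have ht : Filter.Tendsto (fun t : ℝ => (m.1, m.2 - t)) (nhdsWithin 0 (Set.Ioi 0)) (nhds m) := by
      have : Continuous fun t : ℝ => (m.1, m.2 - t) := by fun_prop
      have h := this.tendsto 0
      simp only [sub_zero] at h
      exact h.mono_left nhdsWithin_le_nhds
    obtain ⟨t, ht1, ht2⟩ :=
      ((ht.eventually (mem_interior_iff_mem_nhds.1 hi)).and self_mem_nhdsWithin).exists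
    have h1 : 0 ≤ facet c k (m.1, m.2 - t) := ht1 k
    have h2 : (0 : ℝ) < t := ht2
    rw [facet] at h0 h1
    simp only at h1
    linarith

theorem mu_center (hc : StrictMono c) (i : Fin n) : mu c (center c i) = vertex c i := by
  refine Prod.ext rfl ?_
  simp only [mu, vertex, Finset.mul_sum]
  refine Finset.sum_congr rfl fun j _ => ?_
  rw [rad_add_eq]
  have hz : horizSq (center c i) = 0 := by simp [horizSq_eq, center]
  rw [hz, rPlus, zero_add, Real.sqrt_sq_eq_abs]
  simp only [center]
  split_ifs with h
  · rw [abs_of_pos (sub_pos.2 (hc h))]; ring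
  · rw [abs_of_nonpos (sub_nonpos.2 (hc.monotone (not_lt.1 h)))]; ring

/-- On the axis, between the centers of index `k - 1` and `k`, the `k`-th facet function vanishes. -/
theorem facet_mu_axis {k : Fin (n + 1)} {z : ℝ}
    (hz : ∀ j : Fin n, (j.val < k.val → c j ≤ z) ∧ (k.val ≤ j.val → z ≤ c j)) :
    facet c k (mu c (0, 0, z)) = 0 := by
  rw [facet_mu]
  refine Finset.sum_eq_zero fun j _ => ?_
  have h0 : horizSq (0, 0, z) = 0 := by simp [horizSq_eq]
  rw [h0]
  split_ifs with hj
  · simp [rMinus, Real.sqrt_sq_eq_abs, abs_of_nonneg (sub_nonneg.2 ((hz j).1 hj))]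
  · simp only [rPlus, zero_add, Real.sqrt_sq_eq_abs,
      abs_of_nonpos (sub_nonpos.2 ((hz j).2 (not_lt.1 hj)))]
    ring

theorem mu_axis {k : Fin (n + 1)} {z : ℝ}
    (hz : ∀ j : Fin n, (j.val < k.val → c j ≤ z) ∧ (k.val ≤ j.val → z ≤ c j)) :
    mu c (0, 0, z) = (-z, ∑ j : Fin n, if j.val < k.val then z - c j else 0) := by
  have h := facet_mu_axis hz
  refine Prod.ext rfl ?_
  rw [facet, add_eq_zero_iff_eq_neg, ← Finset.sum_neg_distrib] at h
  rw [h]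
  refine Finset.sum_congr rfl fun j _ => ?_
  split_ifs
  · change -(-z + c j) = z - c j
    ring
  · exact neg_zero

/-- The image of `μ` is found by moving away from the axis at constant height. -/
theorem exists_mu_eq (hc : StrictMono c) (hn : 1 ≤ n) {m : ℝ × ℝ} (hm : m ∈ polygon c) :
    ∃ p, mu c p = m := by
  obtain ⟨k, hk⟩ := exists_count hc (-m.1)
  let f : ℝ → ℝ := fun t => (mu c (t, 0, -m.1)).2
  have hf : Continuous f := by
    refine continuous_const.mul (continuous_finsetSum _ fun j _ => ?_)
    exact ((continuous_rad j).comp (g := rad c j) (f := fun t : ℝ => (t, 0, -m.1))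
      (by fun_prop)).add (continuous_const (y := -m.1 - c j))
  have h0 : f 0 ≤ m.2 := by
    have h1 := hm k
    have h2 : facet c k (mu c (0, 0, -m.1)) = 0 := facet_mu_axis fun j =>
      ⟨fun hj => ((hk j).1 hj).le, fun hj => not_lt.1 fun h => absurd ((hk j).2 h) (not_lt.2 hj)⟩
    have h3 : (mu c (0, 0, -m.1)).1 = m.1 := neg_neg _
    rw [facet] at h1 h2
    rw [h3] at h2
    change (mu c (0, 0, -m.1)).2 ≤ m.2
    linarith
  have h1 : 0 ≤ m.2 := by simpa [facet] using hm 0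
  -- for `t = 2 μ₂ + |s|`, where `s` is the height above the first center, the summand `r + s` of that
  -- center is at least `2 μ₂`
  obtain ⟨u, hu⟩ : ∃ u : ℝ, u = 2 * m.2 := ⟨_, rfl⟩
  obtain ⟨s, hs⟩ : ∃ s : ℝ, s = -m.1 - c ⟨0, hn⟩ := ⟨_, rfl⟩
  have hu0 : 0 ≤ u := by linarith
  have ht : 0 ≤ u + |s| := by positivity
  have h2 : m.2 ≤ f (u + |s|) := by
    have hle : u ≤ rad c ⟨0, hn⟩ (u + |s|, 0, -m.1) + (-m.1 - c ⟨0, hn⟩) := by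
      have : u + |s| ≤ rad c ⟨0, hn⟩ (u + |s|, 0, -m.1) :=
        Real.le_sqrt_of_sq_le (by rw [← hs]; nlinarith [sq_nonneg s])
      rw [← hs]
      linarith [neg_abs_le s]
    have hsum := Finset.single_le_sum (s := Finset.univ) (a := (⟨0, hn⟩ : Fin n))
      (f := fun j => rad c j (u + |s|, 0, -m.1) + (-m.1 - c j)) (fun j _ => by
        have := rPlus_nonneg (horizSq_nonneg (u + |s|, 0, -m.1)) (-m.1 - c j)
        rwa [← rad_add_eq (p := (u + |s|, 0, -m.1))] at this) (Finset.mem_univ _)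
    change m.2 ≤ 1 / 2 * ∑ j, (rad c j (u + |s|, 0, -m.1) + (-m.1 - c j))
    linarith
  obtain ⟨t, -, ht⟩ := intermediate_value_Icc ht hf.continuousOn ⟨h0, h2⟩
  exact ⟨(t, 0, -m.1), Prod.ext (neg_neg _) ht⟩

theorem range_mu_proj (hc : StrictMono c) (hn : 1 ≤ n) {X : Type*} {f : X → GHSpace c}
    (hf : Function.Surjective f) :
    Set.range (fun y => mu c (GHSpace.proj c (f y))) = polygon c := by
  refine Set.Subset.antisymm ?_ fun m hm => ?_
  · rintro _ ⟨y, rfl⟩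
    exact mu_mem_polygon _
  · obtain ⟨p, rfl⟩ := exists_mu_eq hc hn hm
    obtain ⟨y, rfl⟩ : p ∈ Set.range (GHSpace.proj c) := by rw [range_proj hc]; trivial
    obtain ⟨x, rfl⟩ := hf y
    exact ⟨x, rfl⟩

/-- The edges are the images of the closed intervals into which the centers divide the axis. -/
theorem mem_edge_iff (hc : StrictMono c) {k : Fin (n + 1)} {m : ℝ × ℝ} :
    m ∈ edge c k ↔ ∃ z, (∀ j : Fin n, (j.val < k.val → c j ≤ z) ∧ (k.val ≤ j.val → z ≤ c j)) ∧
      m = mu c (0, 0, z) := by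
  have hdiff : ∀ j : Fin n, facet c j.succ m = facet c j.castSucc m + (m.1 + c j) := fun j => by
    simp only [facet, Fin.val_succ, Fin.val_castSucc, add_assoc]
    congr 1
    have : ∀ l : Fin n, (if l.val < j.val + 1 then m.1 + c l else 0) =
        (if l.val < j.val then m.1 + c l else 0) + if l = j then m.1 + c j else 0 := fun l => by
      rcases lt_trichotomy l j with h | rfl | h
      · simp [Nat.lt_succ_of_lt h, Fin.lt_def.1 h, h.ne]
      · simp
      · have h1 : ¬ l.val < j.val + 1 := by have := Fin.lt_def.1 h; omega
        have h2 : ¬ l.val < j.val := by omega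
        simp [h1, h2, h.ne']
    rw [Finset.sum_congr rfl fun l _ => this l, Finset.sum_add_distrib]
    simp
  constructor
  · rintro ⟨hm, h0⟩
    have hz : ∀ j : Fin n, (j.val < k.val → c j ≤ -m.1) ∧ (k.val ≤ j.val → -m.1 ≤ c j) := by
      refine fun j => ⟨fun hj => ?_, fun hj => ?_⟩
      · have hk : k.val - 1 < n := by omega
        have e : k = (⟨k.val - 1, hk⟩ : Fin n).succ := Fin.ext (by simp; omega)
        have h1 := hdiff ⟨k.val - 1, hk⟩
        rw [← e, h0] at h1
        have h2 := hm (⟨k.val - 1, hk⟩ : Fin n).castSucc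
        have h3 := hc.monotone (show j ≤ ⟨k.val - 1, hk⟩ from Fin.le_def.2 (by simp; omega))
        linarith
      · have hk : k.val < n := by omega
        have e : k = (⟨k.val, hk⟩ : Fin n).castSucc := rfl
        have h1 := hdiff ⟨k.val, hk⟩
        rw [← e, h0] at h1
        have h2 := hm (⟨k.val, hk⟩ : Fin n).succ
        have h3 := hc.monotone (show ⟨k.val, hk⟩ ≤ j from Fin.le_def.2 hj)
        linarith
    refine ⟨-m.1, hz, Prod.ext (neg_neg _).symm ?_⟩
    have h1 := facet_mu_axis hz
    have h3 : (mu c (0, 0, -m.1)).1 = m.1 := neg_neg _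
    rw [facet] at h0 h1
    rw [h3] at h1
    linarith
  · rintro ⟨z, hz, rfl⟩
    exact ⟨mu_mem_polygon _, facet_mu_axis hz⟩

theorem edge_zero (hc : StrictMono c) (hn : 1 ≤ n) :
    edge c 0 = {m | ∃ t : ℝ, 0 ≤ t ∧ m = vertex c ⟨0, hn⟩ + t • (1, 0)} := by
  have hv : vertex c ⟨0, hn⟩ = (-c ⟨0, hn⟩, 0) := by simp [vertex]
  ext m
  rw [mem_edge_iff hc, hv]
  constructor
  · rintro ⟨z, hz, rfl⟩
    refine ⟨c ⟨0, hn⟩ - z, sub_nonneg.2 ((hz _).2 (Nat.zero_le _)), ?_⟩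
    rw [mu_axis hz]
    refine Prod.ext ?_ ?_
    · simp only [Prod.fst_add, Prod.smul_fst, smul_eq_mul]
      ring
    · simp
  · rintro ⟨t, ht, rfl⟩
    have hz : ∀ j : Fin n, (j.val < (0 : Fin (n + 1)).val → c j ≤ c ⟨0, hn⟩ - t) ∧
        ((0 : Fin (n + 1)).val ≤ j.val → c ⟨0, hn⟩ - t ≤ c j) := fun j =>
      ⟨fun h => absurd h (Nat.not_lt_zero _), fun _ => by
        have := hc.monotone (show ⟨0, hn⟩ ≤ j from Fin.le_def.2 (Nat.zero_le _))
        linarith⟩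
    refine ⟨c ⟨0, hn⟩ - t, hz, ?_⟩
    rw [mu_axis hz]
    ext <;> simp
    ring

theorem edge_last (hc : StrictMono c) {l : Fin n} (hl : l.val + 1 = n) :
    edge c (Fin.last n) =
      {m | ∃ t : ℝ, 0 ≤ t ∧ m = vertex c l + t • (-1, (n : ℝ))} := by
  have hlast : ∀ j : Fin n, c j ≤ c l := fun j =>
    hc.monotone (Fin.le_def.2 (by omega))
  have hv : vertex c l =
      (-c l, ∑ j, (c l - c j)) := by
    refine Prod.ext rfl ?_
    simp only [vertex]
    refine Finset.sum_congr rfl fun j _ => ?_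
    split_ifs with h
    · rfl
    · have : j = l := Fin.ext (by omega)
      rw [← this, sub_self]
  have hμ : ∀ z, (∀ j : Fin n, (j.val < (Fin.last n).val → c j ≤ z) ∧
      ((Fin.last n).val ≤ j.val → z ≤ c j)) →
      mu c (0, 0, z) = vertex c l +
        (z - c l) • ((-1, (n : ℝ)) : ℝ × ℝ) := fun z hz => by
    rw [mu_axis hz, hv]
    refine Prod.ext (by simp only [Prod.fst_add, Prod.smul_fst, smul_eq_mul]; ring) ?_
    simp only [Fin.val_last, Fin.is_lt, if_true, Prod.snd_add, Prod.smul_snd, smul_eq_mul,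
      Finset.sum_sub_distrib, Finset.sum_const, Finset.card_univ, Fintype.card_fin, nsmul_eq_mul]
    ring
  ext m
  rw [mem_edge_iff hc]
  constructor
  · rintro ⟨z, hz, rfl⟩
    exact ⟨z - c l, sub_nonneg.2 ((hz _).1 (by simp)), hμ z hz⟩
  · rintro ⟨t, ht, rfl⟩
    have hz : ∀ j : Fin n, (j.val < (Fin.last n).val → c j ≤ c l + t) ∧
        ((Fin.last n).val ≤ j.val → c l + t ≤ c j) := fun j =>
      ⟨fun _ => by linarith [hlast j], fun h => absurd j.isLt (not_lt.2 h)⟩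
    refine ⟨c l + t, hz, ?_⟩
    rw [hμ _ hz, add_sub_cancel_left]

theorem vertex_ne (hc : StrictMono c) {i j : Fin n} (h : i ≠ j) : vertex c i ≠ vertex c j :=
  fun e => h (hc.injective (neg_injective (congrArg Prod.fst e)))

theorem edge_eq_segment (hc : StrictMono c) {i j : Fin n} (hij : i.val + 1 = j.val) :
    edge c j.castSucc = segment ℝ (vertex c i) (vertex c j) := by
  have hlt : c i < c j := hc (Fin.lt_def.2 (by omega))
  have harc : ∀ z, (∀ l : Fin n, (l.val < j.castSucc.val → c l ≤ z) ∧
      (j.castSucc.val ≤ l.val → z ≤ c l)) ↔ c i ≤ z ∧ z ≤ c j := fun z => by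
    refine ⟨fun h => ⟨(h i).1 (by simp; omega), (h j).2 le_rfl⟩, fun h l => ⟨fun hl => ?_, fun hl => ?_⟩⟩
    · exact (hc.monotone (Fin.le_def.2 (by simp at hl; omega))).trans h.1
    · exact h.2.trans (hc.monotone (Fin.le_def.2 hl))
  have hv : ∀ l : Fin n, c i ≤ c l → c l ≤ c j → vertex c l =
      (-c l, ∑ l' : Fin n, if l'.val < j.castSucc.val then c l - c l' else 0) := fun l h1 h2 => by
    rw [← mu_center hc, ← mu_axis ((harc _).2 ⟨h1, h2⟩)]
    rfl
  have hμ : ∀ t ∈ Set.Icc (0 : ℝ) 1, mu c (0, 0, c i + t * (c j - c i)) =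
      (1 - t) • vertex c i + t • vertex c j := fun t ht => by
    rw [mu_axis ((harc _).2 ⟨by nlinarith [ht.1], by nlinarith [ht.2]⟩), hv i le_rfl hlt.le,
      hv j hlt.le le_rfl]
    refine Prod.ext ?_ ?_
    · simp only [Prod.fst_add, Prod.smul_fst, smul_eq_mul]
      ring
    · simp only [Prod.snd_add, Prod.smul_snd, smul_eq_mul, Finset.mul_sum,
        ← Finset.sum_add_distrib]
      refine Finset.sum_congr rfl fun l _ => ?_
      split_ifs <;> ring
  ext m
  rw [mem_edge_iff hc, segment_eq_image]
  constructor
  · rintro ⟨z, hz, rfl⟩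
    obtain ⟨h1, h2⟩ := (harc z).1 hz
    have hpos : 0 < c j - c i := sub_pos.2 hlt
    have ht : (z - c i) / (c j - c i) ∈ Set.Icc (0 : ℝ) 1 :=
      ⟨div_nonneg (by linarith) hpos.le, (div_le_one hpos).2 (by linarith)⟩
    refine ⟨_, ht, ?_⟩
    have := hμ _ ht
    rw [div_mul_cancel₀ _ hpos.ne', add_sub_cancel] at this
    exact this.symm
  · rintro ⟨t, ht, rfl⟩
    exact ⟨c i + t * (c j - c i), (harc _).2 ⟨by nlinarith [ht.1], by nlinarith [ht.2]⟩,
      (hμ t ht).symm⟩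

/-- The vertices on an edge are the images of the end points of the corresponding interval. -/
theorem mu_axis_mem_vertex_image (hc : StrictMono c) {s : Set (Fin n)} {z : ℝ} :
    mu c (0, 0, z) ∈ vertex c '' s ↔ ∃ j ∈ s, c j = z := by
  constructor
  · rintro ⟨j, hj, h⟩
    exact ⟨j, hj, neg_injective (congrArg Prod.fst h)⟩
  · rintro ⟨j, hj, rfl⟩
    exact ⟨j, hj, (mu_center hc j).symm⟩

/-- The `α_i`-axis lies over the part of the axis from `c i` up to, but not including, the next center. -/
theorem mu_fst_axis (hc : StrictMono c) (hn : 1 ≤ n) (i : Fin n) :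
    (fun α : ℂ => mu c (GHSpace.proj c (ghHomeomorph hc hn (GluedSurface.incl i (α, 0))))) ''
      Set.univ = edge c i.succ \ (vertex c '' Set.Ioi i) := by
  have hp : ∀ α : ℂ, GHSpace.proj c (ghHomeomorph hc hn (GluedSurface.incl i (α, 0))) =
      (0, 0, height c i (α, 0)) := fun α => by
    rw [ghHomeomorph_incl, proj_chartMap, position]
    simp
  rw [Set.image_univ]
  ext m
  constructor
  · rintro ⟨α, rfl⟩
    simp only [hp]
    have hlo : c i ≤ height c i (α, 0) := le_height_of_snd_eq_zero hc rfl
    have hhi : ∀ j, i < j → height c i (α, 0) < c j := fun j hj => by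
      have := rMinus_height_pos i hc hj (α, 0)
      rw [rMinus_pos_iff (modSq_nonneg _)] at this
      simpa [modSq] using this
    refine ⟨(mem_edge_iff hc).2 ⟨_, fun j => ⟨fun hj => ?_, fun hj => ?_⟩, rfl⟩, fun h => ?_⟩
    · exact (hc.monotone (Fin.le_def.2 (by simp at hj; omega))).trans hlo
    · exact (hhi j (Fin.lt_def.2 (by simp at hj; omega))).le
    · obtain ⟨j, hj, e⟩ := (mu_axis_mem_vertex_image hc).1 h
      exact (hhi j hj).ne' e
  · rintro ⟨hm, hv⟩
    obtain ⟨z, hz, rfl⟩ := (mem_edge_iff hc).1 hm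
    rw [mu_axis_mem_vertex_image hc] at hv
    push Not at hv
    have hi : c i ≤ z := (hz i).1 (by simp)
    rcases hi.eq_or_lt with rfl | hi
    · refine ⟨0, ?_⟩
      have h0 : height c i (0, 0) = c i := by rw [height_eq i hc]; simp
      simp only [hp, h0]
    · have hq : ((0, 0, z) : ℝ × ℝ × ℝ) ∈ patch c i.succ := Or.inr fun j => ⟨fun hj =>
        (hc.monotone (Fin.le_def.2 (by simp at hj; omega))).trans_lt hi, fun hj =>
        lt_of_le_of_ne ((hz j).2 hj) (hv j (Fin.lt_def.2 (by simp at hj; omega))).symm⟩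
      have hI : InChart i i.succ (0, 0, z) := Or.inr (Or.inr rfl)
      have hh : horiz (0, 0, z) = 0 := rfl
      have h2 : (chartCoord c i i.succ (0, 0, z) 1).2 = 0 := by simp [chartCoord, hh]
      refine ⟨(chartCoord c i i.succ (0, 0, z) 1).1, ?_⟩
      have e := position_chartCoord hc hq hI 1
      simp only [ghHomeomorph_incl, proj_chartMap]
      rw [← h2, e]

/-- The `β_i`-axis lies over the part of the axis from `c i` down to, but not including, the previous
center. -/
theorem mu_snd_axis (hc : StrictMono c) (hn : 1 ≤ n) (i : Fin n) :
    (fun β : ℂ => mu c (GHSpace.proj c (ghHomeomorph hc hn (GluedSurface.incl i (0, β))))) ''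
      Set.univ = edge c i.castSucc \ (vertex c '' Set.Iio i) := by
  have hp : ∀ β : ℂ, GHSpace.proj c (ghHomeomorph hc hn (GluedSurface.incl i (0, β))) =
      (0, 0, height c i (0, β)) := fun β => by
    rw [ghHomeomorph_incl, proj_chartMap, position]
    simp
  rw [Set.image_univ]
  ext m
  constructor
  · rintro ⟨β, rfl⟩
    simp only [hp]
    have hhi : height c i (0, β) ≤ c i := height_le_of_fst_eq_zero hc rfl
    have hlo : ∀ j, j < i → c j < height c i (0, β) := fun j hj => by
      have := rPlus_height_pos i hc hj (0, β)
      rw [rPlus_pos_iff (modSq_nonneg _)] at this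
      simpa [modSq] using this
    refine ⟨(mem_edge_iff hc).2 ⟨_, fun j => ⟨fun hj => ?_, fun hj => ?_⟩, rfl⟩, fun h => ?_⟩
    · exact (hlo j hj).le
    · exact hhi.trans (hc.monotone hj)
    · obtain ⟨j, hj, e⟩ := (mu_axis_mem_vertex_image hc).1 h
      exact (hlo j hj).ne e
  · rintro ⟨hm, hv⟩
    obtain ⟨z, hz, rfl⟩ := (mem_edge_iff hc).1 hm
    rw [mu_axis_mem_vertex_image hc] at hv
    push Not at hv
    have hi : z ≤ c i := (hz i).2 le_rfl
    rcases hi.eq_or_lt with rfl | hi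
    · refine ⟨0, ?_⟩
      have h0 : height c i (0, 0) = c i := by rw [height_eq i hc]; simp
      simp only [hp, h0]
    · have hq : ((0, 0, z) : ℝ × ℝ × ℝ) ∈ patch c i.castSucc := Or.inr fun j => ⟨fun hj =>
        lt_of_le_of_ne ((hz j).1 hj) (hv j hj), fun hj => hi.trans_le (hc.monotone hj)⟩
      have hI : InChart i i.castSucc (0, 0, z) := Or.inr (Or.inl rfl)
      have hh : horiz (0, 0, z) = 0 := rfl
      have h1 : (chartCoord c i i.castSucc (0, 0, z) 1).1 = 0 := by simp [chartCoord, hh]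
      refine ⟨(chartCoord c i i.castSucc (0, 0, z) 1).2, ?_⟩
      have e := position_chartCoord hc hq hI 1
      simp only [ghHomeomorph_incl, proj_chartMap]
      rw [← h1, e]

end Polygon

theorem mainTheorem3 (n : ℕ) (hn : 1 ≤ n) (c : Fin n → ℝ) (hc : StrictMono c) :
    -- the surface glued from `n` copies of `ℂ²` is the toric crepant resolution of `ℂ² / ℤ_n`
    (∃ π : GluedSurface n → CyclicQuotient n, IsToricCrepantResolution n π) ∧
    -- the toric Gibbons–Hawking space is this surface
    ∃ Φ : GluedSurface n ≃ₜ GHSpace c,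
      -- it is covered by the `n` charts, with the stated coordinate changes
      (∀ i : Fin n, Topology.IsOpenEmbedding fun x => Φ (GluedSurface.incl i x)) ∧
      (∀ y : GHSpace c, ∃ i x, Φ (GluedSurface.incl i x) = y) ∧
      (∀ i j : Fin n, i.val + 1 = j.val → ∀ x y : ℂ × ℂ,
        Φ (GluedSurface.incl i x) = Φ (GluedSurface.incl j y) ↔
          x.1 ≠ 0 ∧ y = (x.1 ^ 2 * x.2, x.1⁻¹)) ∧
      -- the first chart is `(z₂ / z₁, z₁)` with `z₂ = x + i y`
      (∀ (p : patch c 0) (e : Circle),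
        Φ (GluedSurface.incl ⟨0, hn⟩ (horiz p / ghZ₁ c p e, ghZ₁ c p e)) = GHSpace.mk c 0 p e) ∧
      -- the torus acts by translation of `φ` and rotation about the `z`-axis
      (∀ (t₁ t₂ : Circle) (k : Fin (n + 1)) (p : patch c k) (e : Circle),
        Φ ((Circle.toUnits t₁, Circle.toUnits t₂) • Φ.symm (GHSpace.mk c k p e)) =
          GHSpace.mk c k ⟨rotate t₂ p, rotate_mem c k t₂ p⟩ (t₁ * (t₂ ^ k.val)⁻¹ * e)) ∧
      ∃ G : ChartTensor n,
        -- the Gibbons–Hawking metric extends to a Ricci-flat Kähler metric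
        IsGibbonsHawking c Φ G ∧ IsKahlerMetric n G ∧ IsRicciFlat n G ∧
        -- Kähler potential
        (∃ C₁ C₂ : ℝ, ∀ (i : Fin n) (x : ℂ × ℂ),
          (∀ j, 0 < rad c j (GHSpace.proj c (Φ (GluedSurface.incl i x))) -
            ((GHSpace.proj c (Φ (GluedSurface.incl i x))).2.2 - c j)) →
          ContDiffAt ℝ ∞ (fun y =>
            kahlerPotential c C₁ C₂ (GHSpace.proj c (Φ (GluedSurface.incl i y)))) x ∧
          ∀ v w, (fundamentalForm (G i) x v w : ℂ) = iDDbar (fun y =>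
            kahlerPotential c C₁ C₂ (GHSpace.proj c (Φ (GluedSurface.incl i y)))) x v w) ∧
        -- moment map
        IsMomentMap n G (fun y => mu c (GHSpace.proj c (Φ y))) ∧
        -- its image
        Set.range (fun y => mu c (GHSpace.proj c (Φ y))) = polygon c ∧
        Convex ℝ (polygon c) ∧
        frontier (polygon c) = ⋃ k, edge c k ∧
        edge c 0 = {m | ∃ t : ℝ, 0 ≤ t ∧ m = vertex c ⟨0, hn⟩ + t • (1, 0)} ∧
        (∀ i j : Fin n, i.val + 1 = j.val →
          vertex c i ≠ vertex c j ∧ edge c j.castSucc = segment ℝ (vertex c i) (vertex c j)) ∧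
        edge c (Fin.last n) =
          {m | ∃ t : ℝ, 0 ≤ t ∧ m = vertex c ⟨n - 1, by omega⟩ + t • (-1, (n : ℝ))} ∧
        -- the axis `β_i = 0` maps to the edge after the one to which the axis `α_i = 0` maps
        -- (onto the edge, up to its end point that is not the image of the origin, if any)
        ∀ i : Fin n,
          (fun α : ℂ => mu c (GHSpace.proj c (Φ (GluedSurface.incl i (α, 0))))) '' Set.univ =
            edge c i.succ \ (vertex c '' Set.Ioi i) ∧
          (fun β : ℂ => mu c (GHSpace.proj c (Φ (GluedSurface.incl i (0, β))))) '' Set.univ =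
            edge c i.castSucc \ (vertex c '' Set.Iio i) := by
  refine ⟨⟨resolution hn, isToricCrepantResolution hc hn⟩, ghHomeomorph hc hn,
    fun i => isOpenEmbedding_chartMap hc i, fun y => exists_chartMap_eq hc hn y,
    fun i j hij x y => chartMap_eq_iff_transition hc hij x y,
    fun p e => chartMap_first hc hn p e, fun t₁ t₂ k p e => ghHomeomorph_smul hc hn t₁ t₂ k p e,
    chartMetric c, isGibbonsHawking_chartMetric hc hn, isKahlerMetric_chartMetric hc,
    isRicciFlat_chartMetric hc, exists_kahlerPotential hc hn, isMomentMap_mu hc hn,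
    range_mu_proj hc hn (ghHomeomorph hc hn).surjective, convex_polygon, frontier_polygon,
    edge_zero hc hn, fun i j hij => ⟨vertex_ne hc fun h => ?_, edge_eq_segment hc hij⟩,
    edge_last hc (Nat.sub_add_cancel hn), fun i => ⟨mu_fst_axis hc hn i, mu_snd_axis hc hn i⟩⟩
  rw [h] at hij
  omega
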